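/- Let $V(\phi)=V_0e^{-\nu\phi}$ with $V_0>0$, $\nu\in\mathbb R$. Then the system $$x'=-2x-\sqrt{\tfrac32}\,\tfrac{V'}{V}\,y^2-xy^2+2x^3,\qquad y'=y+\sqrt{\tfrac32}\,\tfrac{V'}{V}\,xy+2x^2y-y^3$$ becomes the planar autonomous system $$x'=-2x+\sqrt{\tfrac32}\,\nu y^2-xy^2+2x^3,\qquad y'=y-\sqrt{\tfrac32}\,\nu xy+2x^2y-y^3. \tag{$*$}$$ **Critical points.** The critical points of $(*)$ are exactly $P_0=(0,0)$, $P_1=(1,0)$, $P_2=(-1,0)$; $P_{3}=\big(\tfrac{\nu}{\sqrt6},\sqrt{1-\tfrac{\nu^2}{6}}\big)$ and $P_4=\big(\tfrac{\nu}{\sqrt6},-\sqrt{1-\tfrac{\nu^2}{6}}\big)$ if $\nu^2\le 6$; $P_{5}=\big(\tfrac1\nu\sqrt{\tfrac23},\tfrac{2}{\sqrt3\,\nu}\big)$ and $P_6=\big(\tfrac1\nu\sqrt{\tfrac23},-\tfrac{2}{\sqrt3\,\nu}\big)$ if $\nu\neq0$. **Eigenvalues of the Jacobian** (with multiplicity).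 $P_0$: $-2,\,1$. $P_1$: $4,\;3-\sqrt{3/2}\,\nu$. $P_2$: $4,\;3+\sqrt{3/2}\,\nu$. $P_3,P_4$ ($\nu^2\le 6$): $-2+\nu^2,\;\tfrac12(\nu^2-6)$. $P_5,P_6$ ($\nu\ne0$): $\dfrac{-\nu^2\pm\sqrt{(8-3\nu^2)\nu^2}}{\nu^2}$ (complex square root). **Terminology.** A critical point $p$ is a *stable node* if it is asymptotically stable and every trajectory in a deleted neighbourhood tends to $p$ with a well-defined limiting direction; an *unstable node* if this holds after time reversal; a *spiral sink* if it is asymptotically stable and along every trajectory in a deleted neighbourhood the continuous polar angle around $p$ tends to $\pm\infty$ in time; a *saddle* if exactly two trajectories tend to $p$ as $t\to\infty$, exactly two as $t\to-\infty$, and all others in a small deleted neighbourhood leave it in both time directions; a *saddle-node* if a neighbourhood of $p$ consists of two hyperbolic sectors and one parabolic sector. **Classification.** - $P_0$ is a saddle for all $\nu$. - $P_1$ is an unstable node for $\nu<\sqrt6$ and a saddle for $\nu\ge\sqrt6$. $P_2$ is an unstable node for $\nu>-\sqrt6$ and a saddle for $\nu\le-\sqrt6$. - $P_3$ and $P_4$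 are stable nodes for $\nu^2<2$, saddle-nodes for $\nu^2=2$, and saddles for $2<\nu^2\le 6$. - $P_5$ and $P_6$ are saddles for $0<\nu^2<2$, saddle-nodes for $\nu^2=2$, stable nodes for $2<\nu^2\le\tfrac83$, and spiral sinks for $\nu^2>\tfrac83$. **Center manifold expansions at the non-hyperbolic values.** A local center manifold below means a $C^2$ locally invariant curve through the critical point, tangent there to the kernel of the Jacobian. - For $\nu=\sqrt6$, in coordinates $(x,y)=P_1+(X,Y)$, every local center manifold of $P_1$ is $X=-\tfrac12Y^2+O(Y^3)$ with flow $Y'=-\tfrac32Y^3+O(Y^4)$. For $\nu=-\sqrt6$, in coordinates $(x,y)=P_2+(X,Y)$, every local center manifold of $P_2$ is $X=\tfrac12Y^2+O(Y^3)$ with the same flow $Y'=-\tfrac32Y^3+O(Y^4)$. In both cases the Jacobian has eigenvectors $(1,0)$ (eigenvalue $4$) and $(0,1)$ (eigenvalue $0$). - For $\nu^2=2$, the Jacobian at $P_3$ (resp. $P_4$) has eigenvectors $u=(\mp\nu,1)$ for $-2$ and $w=(\pm2\nu,1)$ for $0$ (upper sign for $P_3$, lower for $P_4$), and in coordinates $P_{3}+Uu+Vw$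 (resp. $P_4+Uu+Vw$) every local center manifold is $U=\pm\sqrt{\tfrac32}\,V^2+O(V^3)$, with flow $V'=\pm4\sqrt6\,V^2+O(V^3)$. -/

import Mathlib

open Set Filter Topology Asymptotics

namespace ScalarFieldCosmology

noncomputable section

/-! ### The planar system -/

/-- The exponential potential `V(φ) = V₀ e^{-νφ}`. -/
def expPotential (V₀ ν : ℝ) (φ : ℝ) : ℝ := V₀ * Real.exp (-(ν * φ))

/-- Right-hand side of the `(x, y)` evolution equations for a general potential `V`, at the field
value `φ`:
`x' = -2x - √(3/2) (V'/V) y² - x y² + 2x³`, `y' = y + √(3/2) (V'/V) x y + 2x² y - y³`. -/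
def generalSystem (V : ℝ → ℝ) (φ : ℝ) (p : ℝ × ℝ) : ℝ × ℝ :=
  (-2 * p.1 - √(3 / 2) * (deriv V φ / V φ) * p.2 ^ 2 - p.1 * p.2 ^ 2 + 2 * p.1 ^ 3,
    p.2 + √(3 / 2) * (deriv V φ / V φ) * p.1 * p.2 + 2 * p.1 ^ 2 * p.2 - p.2 ^ 3)

/-- The autonomous planar vector field of the exponential model:
`x' = -2x + √(3/2) ν y² - x y² + 2x³`, `y' = y - √(3/2) ν x y + 2x² y - y³`. -/
def expSystem (ν : ℝ) (p : ℝ × ℝ) : ℝ × ℝ :=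
  (-2 * p.1 + √(3 / 2) * ν * p.2 ^ 2 - p.1 * p.2 ^ 2 + 2 * p.1 ^ 3,
    p.2 - √(3 / 2) * ν * p.1 * p.2 + 2 * p.1 ^ 2 * p.2 - p.2 ^ 3)

def P0 : ℝ × ℝ := (0, 0)
def P1 : ℝ × ℝ := (1, 0)
def P2 : ℝ × ℝ := (-1, 0)
/-- Exists for `ν² ≤ 6`. -/
def P3 (ν : ℝ) : ℝ × ℝ := (ν / √6, √(1 - ν ^ 2 / 6))
/-- Exists for `ν² ≤ 6`. -/
def P4 (ν : ℝ) : ℝ × ℝ := (ν / √6, -√(1 - ν ^ 2 / 6))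
/-- Exists for `ν ≠ 0`. -/
def P5 (ν : ℝ) : ℝ × ℝ := (1 / ν * √(2 / 3), 2 / (√3 * ν))
/-- Exists for `ν ≠ 0`. -/
def P6 (ν : ℝ) : ℝ × ℝ := (1 / ν * √(2 / 3), -(2 / (√3 * ν)))

/-! ### Jacobian eigenvalues -/

/-- The complex eigenvalues, with algebraic multiplicity, of the Jacobian of `F` at `p`. -/
def eigenvalues (F : ℝ × ℝ → ℝ × ℝ) (p : ℝ × ℝ) : Multiset ℂ :=
  (((fderiv ℝ F p : ℝ × ℝ →L[ℝ] ℝ × ℝ) : ℝ × ℝ →ₗ[ℝ] ℝ × ℝ).charpoly.map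
    (algebraMap ℝ ℂ)).roots

/-! ### Trajectories of a planar vector field

Backward trajectories of `F` are forward trajectories of the time-reversed field `-F`. -/

/-- `γ`, restricted to `[0, ∞)`, is a forward trajectory of `F` starting at `q`. -/
def IsForwardTrajectory (F : ℝ × ℝ → ℝ × ℝ) (γ : ℝ → ℝ × ℝ) (q : ℝ × ℝ) : Prop :=
  IsIntegralCurveOn γ (fun _ => F) (Ici 0) ∧ γ 0 = q

/-- `γ`, restricted to `[0, ∞)`, is a nonconstant forward half-trajectory approaching `p`. -/
def Approaches (F : ℝ × ℝ → ℝ × ℝ) (γ : ℝ → ℝ × ℝ) (p : ℝ × ℝ) : Prop :=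
  IsIntegralCurveOn γ (fun _ => F) (Ici 0) ∧ (∀ t, 0 ≤ t → γ t ≠ p) ∧ Tendsto γ atTop (𝓝 p)

/-- The set of points of a half-trajectory. -/
def halfOrbit (γ : ℝ → ℝ × ℝ) : Set (ℝ × ℝ) := γ '' Ici 0

/-- The forward trajectory of `q` leaves the set `N`. -/
def Leaves (F : ℝ × ℝ → ℝ × ℝ) (N : Set (ℝ × ℝ)) (q : ℝ × ℝ) : Prop :=
  ∃ (γ : ℝ → ℝ × ℝ) (T : ℝ), 0 ≤ T ∧ IsIntegralCurveOn γ (fun _ => F) (Icc 0 T) ∧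
    γ 0 = q ∧ γ T ∉ N

/-- The points whose forward trajectory stays in `N` and converges to `p`. -/
def localStableSet (F : ℝ × ℝ → ℝ × ℝ) (N : Set (ℝ × ℝ)) (p : ℝ × ℝ) : Set (ℝ × ℝ) :=
  {q | ∃ γ, IsForwardTrajectory F γ q ∧ (∀ t, 0 ≤ t → γ t ∈ N) ∧ Tendsto γ atTop (𝓝 p)}

/-! ### Types of critical points -/

/-- `p` is a critical point that is Lyapunov stable and locally attracting. -/
def IsAsymptoticallyStable (F : ℝ × ℝ → ℝ × ℝ) (p : ℝ × ℝ) : Prop :=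
  F p = 0 ∧
  (∀ ε > 0, ∃ δ > 0, ∀ q ∈ Metric.ball p δ,
    ∃ γ, IsForwardTrajectory F γ q ∧ ∀ t, 0 ≤ t → γ t ∈ Metric.ball p ε) ∧
  (∃ δ > 0, ∀ q ∈ Metric.ball p δ, ∃ γ, IsForwardTrajectory F γ q ∧ Tendsto γ atTop (𝓝 p))

/-- Stable node: asymptotically stable, and every trajectory in a deleted neighbourhood approaches
`p` along a well-defined limiting direction. -/
def IsStableNode (F : ℝ × ℝ → ℝ × ℝ) (p : ℝ × ℝ) : Prop :=
  IsAsymptoticallyStable F p ∧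
  ∃ δ > 0, ∀ q ∈ Metric.ball p δ, q ≠ p →
    ∃ γ, IsForwardTrajectory F γ q ∧ Tendsto γ atTop (𝓝 p) ∧
      ∃ v : ℝ × ℝ, v ≠ 0 ∧ Tendsto (fun t => ‖γ t - p‖⁻¹ • (γ t - p)) atTop (𝓝 v)

/-- Unstable node: a stable node of the time-reversed field. -/
def IsUnstableNode (F : ℝ × ℝ → ℝ × ℝ) (p : ℝ × ℝ) : Prop := IsStableNode (-F) p

/-- Spiral sink (stable focus): asymptotically stable, and every trajectory in a deleted
neighbourhood winds infinitely often around `p`: its continuous polar angle `θ` satisfies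
`|θ(t)| → ∞`. -/
def IsSpiralSink (F : ℝ × ℝ → ℝ × ℝ) (p : ℝ × ℝ) : Prop :=
  IsAsymptoticallyStable F p ∧
  ∃ δ > 0, ∀ q ∈ Metric.ball p δ, q ≠ p →
    ∃ γ, IsForwardTrajectory F γ q ∧ Tendsto γ atTop (𝓝 p) ∧
      ∃ r θ : ℝ → ℝ, ContinuousOn r (Ici 0) ∧ ContinuousOn θ (Ici 0) ∧
        (∀ t, 0 ≤ t → 0 < r t ∧ γ t = p + (r t * Real.cos (θ t), r t * Real.sin (θ t))) ∧
        Tendsto (fun t => |θ t|) atTop atTop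

/-- (Topological) saddle: exactly two trajectories `γ₁, γ₂` approach `p` as `t → ∞`, exactly two
trajectories `γ₃, γ₄` approach `p` as `t → -∞`, and all other trajectories through a deleted
neighbourhood `N \ {p}` leave `N` both as time increases and as time decreases. -/
def IsSaddle (F : ℝ × ℝ → ℝ × ℝ) (p : ℝ × ℝ) : Prop :=
  F p = 0 ∧ ∃ γ₁ γ₂ γ₃ γ₄ : ℝ → ℝ × ℝ,
    Approaches F γ₁ p ∧ Approaches F γ₂ p ∧ Approaches (-F) γ₃ p ∧ Approaches (-F) γ₄ p ∧
    [halfOrbit γ₁, halfOrbit γ₂, halfOrbit γ₃, halfOrbit γ₄].Pairwise Disjoint ∧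
    ∃ N ∈ 𝓝 p, ∀ q ∈ N, q ≠ p →
      (q ∈ halfOrbit γ₁ ∪ halfOrbit γ₂ ∨ Leaves F N q) ∧
      (q ∈ halfOrbit γ₃ ∪ halfOrbit γ₄ ∨ Leaves (-F) N q)

/-- Saddle-node with attracting parabolic sector. In a suitable open neighbourhood `N` of `p`:
exactly one trajectory `ω` emanates from `p` and every other point of `N \ {p}` leaves `N` backward
in time; every point leaves `N` forward in time or stays in `N` and converges to `p`; the points of
the latter kind form a sector with interior points arbitrarily close to `p` (the parabolic sector),
bounded exactly by `p` and two trajectories `α, β` converging to `p`. The complement of that sector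
is cut by `ω` into the two hyperbolic sectors. -/
def IsAttractingSaddleNode (F : ℝ × ℝ → ℝ × ℝ) (p : ℝ × ℝ) : Prop :=
  F p = 0 ∧ ∃ α β ω : ℝ → ℝ × ℝ,
    Approaches F α p ∧ Approaches F β p ∧ Approaches (-F) ω p ∧
    [halfOrbit α, halfOrbit β, halfOrbit ω].Pairwise Disjoint ∧
    ∃ N : Set (ℝ × ℝ), IsOpen N ∧ p ∈ N ∧
      (∀ q ∈ N, q ≠ p → q ∈ halfOrbit ω ∨ Leaves (-F) N q) ∧
      (∀ q ∈ N, q ∈ localStableSet F N p ∨ Leaves F N q) ∧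
      p ∈ closure (interior (localStableSet F N p)) ∧
      N ∩ frontier (localStableSet F N p) = N ∩ ({p} ∪ halfOrbit α ∪ halfOrbit β)

/-- Saddle-node: two hyperbolic sectors and one (attracting or repelling) parabolic sector. -/
def IsSaddleNode (F : ℝ × ℝ → ℝ × ℝ) (p : ℝ × ℝ) : Prop :=
  IsAttractingSaddleNode F p ∨ IsAttractingSaddleNode (-F) p

/-! ### Center manifolds -/

/-- The curve `s ↦ p + h(s) u + s w` is a `C²` local center manifold of `F` at `p`, tangent to `w`,
on which the flow is `s' = g(s)`: the curve is tangent to `w` at `s = 0`, and `F` is tangent to it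
near `s = 0`. -/
def IsLocalCenterManifold (F : ℝ × ℝ → ℝ × ℝ) (p u w : ℝ × ℝ) (h g : ℝ → ℝ) : Prop :=
  ContDiffAt ℝ 2 h 0 ∧ h 0 = 0 ∧ deriv h 0 = 0 ∧
  ∀ᶠ s in 𝓝 (0 : ℝ), F (p + h s • u + s • w) = g s • (deriv h s • u + w)

/-- At `p` the Jacobian of `F` has eigenvector `u` with nonzero eigenvalue `lam` and eigenvector `w`
with eigenvalue `0`; in the coordinates `p + U u + s w` every local center manifold is
`U = c s² + O(s³)`, with flow `s' = d sᵐ + O(sᵐ⁺¹)` on it. -/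
def HasCenterExpansion (F : ℝ × ℝ → ℝ × ℝ) (p u w : ℝ × ℝ) (lam c d : ℝ) (m : ℕ) : Prop :=
  u ≠ 0 ∧ w ≠ 0 ∧ lam ≠ 0 ∧ fderiv ℝ F p u = lam • u ∧ fderiv ℝ F p w = 0 ∧
  ∀ h g : ℝ → ℝ, IsLocalCenterManifold F p u w h g →
    (fun s => h s - c * s ^ 2) =O[𝓝 0] (fun s : ℝ => s ^ 3) ∧
    (fun s => g s - d * s ^ m) =O[𝓝 0] (fun s : ℝ => s ^ (m + 1))

end

end ScalarFieldCosmology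

open ScalarFieldCosmology

open ScalarFieldCosmology

/-! Put `b = √(3/2) ν`. Off the axis `y = 0`, eliminating `y²` from the two equations leaves `(b x -
1)(3 x - b) = 0`. The second factor gives the points on the unit circle (`P3`, `P4`), the first the
scaling points (`P5`, `P6`). Each pair is used only through such polynomial relations
(`circle_point_iff`, `scaling_point_iff`), so both signs of a square root are treated at once.
Eigenvalues are read off from trace and determinant.

The types of critical points are defined by phase portraits and not by eigenvalues, so a local
theory is needed. In an affine frame (`conjField`, `basisEquiv`) the field is cut off outside a
small square, which yields a global flow; orbits that stay in the square are genuine, and all others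
leave.

Saddles: differences of orbits lying in a horizontal cone are expanded (`IsConeExpanding`). A
connectedness argument produces one orbit in each vertical half-cone that converges to the point,
and expansion makes it unique; reversing time and exchanging coordinates gives the other two
branches. Nodes: the Euclidean norm decays (`IsSink`), and the limiting direction comes from the
ratio of the coordinates if the eigenvalues differ (`exists_direction_of_distinct`) and from the
orbit multiplied by `exp (a t)` if they coincide (`exists_direction_of_double`). Spirals: the
angular velocity is bounded away from zero.

At the non-hyperbolic values no center manifold theorem is used; the invariant circle and the
invariant axis replace it. At `P1` and `P2` they are themselves the branches of the saddle,
uniformly up to and including the degenerate parameter (`isSaddle_axisField`). At `ν² = 2` the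
scaling points merge with those on the circle, and scaled coordinates bring every sign combination
to the single field `saddleNodeField`. There the parabolic sector is the part of the unit disc near
the point, the two arcs of the circle bound it, and the emanating orbit comes from the cone argument
in reversed time.

The center manifold expansions compare orders in the invariance equation, starting from `h = O(s²)`
and `h' = O(s)`. -/

/-! ### Global flow of a planar field cut off outside a square -/

/-- The retraction of the plane onto the closed square of half-side `r`. -/
def clampSq (r : ℝ) (z : ℝ × ℝ) : ℝ × ℝ := (max (-r) (min r z.1), max (-r) (min r z.2))

lemma mem_closedBall_zero_prod {r : ℝ} {z : ℝ × ℝ} :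
    z ∈ Metric.closedBall (0 : ℝ × ℝ) r ↔ |z.1| ≤ r ∧ |z.2| ≤ r := by
  rw [mem_closedBall_zero_iff, Prod.norm_def, max_le_iff, Real.norm_eq_abs, Real.norm_eq_abs]

lemma mem_ball_zero_prod {r : ℝ} {z : ℝ × ℝ} :
    z ∈ Metric.ball (0 : ℝ × ℝ) r ↔ |z.1| < r ∧ |z.2| < r := by
  rw [mem_ball_zero_iff, Prod.norm_def, max_lt_iff, Real.norm_eq_abs, Real.norm_eq_abs]

lemma clampSq_mem {r : ℝ} (hr : 0 ≤ r) (z : ℝ × ℝ) : clampSq r z ∈ Metric.closedBall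
    (0 : ℝ × ℝ) r := by
  rw [mem_closedBall_zero_prod]
  simp only [clampSq, abs_le]
  refine ⟨⟨le_max_left _ _, max_le (by linarith) (min_le_left _ _)⟩,
    ⟨le_max_left _ _, max_le (by linarith) (min_le_left _ _)⟩⟩

lemma clampSq_of_mem {r : ℝ} {z : ℝ × ℝ} (hz : z ∈ Metric.closedBall (0 : ℝ × ℝ) r) :
    clampSq r z = z := by
  rw [mem_closedBall_zero_prod, abs_le, abs_le] at hz
  ext
  · simp [clampSq, hz.1.1, hz.1.2]
  · simp [clampSq, hz.2.1, hz.2.2]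

lemma lipschitzWith_clampSq (r : ℝ) : LipschitzWith 1 (clampSq r) := by
  have h1 : LipschitzWith 1 (fun z : ℝ × ℝ => max (-r) (min r z.1)) :=
    (LipschitzWith.prod_fst.const_min r).const_max (-r)
  have h2 : LipschitzWith 1 (fun z : ℝ × ℝ => max (-r) (min r z.2)) :=
    (LipschitzWith.prod_snd.const_min r).const_max (-r)
  simpa using! h1.prodMk h2

section GlobalExistence

variable {E : Type*} [NormedAddCommGroup E] [NormedSpace ℝ E]

lemma eq_of_hasDerivAt_of_lipschitz {F : E → E} {K : NNReal} (hF : LipschitzWith K F)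
    {γ η : ℝ → E} (hγ : ∀ t, HasDerivAt γ (F (γ t)) t) (hη : ∀ t, HasDerivAt η (F (η t)) t)
    {t₀ : ℝ} (h : γ t₀ = η t₀) : γ = η :=
  ODE_solution_unique_univ (v := fun _ => F) (s := fun _ => univ)
    (fun _ => hF.lipschitzOnWith) (fun t => ⟨hγ t, trivial⟩) (fun t => ⟨hη t, trivial⟩) h

/-- A bounded Lipschitz field has global integral curves. -/
lemma exists_global_curve [CompleteSpace E] {F : E → E} {K : NNReal} (hF : LipschitzWith K F)
    {C : NNReal} (hC : ∀ z, ‖F z‖ ≤ C) (q : E) :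
    ∃ γ : ℝ → E, γ 0 = q ∧ ∀ t, HasDerivAt γ (F (γ t)) t := by
  have loc : ∀ n : ℕ, ∃ γ : ℝ → E, γ 0 = q ∧
      ∀ t ∈ Ioo (-(n : ℝ)) n, HasDerivAt γ (F (γ t)) t := by
    intro n
    have hn : (0 : ℝ) ≤ n := n.cast_nonneg
    -- Boundedness allows the radius `C * n` in the Picard–Lindelöf theorem, so the solution lives
    -- on all of `[-n, n]`.
    have pl : IsPicardLindelof (fun _ => F) (tmin := -(n : ℝ)) (tmax := n)
        ⟨0, by simp⟩ q (C * n) 0 C K := by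
      refine ⟨fun _ _ => hF.lipschitzOnWith, fun _ _ => continuousOn_const,
        fun _ _ x _ => hC x, ?_⟩
      simp
    obtain ⟨γ, h0, hγ⟩ := pl.exists_eq_forall_mem_Icc_hasDerivWithinAt₀
    exact ⟨γ, h0, fun t ht => (hγ t (Ioo_subset_Icc_self ht)).hasDerivAt
      (Icc_mem_nhds ht.1 ht.2)⟩
  choose γ h0 hγ using loc
  have agree : ∀ m n : ℕ, 0 < m → m ≤ n → EqOn (γ m) (γ n) (Ioo (-(m : ℝ)) m) := by
    intro m n hm hmn
    have hm' : (0 : ℝ) < m := Nat.cast_pos.mpr hm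
    have hmn' : (m : ℝ) ≤ n := Nat.cast_le.mpr hmn
    refine ODE_solution_unique_of_mem_Ioo (v := fun _ => F) (s := fun _ => univ) (K := K) (t₀ := 0)
      (fun _ _ => hF.lipschitzOnWith) ⟨by linarith, hm'⟩
      (fun t ht => ⟨hγ m t ht, trivial⟩) (fun t ht => ⟨hγ n t ⟨?_, ?_⟩, trivial⟩) ?_
    · linarith [ht.1]
    · linarith [ht.2]
    · rw [h0, h0]
  -- The glued curve uses at time `t` a solution on an interval around `t`. The `+ 1` makes the
  -- inclusion strict and the index positive, as `agree` requires.
  let N : ℝ → ℕ := fun t => ⌈|t|⌉₊ + 1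
  have hN : ∀ t, |t| < N t := fun t => by
    have := Nat.le_ceil |t|
    push_cast [N]
    linarith
  refine ⟨fun t => γ (N t) t, h0 _, fun t => ?_⟩
  have hd := hγ (N t) t (abs_lt.mp (hN t))
  refine hd.congr_of_eventuallyEq ?_
  filter_upwards [Ioo_mem_nhds (abs_lt.mp (hN t)).1 (abs_lt.mp (hN t)).2] with s hs
  rcases le_total (N s) (N t) with h | h
  · exact agree _ _ (Nat.succ_pos _) h (abs_lt.mp (hN s))
  · exact (agree _ _ (Nat.succ_pos _) h hs).symm

/-- Grönwall: two solutions separate at most by the factor `exp (K t)`. -/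
lemma continuous_in_initial_value {F : E → E} {K : NNReal} (hF : LipschitzWith K F)
    {φ : E → ℝ → E} (h0 : ∀ q, φ q 0 = q) (hφ : ∀ q t, HasDerivAt (φ q) (F (φ q t)) t)
    {t : ℝ} (ht : 0 ≤ t) : Continuous fun q => φ q t := by
  have hL : LipschitzWith (Real.toNNReal (Real.exp (K * t))) fun q => φ q t := by
    refine LipschitzWith.of_dist_le_mul fun q q' => ?_
    have := dist_le_of_trajectories_ODE (v := fun _ => F) (fun _ => hF)
      (fun s _ => (hφ q s).continuousAt.continuousWithinAt) (fun s _ => (hφ q s).hasDerivWithinAt)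
      (fun s _ => (hφ q' s).continuousAt.continuousWithinAt)
      (fun s _ => (hφ q' s).hasDerivWithinAt) (a := 0) (b := t) (δ := dist q q')
      (by rw [h0, h0]) t ⟨ht, le_rfl⟩
    rw [Real.coe_toNNReal _ (Real.exp_pos _).le, mul_comm]
    simpa using this
  exact hL.continuous

end GlobalExistence

lemma hasDerivAt_fst {γ : ℝ → ℝ × ℝ} {v : ℝ × ℝ} {t : ℝ} (h : HasDerivAt γ v t) :
    HasDerivAt (fun t => (γ t).1) v.1 t :=
  (ContinuousLinearMap.fst ℝ ℝ ℝ).hasFDerivAt.comp_hasDerivAt t h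

lemma hasDerivAt_snd {γ : ℝ → ℝ × ℝ} {v : ℝ × ℝ} {t : ℝ} (h : HasDerivAt γ v t) :
    HasDerivAt (fun t => (γ t).2) v.2 t :=
  (ContinuousLinearMap.snd ℝ ℝ ℝ).hasFDerivAt.comp_hasDerivAt t h

/-- `φ` is the flow of the field `F` cut off outside the square of half-side `r`. -/
structure IsCutoffFlow (F : ℝ × ℝ → ℝ × ℝ) (r : ℝ) (φ : ℝ × ℝ → ℝ → ℝ × ℝ) : Prop where
  zero : ∀ q, φ q 0 = q
  deriv : ∀ q t, HasDerivAt (φ q) (F (clampSq r (φ q t))) t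
  add : ∀ q s t, φ q (s + t) = φ (φ q s) t
  cont : ∀ t, 0 ≤ t → Continuous fun q => φ q t

/-- Precomposition with the 1-Lipschitz retraction makes the field bounded and globally Lipschitz
without changing it on the square. The group law is uniqueness applied to a time-translated
solution. -/
lemma exists_isCutoffFlow {F : ℝ × ℝ → ℝ × ℝ} {r : ℝ} (hr : 0 ≤ r) {K : NNReal}
    (hF : LipschitzOnWith K F (Metric.closedBall 0 r)) : ∃ φ, IsCutoffFlow F r φ := by
  have hL : LipschitzWith K (fun z => F (clampSq r z)) := by
    have := hF.comp (lipschitzWith_clampSq r).lipschitzOnWith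
      (fun z _ => clampSq_mem hr z : MapsTo (clampSq r) univ _)
    rw [mul_one] at this
    exact lipschitzOnWith_univ.mp this
  obtain ⟨C, hC⟩ := (isCompact_closedBall (0 : ℝ × ℝ) r).exists_bound_of_continuousOn
    hF.continuousOn
  have hC' : ∀ z, ‖F (clampSq r z)‖ ≤ C.toNNReal := fun z =>
    (hC _ (clampSq_mem hr z)).trans (Real.le_coe_toNNReal C)
  choose φ h0 hφ using exists_global_curve hL hC'
  refine ⟨φ, h0, hφ, fun q s t => ?_, fun t ht => continuous_in_initial_value hL h0 hφ ht⟩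
  have h1 : ∀ t, HasDerivAt (fun t => φ q (s + t)) (F (clampSq r (φ q (s + t)))) t :=
    fun t => (hφ q (s + t)).comp_const_add s t
  have := eq_of_hasDerivAt_of_lipschitz hL h1 (hφ (φ q s)) (t₀ := 0) (by simp [h0])
  exact congrFun this t

/-- A curve that does not leave an open set at a first exit time stays in it. -/
lemma forall_mem_of_no_first_exit {X : Type*} [TopologicalSpace X] {U : Set X} (hU : IsOpen U)
    {γ : ℝ → X} (hγ : Continuous γ) (h0 : γ 0 ∈ U)
    (h : ∀ T, 0 < T → (∀ t, 0 ≤ t → t < T → γ t ∈ U) → γ T ∈ U) : ∀ t, 0 ≤ t → γ t ∈ U := by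
  by_contra! hne
  obtain ⟨t₁, ht₁, hne⟩ := hne
  let S : Set ℝ := Ici 0 ∩ γ ⁻¹' Uᶜ
  have hS : IsClosed S := isClosed_Ici.inter (hU.isClosed_compl.preimage hγ)
  have hb : BddBelow S := ⟨0, fun t ht => ht.1⟩
  have hm := hS.csInf_mem ⟨t₁, ht₁, hne⟩ hb
  refine hm.2 (h _ (lt_of_le_of_ne hm.1 fun h' => hm.2 (h' ▸ h0)) fun t ht0 ht => ?_)
  by_contra hc
  exact absurd (csInf_le hb ⟨ht0, hc⟩) (not_le.mpr ht)

namespace IsCutoffFlow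

variable {F : ℝ × ℝ → ℝ × ℝ} {r : ℝ} {φ : ℝ × ℝ → ℝ → ℝ × ℝ}

lemma continuous (h : IsCutoffFlow F r φ) (q : ℝ × ℝ) : Continuous (φ q) :=
  continuous_iff_continuousAt.mpr fun t => (h.deriv q t).continuousAt

lemma deriv_of_mem (h : IsCutoffFlow F r φ) {q : ℝ × ℝ} {t : ℝ}
    (hm : φ q t ∈ Metric.closedBall 0 r) : HasDerivAt (φ q) (F (φ q t)) t := by
  have := h.deriv q t
  rwa [clampSq_of_mem hm] at this

lemma deriv_fst (h : IsCutoffFlow F r φ) (q : ℝ × ℝ) (t : ℝ) :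
    HasDerivAt (fun t => (φ q t).1) (F (clampSq r (φ q t))).1 t :=
  hasDerivAt_fst (h.deriv q t)

lemma deriv_snd (h : IsCutoffFlow F r φ) (q : ℝ × ℝ) (t : ℝ) :
    HasDerivAt (fun t => (φ q t).2) (F (clampSq r (φ q t))).2 t :=
  hasDerivAt_snd (h.deriv q t)

lemma deriv_fst_of_mem (h : IsCutoffFlow F r φ) {q : ℝ × ℝ} {t : ℝ}
    (hm : φ q t ∈ Metric.closedBall 0 r) : HasDerivAt (fun t => (φ q t).1) (F (φ q t)).1 t :=
  hasDerivAt_fst (h.deriv_of_mem hm)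

lemma deriv_snd_of_mem (h : IsCutoffFlow F r φ) {q : ℝ × ℝ} {t : ℝ}
    (hm : φ q t ∈ Metric.closedBall 0 r) : HasDerivAt (fun t => (φ q t).2) (F (φ q t)).2 t :=
  hasDerivAt_snd (h.deriv_of_mem hm)

lemma injective (h : IsCutoffFlow F r φ) {q q' : ℝ × ℝ} {t : ℝ} (he : φ q t = φ q' t) :
    q = q' := by
  have h1 := h.add q t (-t)
  have h2 := h.add q' t (-t)
  rw [add_neg_cancel, h.zero] at h1 h2
  rw [h1, h2, he]

lemma isIntegralCurveOn (h : IsCutoffFlow F r φ) {q : ℝ × ℝ}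
    (hm : ∀ t, 0 ≤ t → φ q t ∈ Metric.closedBall 0 r) :
    IsIntegralCurveOn (φ q) (fun _ => F) (Ici 0) :=
  fun t ht => (h.deriv_of_mem (hm t ht)).hasDerivWithinAt

/-- Up to and including the first exit from `N` the orbit lies in the closed square, where the
cut-off field is `F`. The first exit is therefore made by a genuine trajectory, whatever the cut-off
flow does later. -/
lemma leaves (h : IsCutoffFlow F r φ) {N : Set (ℝ × ℝ)} (hN : IsOpen N)
    (hNr : N ⊆ Metric.closedBall 0 r) {q : ℝ × ℝ} (hq : q ∈ N)
    (hex : ∃ t, 0 ≤ t ∧ φ q t ∉ N) : Leaves F N q := by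
  by_contra hl
  obtain ⟨t₁, ht₁, hne⟩ := hex
  refine hne (forall_mem_of_no_first_exit hN (h.continuous q) (by rwa [h.zero]) ?_ t₁ ht₁)
  intro T hT hin
  by_contra hout
  refine hl ⟨φ q, T, hT.le, fun t ht => (h.deriv_of_mem ?_).hasDerivWithinAt, h.zero q, hout⟩
  rcases ht.2.lt_or_eq with h1 | rfl
  · exact hNr (hin t ht.1 h1)
  · have : Tendsto (φ q) (𝓝[<] t) (𝓝 (φ q t)) := (h.continuous q).continuousAt.mono_left inf_le_left
    refine Metric.isClosed_closedBall.mem_of_tendsto this ?_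
    filter_upwards [Ioo_mem_nhdsLT hT] with s hs
    exact hNr (hin s hs.1.le hs.2)

end IsCutoffFlow

lemma zero_cutoffFlow {F : ℝ × ℝ → ℝ × ℝ} {r : ℝ} {φ : ℝ × ℝ → ℝ → ℝ × ℝ} (hr : 0 ≤ r)
    {K : NNReal} (hF : LipschitzOnWith K F (Metric.closedBall 0 r)) (h0 : F 0 = 0)
    (h : IsCutoffFlow F r φ) (t : ℝ) : φ 0 t = 0 := by
  have hL : LipschitzWith K (fun z => F (clampSq r z)) := by
    have := hF.comp (lipschitzWith_clampSq r).lipschitzOnWith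
      (fun z _ => clampSq_mem hr z : MapsTo (clampSq r) univ _)
    rw [mul_one] at this
    exact lipschitzOnWith_univ.mp this
  have hz : ∀ t, HasDerivAt (fun _ : ℝ => (0 : ℝ × ℝ)) (F (clampSq r 0)) t := fun t => by
    rw [clampSq_of_mem (Metric.mem_closedBall_self hr), h0]
    exact hasDerivAt_const t _
  exact congrFun (eq_of_hasDerivAt_of_lipschitz hL (h.deriv 0) hz (t₀ := 0) (h.zero 0)) t

/-! ### One-variable comparison lemmas -/

lemma antitoneOn_of_hasDerivAt_nonpos {f f' : ℝ → ℝ} {a : ℝ}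
    (hf : ∀ t, a ≤ t → HasDerivAt f (f' t) t) (h : ∀ t, a ≤ t → f' t ≤ 0) :
    AntitoneOn f (Ici a) := by
  refine antitoneOn_of_hasDerivWithinAt_nonpos (f' := f') (convex_Ici a)
    (fun t ht => (hf t ht).continuousAt.continuousWithinAt) (fun t ht => ?_) fun t ht => ?_
  · exact (hf t (interior_subset ht)).hasDerivWithinAt
  · exact h t (interior_subset ht)

lemma monotoneOn_of_hasDerivAt_nonneg {f f' : ℝ → ℝ} {a : ℝ}
    (hf : ∀ t, a ≤ t → HasDerivAt f (f' t) t) (h : ∀ t, a ≤ t → 0 ≤ f' t) :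
    MonotoneOn f (Ici a) := by
  refine monotoneOn_of_hasDerivWithinAt_nonneg (f' := f') (convex_Ici a)
    (fun t ht => (hf t ht).continuousAt.continuousWithinAt) (fun t ht => ?_) fun t ht => ?_
  · exact (hf t (interior_subset ht)).hasDerivWithinAt
  · exact h t (interior_subset ht)

lemma add_mul_le_of_le_hasDerivAt {f f' : ℝ → ℝ} {a m : ℝ}
    (hf : ∀ t, a ≤ t → HasDerivAt f (f' t) t) (h : ∀ t, a ≤ t → m ≤ f' t) {t : ℝ} (ht : a ≤ t) :
    f a + m * (t - a) ≤ f t := by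
  have := monotoneOn_of_hasDerivAt_nonneg (f := fun t => f t - m * t) (f' := fun t => f' t - m * 1)
    (fun t ht => (hf t ht).sub ((hasDerivAt_id t).const_mul m))
    (fun t ht => by linarith [h t ht]) (mem_Ici.mpr le_rfl) ht ht
  simp only at this
  linarith

/-- Used to show that orbits escape: some function would grow at least linearly along an orbit that
stays. -/
lemma not_bddAbove_of_le_hasDerivAt {f f' : ℝ → ℝ} {a m M : ℝ} (hm : 0 < m)
    (hf : ∀ t, a ≤ t → HasDerivAt f (f' t) t) (h : ∀ t, a ≤ t → m ≤ f' t)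
    (hM : ∀ t, a ≤ t → f t ≤ M) : False := by
  have hM' := hM a le_rfl
  have ht : a ≤ a + (M - f a + 1) / m := by
    have : 0 ≤ (M - f a + 1) / m := div_nonneg (by linarith) hm.le
    linarith
  have h1 := add_mul_le_of_le_hasDerivAt hf h ht
  have h2 := hM _ ht
  rw [add_sub_cancel_left, mul_div_cancel₀ _ hm.ne'] at h1
  linarith

/-- A barrier argument with a sign condition only at zeros of `f`. Comparison gives `0 ≤ f`; a later
zero would be an interior local minimum, where the derivative vanishes. Since `f a = 0` is allowed,
an orbit starting on the boundary of a cone enters its interior. -/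
lemma pos_of_hasDerivAt_pos_at_zeros {f f' : ℝ → ℝ} {a : ℝ}
    (hf : ∀ t, a ≤ t → HasDerivAt f (f' t) t) (ha : 0 ≤ f a)
    (hb : ∀ t, a ≤ t → f t = 0 → 0 < f' t) {t : ℝ} (ht : a < t) : 0 < f t := by
  have nonneg : ∀ s, a ≤ s → 0 ≤ f s := fun s hs => by
    have := image_le_of_deriv_right_lt_deriv_boundary (f := fun t => -f t) (f' := fun t => -f' t)
      (a := a) (b := s) (B := fun _ => 0) (B' := fun _ => 0)
      (fun x hx => (hf x hx.1).neg.continuousAt.continuousWithinAt)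
      (fun x hx => (hf x hx.1).neg.hasDerivWithinAt) (by simpa using ha)
      (fun x => hasDerivAt_const x 0)
      (fun x hx h => by have := hb x hx.1 (by simpa using h); simpa using this)
      (right_mem_Icc.mpr hs)
    simpa using this
  refine lt_of_le_of_ne (nonneg t ht.le) fun h0 => ?_
  have hmin : IsLocalMin f t := by
    filter_upwards [Ioi_mem_nhds ht] with s hs
    rw [← h0]
    exact nonneg s (le_of_lt hs)
  have := hmin.hasDerivAt_eq_zero (hf t ht.le)
  linarith [hb t ht.le h0.symm]

/-- By compactness `W` decreases at a rate bounded away from zero, yet it is bounded below. -/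
lemma false_of_forall_mem_compact {X : Type*} [TopologicalSpace X] {z : ℝ → X} {W w : X → ℝ}
    {S : Set X} {a : ℝ} (hS : IsCompact S) (hz : ∀ t, a ≤ t → z t ∈ S)
    (hd : ∀ t, a ≤ t → HasDerivAt (fun t => W (z t)) (w (z t)) t) (hW : ContinuousOn W S)
    (hw : ContinuousOn w S) (hneg : ∀ x ∈ S, w x < 0) : False := by
  obtain ⟨x₀, hx₀, hmax⟩ := hS.exists_isMaxOn ⟨z a, hz a le_rfl⟩ hw
  obtain ⟨x₁, hx₁, hmin⟩ := hS.exists_isMinOn ⟨z a, hz a le_rfl⟩ hW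
  refine not_bddAbove_of_le_hasDerivAt (f := fun t => -W (z t)) (f' := fun t => -w (z t)) (a := a)
    (m := -w x₀) (M := -W x₁) (by linarith [hneg x₀ hx₀]) (fun t ht => (hd t ht).neg)
    (fun t ht => neg_le_neg (hmax (hz t ht))) (fun t ht => neg_le_neg (hmin (hz t ht)))

/-- `W` does not increase along the orbit. If it failed to tend to zero it would stay above some
`ε`, and the orbit would remain in a compact set where `W` decreases strictly. -/
lemma tendsto_zero_of_lyapunov {X : Type*} [TopologicalSpace X] {z : ℝ → X} {W w : X → ℝ}
    {S : Set X} {a : ℝ} (hS : IsCompact S) (hz : ∀ t, a ≤ t → z t ∈ S)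
    (hd : ∀ t, a ≤ t → HasDerivAt (fun t => W (z t)) (w (z t)) t) (hW : Continuous W)
    (hw : ContinuousOn w S) (hpos : ∀ x ∈ S, 0 ≤ W x) (hnonpos : ∀ x ∈ S, w x ≤ 0)
    (hneg : ∀ x ∈ S, 0 < W x → w x < 0) : Tendsto (fun t => W (z t)) atTop (𝓝 0) := by
  have anti := antitoneOn_of_hasDerivAt_nonpos hd fun t ht => hnonpos _ (hz t ht)
  rw [Metric.tendsto_atTop]
  intro ε hε
  by_contra! hc
  refine false_of_forall_mem_compact (S := S ∩ {x | ε ≤ W x}) (z := z) (W := W) (w := w) (a := a)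
    (hS.inter_right (isClosed_le continuous_const hW)) (fun t ht => ⟨hz t ht, ?_⟩) hd
    hW.continuousOn (hw.mono inter_subset_left) fun x hx => hneg x hx.1 (hε.trans_le hx.2)
  obtain ⟨s, hs, hs'⟩ := hc t
  rw [Real.dist_eq, sub_zero, abs_of_nonneg (hpos _ (hz s (ht.trans hs)))] at hs'
  exact hs'.trans (anti ht (ht.trans hs) hs)

lemma forall_pos_of_ne_zero {f : ℝ → ℝ} (hf : Continuous f) {a : ℝ} (ha : 0 < f a)
    (h : ∀ t, a ≤ t → f t ≠ 0) {t : ℝ} (ht : a ≤ t) : 0 < f t := by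
  by_contra! hc
  obtain ⟨s, hs, hs0⟩ := intermediate_value_Icc' ht hf.continuousOn ⟨hc, ha.le⟩
  exact h s hs.1 hs0

/-! ### Trajectories staying near a point with an expanding direction -/

/-- On the diagonals the retraction is a rescaling. Cone conditions known only on the square can
thus be tested along cut-off orbits that have left it. -/
lemma clampSq_of_abs_eq {r : ℝ} (hr : 0 < r) {z : ℝ × ℝ} (h : |z.1| = |z.2|) :
    ∃ k : ℝ, 1 ≤ k ∧ z = k • clampSq r z := by
  by_cases hz : |z.1| ≤ r
  · exact ⟨1, le_rfl, by
      rw [one_smul, clampSq_of_mem (mem_closedBall_zero_prod.mpr ⟨hz, h ▸ hz⟩)]⟩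
  · push Not at hz
    have key : ∀ x : ℝ, |x| = |z.1| → x = |z.1| / r * max (-r) (min r x) := by
      intro x hx
      rcases abs_cases x with ⟨h1, h2⟩ | ⟨h1, h2⟩
      · rw [min_eq_left (by linarith), max_eq_right (by linarith), div_mul_cancel₀ _ hr.ne']
        linarith
      · rw [min_eq_right (by linarith), max_eq_left (by linarith), mul_neg,
          div_mul_cancel₀ _ hr.ne']
        linarith
    refine ⟨|z.1| / r, (one_le_div hr).mpr hz.le, ?_⟩
    ext
    · exact key _ rfl
    · exact key _ h.symm

/-- On the square of half-side `r`, the field vanishes at the origin and differences of points in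
the horizontal cone are expanded at rate `c`. -/
structure IsConeExpanding (G : ℝ × ℝ → ℝ × ℝ) (r c : ℝ) : Prop where
  r_pos : 0 < r
  c_pos : 0 < c
  zero : G 0 = 0
  lip : ∃ K, LipschitzOnWith K G (Metric.closedBall 0 r)
  cone : ∀ z ∈ Metric.closedBall (0 : ℝ × ℝ) r, ∀ z' ∈ Metric.closedBall (0 : ℝ × ℝ) r,
    |z.2 - z'.2| ≤ |z.1 - z'.1| →
    c * (z.1 - z'.1) ^ 2 ≤
      (z.1 - z'.1) * ((G z).1 - (G z').1) - (z.2 - z'.2) * ((G z).2 - (G z').2)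

namespace IsConeExpanding

variable {G : ℝ × ℝ → ℝ × ℝ} {r c : ℝ} {φ : ℝ × ℝ → ℝ → ℝ × ℝ}

lemma flow_ne_zero (h : IsConeExpanding G r c) (hφ : IsCutoffFlow G r φ) {q : ℝ × ℝ} (hq : q ≠ 0)
    (t : ℝ) : φ q t ≠ 0 := by
  obtain ⟨K, hK⟩ := h.lip
  intro h0
  exact hq (hφ.injective (t := t) (by rw [h0, zero_cutoffFlow h.r_pos.le hK h.zero hφ]))

lemma hasDerivAt_quad (hφ : IsCutoffFlow G r φ) (q : ℝ × ℝ) (t : ℝ) :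
    HasDerivAt (fun t => (φ q t).1 ^ 2 - (φ q t).2 ^ 2)
      (2 * ((φ q t).1 * (G (clampSq r (φ q t))).1 - (φ q t).2 * (G (clampSq r (φ q t))).2)) t := by
  convert! ((hφ.deriv_fst q t).pow 2).sub ((hφ.deriv_snd q t).pow 2) using 1
  push_cast
  ring

lemma cone_zero (h : IsConeExpanding G r c) {z : ℝ × ℝ} (hz : z ∈ Metric.closedBall (0 : ℝ × ℝ) r)
    (hc : |z.2| ≤ |z.1|) : c * z.1 ^ 2 ≤ z.1 * (G z).1 - z.2 * (G z).2 := by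
  have := h.cone z hz 0 (Metric.mem_closedBall_self h.r_pos.le) (by simpa using hc)
  simpa [h.zero] using this

/-- On the boundary of the cone the point is a positive multiple of its clamped image, so
`cone_zero` makes `x² - y²` increase there, inside the square or not. -/
lemma quad_pos (h : IsConeExpanding G r c) (hφ : IsCutoffFlow G r φ) {q : ℝ × ℝ} (hq : q ≠ 0)
    {a t : ℝ} (ha : (φ q a).2 ^ 2 ≤ (φ q a).1 ^ 2) (ht : a < t) :
    (φ q t).2 ^ 2 < (φ q t).1 ^ 2 := by
  have := pos_of_hasDerivAt_pos_at_zeros (a := a) (fun t _ => hasDerivAt_quad hφ q t)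
    (by linarith) (fun s _ hs => ?_) ht
  · linarith
  have habs : |(φ q s).1| = |(φ q s).2| := by rw [← sq_eq_sq_iff_abs_eq_abs]; linarith
  obtain ⟨k, hk, hz⟩ := clampSq_of_abs_eq h.r_pos habs
  have hne := h.flow_ne_zero hφ hq s
  set x := clampSq r (φ q s) with hx
  have hk0 : 0 < k := by linarith
  rw [hz] at habs hne ⊢
  simp only [Prod.smul_fst, Prod.smul_snd, smul_eq_mul, abs_mul] at habs ⊢
  have habs' : |x.1| = |x.2| := mul_left_cancel₀ (abs_pos.mpr hk0.ne').ne' habs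
  have hx1 : x.1 ≠ 0 := fun h0 => hne (by
    have h2 : x.2 = 0 := by rw [h0, abs_zero] at habs'; exact abs_eq_zero.mp habs'.symm
    rw [show x = 0 from Prod.ext h0 h2, smul_zero])
  have h1 := h.cone_zero (clampSq_mem h.r_pos.le (φ q s)) (habs'.ge)
  rw [← hx] at h1
  have h2 : 0 < c * x.1 ^ 2 := mul_pos h.c_pos (by positivity)
  nlinarith

/-- A horizontal difference of two orbits remains horizontal, and its form `x² - y²` then grows
without bound. With one orbit at rest this confines staying orbits to the vertical cone; at equal
heights it gives uniqueness. -/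
lemma false_of_forall_mem (h : IsConeExpanding G r c) (hφ : IsCutoffFlow G r φ) {q q' : ℝ × ℝ}
    (hq : ∀ t, 0 ≤ t → φ q t ∈ Metric.closedBall 0 r)
    (hq' : ∀ t, 0 ≤ t → φ q' t ∈ Metric.closedBall 0 r) (hne : q ≠ q')
    (hc : (q.2 - q'.2) ^ 2 ≤ (q.1 - q'.1) ^ 2) : False := by
  have hd : ∀ t, 0 ≤ t → HasDerivAt
      (fun t => ((φ q t).1 - (φ q' t).1) ^ 2 - ((φ q t).2 - (φ q' t).2) ^ 2)
      (2 * (((φ q t).1 - (φ q' t).1) * ((G (φ q t)).1 - (G (φ q' t)).1) -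
        ((φ q t).2 - (φ q' t).2) * ((G (φ q t)).2 - (G (φ q' t)).2))) t := by
    intro t ht
    convert! (((hφ.deriv_fst_of_mem (hq t ht)).sub (hφ.deriv_fst_of_mem (hq' t ht))).pow 2).sub
      (((hφ.deriv_snd_of_mem (hq t ht)).sub (hφ.deriv_snd_of_mem (hq' t ht))).pow 2) using 1
    simp only [Pi.sub_apply]
    push_cast
    ring
  have hcone : ∀ t, 0 ≤ t → ((φ q t).2 - (φ q' t).2) ^ 2 ≤ ((φ q t).1 - (φ q' t).1) ^ 2 →
      2 * c * ((φ q t).1 - (φ q' t).1) ^ 2 ≤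
        2 * (((φ q t).1 - (φ q' t).1) * ((G (φ q t)).1 - (G (φ q' t)).1) -
        ((φ q t).2 - (φ q' t).2) * ((G (φ q t)).2 - (G (φ q' t)).2)) := by
    intro t ht hs
    have := h.cone _ (hq t ht) _ (hq' t ht) (sq_le_sq.mp hs)
    linarith
  have hpos : ∀ t, 0 < t →
      0 < ((φ q t).1 - (φ q' t).1) ^ 2 - ((φ q t).2 - (φ q' t).2) ^ 2 := by
    intro t ht
    refine pos_of_hasDerivAt_pos_at_zeros hd ?_ (fun s hs hs0 => ?_) ht
    · rw [hφ.zero, hφ.zero]; linarith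
    refine lt_of_lt_of_le ?_ (hcone s hs (by linarith))
    refine mul_pos (mul_pos two_pos h.c_pos) (pow_two_pos_of_ne_zero fun h1 => hne ?_)
    refine hφ.injective (t := s) (Prod.ext (by linarith) ?_)
    have : ((φ q s).2 - (φ q' s).2) ^ 2 = 0 := by rw [h1] at hs0; linarith
    linarith [pow_eq_zero_iff two_ne_zero |>.mp this]
  -- The form may vanish at time `0`, so the growth estimate starts at time `1`, where it is
  -- positive.
  have hmono := monotoneOn_of_hasDerivAt_nonneg (a := 1) (fun t ht => hd t (by linarith))
    (fun t ht => (mul_nonneg (mul_pos two_pos h.c_pos).le (sq_nonneg _)).trans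
      (hcone t (by linarith) (by linarith [hpos t (by linarith)])))
  have h1 := hpos 1 one_pos
  refine not_bddAbove_of_le_hasDerivAt (a := 1) (M := (2 * r) ^ 2) (mul_pos (mul_pos two_pos h.c_pos) h1)
    (fun t ht => hd t (by linarith)) (fun t ht => ?_) (fun t ht => ?_)
  · refine le_trans ?_ (hcone t (by linarith) (by linarith [hpos t (by linarith)]))
    refine mul_le_mul_of_nonneg_left ?_ (mul_pos two_pos h.c_pos).le
    refine (hmono (mem_Ici.mpr le_rfl) (mem_Ici.mpr ht) ht).trans ?_
    nlinarith [sq_nonneg ((φ q t).2 - (φ q' t).2)]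
  · have h2 := (mem_closedBall_zero_prod.mp (hq t (by linarith))).1
    have h3 := (mem_closedBall_zero_prod.mp (hq' t (by linarith))).1
    have : ((φ q t).1 - (φ q' t).1) ^ 2 ≤ (2 * r) ^ 2 := by
      refine sq_le_sq' ?_ ?_ <;> linarith [abs_le.mp h2, abs_le.mp h3]
    nlinarith [sq_nonneg ((φ q t).2 - (φ q' t).2)]

/-- A nonzero point whose trajectory stays in the square moves in the open vertical cone. -/
lemma sq_lt_sq_of_forall_mem (h : IsConeExpanding G r c) (hφ : IsCutoffFlow G r φ) {q : ℝ × ℝ}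
    (hq : ∀ t, 0 ≤ t → φ q t ∈ Metric.closedBall 0 r) (hne : q ≠ 0) {t : ℝ} (ht : 0 ≤ t) :
    (φ q t).1 ^ 2 < (φ q t).2 ^ 2 := by
  obtain ⟨K, hK⟩ := h.lip
  by_contra! hc
  refine h.false_of_forall_mem hφ (q := φ q t) (q' := 0) (fun s hs => ?_) (fun s _ => ?_)
    (h.flow_ne_zero hφ hne t) (by simpa using hc)
  · rw [← hφ.add]; exact hq _ (by linarith)
  · rw [zero_cutoffFlow h.r_pos.le hK h.zero hφ]; exact Metric.mem_closedBall_self h.r_pos.le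

/-- A shooting argument along the side of the square at height `σ * r`. The starting points whose
orbits enter the right, respectively left, half of the horizontal cone form two disjoint open sets,
each containing a corner. By connectedness some orbit enters neither; it stays in the vertical cone,
where `σ * z.2` is a Lyapunov function. -/
lemma exists_approaching (h : IsConeExpanding G r c) (hφ : IsCutoffFlow G r φ) {σ : ℝ}
    (hσ : σ = 1 ∨ σ = -1)
    (hv : ∀ z ∈ Metric.closedBall (0 : ℝ × ℝ) r, |z.1| ≤ σ * z.2 → 0 < σ * z.2 →
      σ * (G z).2 < 0) :
    ∃ q : ℝ × ℝ, q.2 = σ * r ∧ (∀ t, 0 ≤ t → φ q t ∈ Metric.closedBall 0 r) ∧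
      (∀ t, 0 ≤ t → |(φ q t).1| < σ * (φ q t).2) ∧ Tendsto (φ q) atTop (𝓝 0) := by
  have hr := h.r_pos
  have hσ2 : σ * σ = 1 := by rcases hσ with rfl | rfl <;> norm_num
  have hσabs : |σ| = 1 := by rcases hσ with rfl | rfl <;> norm_num
  have hne : ∀ s : ℝ, ((s, σ * r) : ℝ × ℝ) ≠ 0 := fun s h0 => by
    have : σ * r = 0 := congrArg Prod.snd h0
    rcases hσ with rfl | rfl <;> linarith
  have c1 : ∀ q, Continuous fun t => (φ q t).1 := fun q => (hφ.continuous q).fst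
  have c2 : ∀ q, Continuous fun t => (φ q t).2 := fun q => (hφ.continuous q).snd
  have hopen : ∀ τ : ℝ, IsOpen {s : ℝ | ∃ t, 0 ≤ t ∧
      |(φ (s, σ * r) t).2| < τ * (φ (s, σ * r) t).1} := by
    intro τ
    have : {s : ℝ | ∃ t, 0 ≤ t ∧ |(φ (s, σ * r) t).2| < τ * (φ (s, σ * r) t).1} =
        ⋃ t ∈ Ici (0 : ℝ), {s : ℝ | |(φ (s, σ * r) t).2| < τ * (φ (s, σ * r) t).1} := by
      ext; simp
    rw [this]
    refine isOpen_biUnion fun t ht => ?_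
    have hc : Continuous fun s : ℝ => φ (s, σ * r) t :=
      (hφ.cont t ht).comp (by fun_prop : Continuous fun s : ℝ => ((s, σ * r) : ℝ × ℝ))
    exact isOpen_lt hc.snd.abs (continuous_const.mul hc.fst)
  -- An orbit cannot pass from one half of the horizontal cone to the other: the cone is forward
  -- invariant and `z.1` has no zero inside it.
  have hsign : ∀ q : ℝ × ℝ, q ≠ 0 → ∀ τ : ℝ, (τ = 1 ∨ τ = -1) → ∀ t₁ t₂, t₁ ≤ t₂ →
      |(φ q t₁).2| < τ * (φ q t₁).1 → ¬ |(φ q t₂).2| < -τ * (φ q t₂).1 := by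
    intro q hq τ hτ t₁ t₂ h12 h1 h2
    have hpos : 0 < τ * (φ q t₂).1 := by
      refine forall_pos_of_ne_zero (f := fun t => τ * (φ q t).1) (continuous_const.mul (c1 q))
        ((abs_nonneg _).trans_lt h1) (fun t ht => ?_) h12
      have hQ : (φ q t₁).2 ^ 2 < (φ q t₁).1 ^ 2 := by
        have : |(φ q t₁).2| < |(φ q t₁).1| := h1.trans_le (by
          rcases hτ with rfl | rfl
          · simpa using le_abs_self _
          · simpa using neg_le_abs _)
        exact sq_lt_sq.mpr this
      have hQ' : (φ q t).2 ^ 2 < (φ q t).1 ^ 2 := by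
        rcases ht.eq_or_lt with rfl | hlt
        · exact hQ
        · exact h.quad_pos hφ hq hQ.le hlt
      have : (φ q t).1 ≠ 0 := fun h0 => by
        rw [h0] at hQ'
        nlinarith [sq_nonneg (φ q t).2]
      rcases hτ with rfl | rfl <;> simpa using this
    linarith [abs_nonneg (φ q t₂).2]
  -- A corner lies on the boundary of the cone, so its orbit enters the interior at once.
  have hcorner : ∀ τ : ℝ, (τ = 1 ∨ τ = -1) →
      ∃ t, 0 ≤ t ∧ |(φ (τ * r, σ * r) t).2| < τ * (φ (τ * r, σ * r) t).1 := by
    intro τ hτ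
    have hτ2 : τ * (τ * r) = r := by rcases hτ with rfl | rfl <;> ring
    have hev : ∀ᶠ t in 𝓝 (0 : ℝ), 0 < τ * (φ (τ * r, σ * r) t).1 := by
      refine (continuous_const.mul (c1 _)).continuousAt.eventually_const_lt ?_
      simpa [hφ.zero, hτ2] using hr
    obtain ⟨ε, hε, hball⟩ := Metric.eventually_nhds_iff_ball.mp hev
    have ht : 0 < τ * (φ (τ * r, σ * r) (ε / 2)).1 := hball _ (by
      rw [Metric.mem_ball, Real.dist_eq, sub_zero, abs_of_pos (by linarith)]; linarith)
    refine ⟨ε / 2, by linarith, ?_⟩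
    have hQ := h.quad_pos hφ (hne (τ * r)) (a := 0) (t := ε / 2) (by
      rw [hφ.zero]
      rcases hσ with rfl | rfl <;> rcases hτ with rfl | rfl <;> simp) (by linarith)
    rw [sq_lt_sq] at hQ
    refine hQ.trans_le (le_of_eq ?_)
    have hτabs : |τ| = 1 := by rcases hτ with rfl | rfl <;> norm_num
    rw [← abs_of_pos ht, abs_mul, hτabs, one_mul]
  obtain ⟨s, hs⟩ : ∃ s : ℝ, ∀ t, 0 ≤ t → (φ (s, σ * r) t).1 ^ 2 ≤ (φ (s, σ * r) t).2 ^ 2 := by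
    by_contra! hc
    have hcov : Icc (-r) r ⊆ {s : ℝ | ∃ t, 0 ≤ t ∧
        |(φ (s, σ * r) t).2| < 1 * (φ (s, σ * r) t).1} ∪ {s : ℝ | ∃ t, 0 ≤ t ∧
        |(φ (s, σ * r) t).2| < -1 * (φ (s, σ * r) t).1} := by
      intro s _
      obtain ⟨t, ht, hlt⟩ := hc s
      rw [sq_lt_sq] at hlt
      rcases abs_cases (φ (s, σ * r) t).1 with ⟨h1, _⟩ | ⟨h1, _⟩
      · exact Or.inl ⟨t, ht, by rwa [h1, ← one_mul (φ _ t).1] at hlt⟩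
      · exact Or.inr ⟨t, ht, by rwa [h1, neg_eq_neg_one_mul] at hlt⟩
    obtain ⟨s, -, ⟨t₁, ht₁, h1⟩, ⟨t₂, ht₂, h2⟩⟩ := isPreconnected_Icc _ _ (hopen 1) (hopen (-1)) hcov
      ⟨1 * r, ⟨by linarith, by linarith⟩, hcorner 1 (Or.inl rfl)⟩
      ⟨-1 * r, ⟨by linarith, by linarith⟩, hcorner (-1) (Or.inr rfl)⟩
    rcases le_total t₁ t₂ with h12 | h12
    · exact hsign _ (hne s) 1 (Or.inl rfl) t₁ t₂ h12 h1 h2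
    · exact hsign _ (hne s) (-1) (Or.inr rfl) t₂ t₁ h12 h2 (by simpa using h1)
  -- A contact with the boundary would be followed by entrance into the horizontal cone, so the weak
  -- inequality is in fact strict.
  have hlt : ∀ t, 0 ≤ t → (φ (s, σ * r) t).1 ^ 2 < (φ (s, σ * r) t).2 ^ 2 := by
    intro t ht
    by_contra! hc
    have h1 := h.quad_pos hφ (hne s) hc (lt_add_one t)
    linarith [hs (t + 1) (by linarith)]
  have hpos : ∀ t, 0 ≤ t → 0 < σ * (φ (s, σ * r) t).2 := fun t ht => by
    refine forall_pos_of_ne_zero (f := fun t => σ * (φ (s, σ * r) t).2)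
      (continuous_const.mul (c2 _)) (by rw [hφ.zero, ← mul_assoc, hσ2]; linarith)
      (fun t ht h0 => ?_) ht
    have : (φ (s, σ * r) t).2 = 0 := by rcases hσ with rfl | rfl <;> simpa using h0
    nlinarith [hlt t ht, sq_nonneg (φ (s, σ * r) t).1]
  have hcone : ∀ t, 0 ≤ t → |(φ (s, σ * r) t).1| < σ * (φ (s, σ * r) t).2 := fun t ht => by
    have := sq_lt_sq.mp (hlt t ht)
    rwa [← one_mul |(φ (s, σ * r) t).2|, ← hσabs, ← abs_mul, abs_of_pos (hpos t ht)] at this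
  have habs : ∀ t, 0 ≤ t → |(φ (s, σ * r) t).2| = σ * (φ (s, σ * r) t).2 := fun t ht => by
    rw [← abs_of_pos (hpos t ht), abs_mul, hσabs, one_mul]
  have hbd : ∀ t, 0 ≤ t → σ * (φ (s, σ * r) t).2 ≤ r := by
    intro t ht
    rcases ht.eq_or_lt with rfl | ht
    · rw [hφ.zero, ← mul_assoc, hσ2, one_mul]
    have := pos_of_hasDerivAt_pos_at_zeros (f := fun t => r - σ * (φ (s, σ * r) t).2) (a := 0)
      (fun t _ => ((hφ.deriv_snd (s, σ * r) t).const_mul σ).const_sub r)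
      (by simp only [hφ.zero]; rw [← mul_assoc, hσ2]; linarith) (fun t ht h0 => ?_) ht
    · linarith
    have hm : φ (s, σ * r) t ∈ Metric.closedBall (0 : ℝ × ℝ) r := by
      rw [mem_closedBall_zero_prod, habs t ht]
      exact ⟨by linarith [hcone t ht], by linarith⟩
    rw [clampSq_of_mem hm]
    linarith [hv _ hm (hcone t ht).le (hpos t ht)]
  have hm : ∀ t, 0 ≤ t → φ (s, σ * r) t ∈ Metric.closedBall (0 : ℝ × ℝ) r := fun t ht => by
    rw [mem_closedBall_zero_prod, habs t ht]
    exact ⟨by linarith [hcone t ht, hbd t ht], hbd t ht⟩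
  refine ⟨(s, σ * r), rfl, hm, hcone, ?_⟩
  obtain ⟨K, hK⟩ := h.lip
  have hW : Continuous fun z : ℝ × ℝ => σ * z.2 := by fun_prop
  have hlim := tendsto_zero_of_lyapunov (z := φ (s, σ * r)) (W := fun z => σ * z.2)
    (w := fun z => σ * (G z).2) (a := 0)
    (S := Metric.closedBall (0 : ℝ × ℝ) r ∩ {z | |z.1| ≤ σ * z.2})
    ((isCompact_closedBall _ _).inter_right (isClosed_le continuous_fst.abs hW))
    (fun t ht => ⟨hm t ht, (hcone t ht).le⟩)
    (fun t ht => (hφ.deriv_snd_of_mem (hm t ht)).const_mul σ) hW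
    (continuousOn_const.mul (continuous_snd.comp_continuousOn (hK.continuousOn.mono inter_subset_left)))
    (fun z hz => (abs_nonneg z.1).trans hz.2) (fun z hz => ?_) (fun z hz h0 => hv z hz.1 hz.2 h0)
  · refine squeeze_zero_norm' (a := fun t => σ * (φ (s, σ * r) t).2) ?_ hlim
    filter_upwards [eventually_ge_atTop 0] with t ht
    rw [Prod.norm_def, Real.norm_eq_abs, Real.norm_eq_abs, habs t ht]
    exact max_le (hcone t ht).le le_rfl
  · rcases ((abs_nonneg z.1).trans hz.2).eq_or_lt with h0 | h0
    · have hz1 : z.1 = 0 := abs_eq_zero.mp (le_antisymm (h0 ▸ hz.2) (abs_nonneg _))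
      have hz2 : z.2 = 0 := by rcases hσ with rfl | rfl <;> simpa using h0.symm
      rw [show z = 0 from Prod.ext hz1 hz2, h.zero]
      simp
    · exact (hv z hz.1 hz.2 h0).le

/-- The half of the local stable set in the cone around `σ • (0, 1)` is a single trajectory. -/
theorem exists_unique_approaching (h : IsConeExpanding G r c) (hφ : IsCutoffFlow G r φ) {σ : ℝ}
    (hσ : σ = 1 ∨ σ = -1)
    (hv : ∀ z ∈ Metric.closedBall (0 : ℝ × ℝ) r, |z.1| ≤ σ * z.2 → 0 < σ * z.2 →
      σ * (G z).2 < 0) :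
    ∃ γ, Approaches G γ 0 ∧ (∀ t, 0 ≤ t → |(γ t).1| < σ * (γ t).2) ∧
      ∀ q : ℝ × ℝ, (∀ t, 0 ≤ t → φ q t ∈ Metric.closedBall 0 r) → 0 < σ * q.2 →
        q ∈ halfOrbit γ := by
  obtain ⟨p, hp, hm, hcone, hlim⟩ := h.exists_approaching hφ hσ hv
  have hσ2 : σ * σ = 1 := by rcases hσ with rfl | rfl <;> norm_num
  refine ⟨φ p, ⟨hφ.isIntegralCurveOn hm, fun t ht h0 => ?_, hlim⟩, hcone, fun q hq hpos => ?_⟩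
  · have := hcone t ht
    simp [h0] at this
  have hcont : Continuous fun t => σ * (φ p t).2 := continuous_const.mul (hφ.continuous p).snd
  have hlim2 : Tendsto (fun t => σ * (φ p t).2) atTop (𝓝 0) := by
    have := ((continuous_snd.tendsto (0 : ℝ × ℝ)).comp hlim).const_mul σ
    simpa using! this
  obtain ⟨T, hT0, hT⟩ : ∃ T, 0 ≤ T ∧ σ * (φ p T).2 < σ * q.2 := by
    obtain ⟨T, h1, h2⟩ := ((hlim2.eventually_lt_const hpos).and (eventually_ge_atTop 0)).exists
    exact ⟨T, h2, h1⟩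
  have hqr : σ * q.2 ≤ r := by
    have h0 := hq 0 le_rfl
    rw [hφ.zero, mem_closedBall_zero_prod] at h0
    have := abs_le.mp h0.2
    rcases hσ with rfl | rfl <;> linarith
  obtain ⟨t, ht, hte⟩ := intermediate_value_Icc' hT0 hcont.continuousOn
    (show σ * q.2 ∈ Icc _ _ from ⟨hT.le, by rw [hφ.zero, hp, ← mul_assoc, hσ2]; linarith⟩)
  have hte' : (φ p t).2 = q.2 := by rcases hσ with rfl | rfl <;> simpa using hte
  refine ⟨t, ht.1, ?_⟩
  -- At equal heights the difference is horizontal, so two distinct staying orbits would separate.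
  by_contra hne
  refine h.false_of_forall_mem hφ (q := φ p t) (q' := q) (fun s hs => ?_) hq hne ?_
  · rw [← hφ.add]; exact hm _ (by linarith [ht.1])
  · rw [hte', sub_self]
    nlinarith [sq_nonneg ((φ p t).1 - q.1)]

end IsConeExpanding

/-! ### Affine changes of coordinates -/

/-- The field `F` in the affine coordinates `z ↦ p + L z`. -/
noncomputable def conjField (F : ℝ × ℝ → ℝ × ℝ) (p : ℝ × ℝ) (L : (ℝ × ℝ) ≃L[ℝ] (ℝ × ℝ))
    (z : ℝ × ℝ) : ℝ × ℝ :=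
  L.symm (F (p + L z))

/-- The affine homeomorphism `z ↦ p + L z`. -/
noncomputable def affineHomeo (p : ℝ × ℝ) (L : (ℝ × ℝ) ≃L[ℝ] (ℝ × ℝ)) : (ℝ × ℝ) ≃ₜ (ℝ × ℝ) :=
  L.toHomeomorph.trans (Homeomorph.addLeft p)

section Conjugation

variable {F : ℝ × ℝ → ℝ × ℝ} {p : ℝ × ℝ} {L : (ℝ × ℝ) ≃L[ℝ] (ℝ × ℝ)}

@[simp] lemma affineHomeo_apply (z : ℝ × ℝ) : affineHomeo p L z = p + L z := rfl

lemma affineHomeo_symm_apply (q : ℝ × ℝ) : (affineHomeo p L).symm q = L.symm (q - p) := by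
  rw [Homeomorph.symm_apply_eq]
  simp

lemma affineHomeo_zero : affineHomeo p L 0 = p := by simp

lemma conjField_neg : conjField (-F) p L = -conjField F p L := by
  ext z <;> simp [conjField]

lemma conjField_zero_eq_zero_iff : conjField F p L 0 = 0 ↔ F p = 0 := by
  simp [conjField]

lemma IsIntegralCurveOn.affineHomeo {γ : ℝ → ℝ × ℝ} {s : Set ℝ}
    (h : IsIntegralCurveOn γ (fun _ => conjField F p L) s) :
    IsIntegralCurveOn (affineHomeo p L ∘ γ) (fun _ => F) s := by
  intro t ht
  have := (L.hasFDerivAt.comp_hasDerivWithinAt t (h t ht)).const_add p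
  simp only [conjField, ContinuousLinearEquiv.coe_coe, ContinuousLinearEquiv.apply_symm_apply]
    at this
  exact this

lemma tendsto_affineHomeo {γ : ℝ → ℝ × ℝ} (h : Tendsto γ atTop (𝓝 0)) :
    Tendsto (affineHomeo p L ∘ γ) atTop (𝓝 p) := by
  have := ((affineHomeo p L).continuous.tendsto 0).comp h
  rwa [affineHomeo_zero] at this

lemma ScalarFieldCosmology.Approaches.affineHomeo {γ : ℝ → ℝ × ℝ}
    (h : Approaches (conjField F p L) γ 0) :
    Approaches F (affineHomeo p L ∘ γ) p :=
  ⟨h.1.affineHomeo, fun t ht h0 => h.2.1 t ht ((_root_.affineHomeo p L).injective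
    (h0.trans affineHomeo_zero.symm)), tendsto_affineHomeo h.2.2⟩

lemma ScalarFieldCosmology.Leaves.affineHomeo {N : Set (ℝ × ℝ)} {q : ℝ × ℝ}
    (h : Leaves (conjField F p L) N q) :
    Leaves F (affineHomeo p L '' N) (affineHomeo p L q) := by
  obtain ⟨γ, T, hT, hγ, h0, hN⟩ := h
  refine ⟨_, T, hT, hγ.affineHomeo, congrArg _ h0, ?_⟩
  rw [Function.comp_apply, (_root_.affineHomeo p L).injective.mem_set_image]
  exact hN

lemma halfOrbit_affineHomeo (γ : ℝ → ℝ × ℝ) :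
    halfOrbit (affineHomeo p L ∘ γ) = affineHomeo p L '' halfOrbit γ := image_comp _ _ _

lemma disjoint_image_affineHomeo {s t : Set (ℝ × ℝ)} (h : Disjoint s t) :
    Disjoint (affineHomeo p L '' s) (affineHomeo p L '' t) :=
  (disjoint_image_iff (affineHomeo p L).injective).mpr h

lemma ScalarFieldCosmology.IsForwardTrajectory.affineHomeo {γ : ℝ → ℝ × ℝ} {q : ℝ × ℝ}
    (h : IsForwardTrajectory (conjField F p L) γ q) :
    IsForwardTrajectory F (affineHomeo p L ∘ γ) (affineHomeo p L q) :=
  ⟨h.1.affineHomeo, congrArg _ h.2⟩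

lemma ScalarFieldCosmology.IsSaddle.of_conjField (h : IsSaddle (conjField F p L) 0) :
    IsSaddle F p := by
  obtain ⟨h0, γ₁, γ₂, γ₃, γ₄, h1, h2, h3, h4, hd, N, hN, hq⟩ := h
  rw [← conjField_neg] at h3 h4 hq
  refine ⟨conjField_zero_eq_zero_iff.mp h0, _, _, _, _, h1.affineHomeo, h2.affineHomeo,
    h3.affineHomeo, h4.affineHomeo, ?_, affineHomeo p L '' N, ?_, ?_⟩
  · simp only [halfOrbit_affineHomeo]
    simp only [List.pairwise_cons, List.mem_cons, List.not_mem_nil, or_false, forall_eq_or_imp,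
      forall_eq, false_imp_iff, implies_true, List.Pairwise.nil, and_true] at hd ⊢
    exact ⟨⟨disjoint_image_affineHomeo hd.1.1, disjoint_image_affineHomeo hd.1.2.1,
      disjoint_image_affineHomeo hd.1.2.2⟩, ⟨disjoint_image_affineHomeo hd.2.1.1,
      disjoint_image_affineHomeo hd.2.1.2⟩, disjoint_image_affineHomeo hd.2.2⟩
  · have := (affineHomeo p L).isOpenMap.image_mem_nhds hN
    rwa [affineHomeo_zero] at this
  · rintro _ ⟨q, hqN, rfl⟩ hne
    have hne' : q ≠ 0 := fun h => hne (by rw [h, affineHomeo_zero])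
    simp only [halfOrbit_affineHomeo, ← image_union, (affineHomeo p L).injective.mem_set_image]
    exact ⟨(hq q hqN hne').1.imp_right Leaves.affineHomeo,
      (hq q hqN hne').2.imp_right Leaves.affineHomeo⟩

lemma localStableSet_image_subset {N : Set (ℝ × ℝ)} :
    affineHomeo p L '' localStableSet (conjField F p L) N 0 ⊆
      localStableSet F (affineHomeo p L '' N) p := by
  rintro _ ⟨q, ⟨γ, hγ, hN, hlim⟩, rfl⟩
  exact ⟨_, hγ.affineHomeo, fun t ht => mem_image_of_mem _ (hN t ht), tendsto_affineHomeo hlim⟩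

lemma ScalarFieldCosmology.IsAsymptoticallyStable.of_conjField
    (h : IsAsymptoticallyStable (conjField F p L) 0) :
    IsAsymptoticallyStable F p := by
  obtain ⟨h0, hs, δ, hδ, ha⟩ := h
  have hcont : Tendsto (affineHomeo p L) (𝓝 0) (𝓝 p) := by
    simpa only [affineHomeo_zero] using (affineHomeo p L).continuous.tendsto 0
  have hcont' : Tendsto (affineHomeo p L).symm (𝓝 p) (𝓝 0) := by
    have := (affineHomeo p L).symm.continuous.tendsto p
    rwa [(affineHomeo p L).symm_apply_eq.mpr affineHomeo_zero.symm] at this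
  refine ⟨conjField_zero_eq_zero_iff.mp h0, fun ε hε => ?_, ?_⟩
  · obtain ⟨ε', hε', hb⟩ := Metric.mem_nhds_iff.mp (hcont (Metric.ball_mem_nhds p hε))
    obtain ⟨δ', hδ', hst⟩ := hs ε' hε'
    obtain ⟨δ'', hδ'', hb'⟩ := Metric.mem_nhds_iff.mp (hcont' (Metric.ball_mem_nhds 0 hδ'))
    refine ⟨δ'', hδ'', fun q hq => ?_⟩
    obtain ⟨γ, hγ, hin⟩ := hst _ (hb' hq)
    exact ⟨affineHomeo p L ∘ γ, by simpa using hγ.affineHomeo, fun t ht => hb (hin t ht)⟩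
  · obtain ⟨δ'', hδ'', hb'⟩ := Metric.mem_nhds_iff.mp (hcont' (Metric.ball_mem_nhds 0 hδ))
    refine ⟨δ'', hδ'', fun q hq => ?_⟩
    obtain ⟨γ, hγ, hlim⟩ := ha _ (hb' hq)
    exact ⟨_, by simpa using hγ.affineHomeo, tendsto_affineHomeo hlim⟩

/-- A positive factor does not change the unit vector, so a limiting direction can be read off from
any positive rescaling of the curve. -/
lemma tendsto_normalized {E : Type*} [NormedAddCommGroup E] [NormedSpace ℝ E] {z : ℝ → E}
    {k : ℝ → ℝ} {v : E} (hv : v ≠ 0) (hk : ∀ᶠ t in atTop, 0 < k t)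
    (h : Tendsto (fun t => k t • z t) atTop (𝓝 v)) :
    Tendsto (fun t => ‖z t‖⁻¹ • z t) atTop (𝓝 (‖v‖⁻¹ • v)) := by
  have := (h.norm.inv₀ (norm_ne_zero_iff.mpr hv)).smul h
  refine this.congr' ?_
  filter_upwards [hk] with t ht
  rw [norm_smul, Real.norm_of_nonneg ht.le, mul_inv, smul_smul, mul_right_comm,
    inv_mul_cancel₀ ht.ne', one_mul]

lemma ScalarFieldCosmology.IsStableNode.of_conjField (h : IsStableNode (conjField F p L) 0) :
    IsStableNode F p := by
  obtain ⟨hs, δ, hδ, ha⟩ := h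
  have hcont' : Tendsto (affineHomeo p L).symm (𝓝 p) (𝓝 0) := by
    have := (affineHomeo p L).symm.continuous.tendsto p
    rwa [(affineHomeo p L).symm_apply_eq.mpr affineHomeo_zero.symm] at this
  obtain ⟨δ', hδ', hb⟩ := Metric.mem_nhds_iff.mp (hcont' (Metric.ball_mem_nhds 0 hδ))
  refine ⟨hs.of_conjField, δ', hδ', fun q hq hne => ?_⟩
  obtain ⟨γ, hγ, hlim, v, hv, hdir⟩ := ha _ (hb hq) fun h0 => hne (by
    rw [Homeomorph.symm_apply_eq, affineHomeo_zero] at h0; exact h0)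
  have hLv : L v ≠ 0 := by simpa using hv
  have hne0 : ∀ᶠ t in atTop, 0 < ‖γ t‖⁻¹ := by
    filter_upwards [hdir.norm.eventually_const_lt (norm_pos_iff.mpr hv)] with t ht
    rw [inv_pos]
    by_contra! hc
    have : γ t - 0 = 0 := by simpa using hc
    simp [this] at ht
  refine ⟨_, by simpa using hγ.affineHomeo, tendsto_affineHomeo hlim, _,
    smul_ne_zero (inv_ne_zero (norm_ne_zero_iff.mpr hLv)) hLv, ?_⟩
  have := tendsto_normalized (z := fun t => L (γ t)) (k := fun t => ‖γ t‖⁻¹) hLv hne0 (by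
    have := (L.continuous.tendsto v).comp hdir
    simpa [Function.comp_def] using! this)
  simpa using this

end Conjugation

/-! ### Linear frames and the linear part of a field on small squares -/

/-- The linear coordinates of the plane with basis `u`, `w`. -/
noncomputable def basisEquiv (u w : ℝ × ℝ) (h : u.1 * w.2 - u.2 * w.1 ≠ 0) :
    (ℝ × ℝ) ≃L[ℝ] (ℝ × ℝ) :=
  LinearEquiv.toContinuousLinearEquiv
    { toFun := fun z => z.1 • u + z.2 • w
      map_add' := fun z z' => by simp only [Prod.fst_add, Prod.snd_add]; module
      map_smul' := fun k z => by
        simp only [Prod.smul_fst, Prod.smul_snd, smul_eq_mul, RingHom.id_apply]; module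
      invFun := fun z => ((z.1 * w.2 - z.2 * w.1) / (u.1 * w.2 - u.2 * w.1),
        (u.1 * z.2 - u.2 * z.1) / (u.1 * w.2 - u.2 * w.1))
      left_inv := fun z => by
        ext
        · simp only [Prod.fst_add, Prod.snd_add, Prod.smul_fst, Prod.smul_snd, smul_eq_mul]
          rw [div_eq_iff h]; ring
        · simp only [Prod.fst_add, Prod.snd_add, Prod.smul_fst, Prod.smul_snd, smul_eq_mul]
          rw [div_eq_iff h]; ring
      right_inv := fun z => by
        ext
        · simp only [Prod.fst_add, Prod.smul_fst, smul_eq_mul]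
          rw [div_mul_eq_mul_div, div_mul_eq_mul_div, ← add_div, div_eq_iff h]; ring
        · simp only [Prod.snd_add, Prod.smul_snd, smul_eq_mul]
          rw [div_mul_eq_mul_div, div_mul_eq_mul_div, ← add_div, div_eq_iff h]; ring }

@[simp] lemma basisEquiv_apply {u w : ℝ × ℝ} (h : u.1 * w.2 - u.2 * w.1 ≠ 0) (z : ℝ × ℝ) :
    basisEquiv u w h z = z.1 • u + z.2 • w := rfl

/-- The linear map of the plane with matrix `!![a, b; c, d]`. -/
noncomputable def planarLinear (a b c d : ℝ) : ℝ × ℝ →L[ℝ] ℝ × ℝ :=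
  (a • ContinuousLinearMap.fst ℝ ℝ ℝ + b • ContinuousLinearMap.snd ℝ ℝ ℝ).prod
    (c • ContinuousLinearMap.fst ℝ ℝ ℝ + d • ContinuousLinearMap.snd ℝ ℝ ℝ)

@[simp] lemma planarLinear_apply (a b c d : ℝ) (z : ℝ × ℝ) :
    planarLinear a b c d z = (a * z.1 + b * z.2, c * z.1 + d * z.2) := rfl

lemma hasStrictFDerivAt_conjField {F : ℝ × ℝ → ℝ × ℝ} {p : ℝ × ℝ} {A : ℝ × ℝ →L[ℝ] ℝ × ℝ}
    (hF : HasStrictFDerivAt F A p) {u w : ℝ × ℝ} (hdet : u.1 * w.2 - u.2 * w.1 ≠ 0) {a b c d : ℝ}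
    (hu : A u = a • u + c • w) (hw : A w = b • u + d • w) :
    HasStrictFDerivAt (conjField F p (basisEquiv u w hdet)) (planarLinear a b c d) 0 := by
  set L := basisEquiv u w hdet with hL
  have h1 : HasStrictFDerivAt (fun z => p + L z) (L : ℝ × ℝ →L[ℝ] ℝ × ℝ) 0 :=
    L.hasStrictFDerivAt.const_add p
  have hF' : HasStrictFDerivAt F A (p + L 0) := by simpa using hF
  have h2 := L.symm.hasStrictFDerivAt.comp (0 : ℝ × ℝ) (hF'.comp (0 : ℝ × ℝ) h1)
  have h3 : (L.symm : ℝ × ℝ →L[ℝ] ℝ × ℝ).comp (A.comp (L : ℝ × ℝ →L[ℝ] ℝ × ℝ)) =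
      planarLinear a b c d := by
    refine ContinuousLinearMap.ext fun z => ?_
    change L.symm (A (L z)) = _
    rw [ContinuousLinearEquiv.symm_apply_eq, hL, basisEquiv_apply, basisEquiv_apply, map_add,
      map_smul, map_smul, hu, hw, planarLinear_apply]
    module
  rwa [h3] at h2

/-- On a small square the field is close to its linear part, with small Lipschitz error. -/
lemma exists_square_approx {G : ℝ × ℝ → ℝ × ℝ} {a b c d : ℝ}
    (hG : HasStrictFDerivAt G (planarLinear a b c d) 0) {ε : ℝ} (hε : 0 < ε) :
    ∃ r > 0, (∃ K, LipschitzOnWith K G (Metric.closedBall 0 r)) ∧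
      ∀ z ∈ Metric.closedBall (0 : ℝ × ℝ) r, ∀ z' ∈ Metric.closedBall (0 : ℝ × ℝ) r,
        |(G z).1 - (G z').1 - (a * (z.1 - z'.1) + b * (z.2 - z'.2))| ≤
          ε * max |z.1 - z'.1| |z.2 - z'.2| ∧
        |(G z).2 - (G z').2 - (c * (z.1 - z'.1) + d * (z.2 - z'.2))| ≤
          ε * max |z.1 - z'.1| |z.2 - z'.2| := by
  obtain ⟨s, hs, happ⟩ := hG.approximates_deriv_on_nhds (c := ⟨ε, hε.le⟩) (Or.inr hε)
  obtain ⟨K, t, ht, hK⟩ := hG.exists_lipschitzOnWith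
  obtain ⟨r, hr, hb⟩ := Metric.nhds_basis_closedBall.mem_iff.mp (inter_mem hs ht)
  refine ⟨r, hr, ⟨K, hK.mono (hb.trans inter_subset_right)⟩, fun z hz z' hz' => ?_⟩
  have := happ z (hb hz).1 z' (hb hz').1
  rw [Prod.norm_def, Prod.norm_def, max_le_iff] at this
  simpa using! this

lemma exists_square_approx_zero {G : ℝ × ℝ → ℝ × ℝ} {a b c d : ℝ} (h0 : G 0 = 0)
    (hG : HasStrictFDerivAt G (planarLinear a b c d) 0) {ε : ℝ} (hε : 0 < ε) :
    ∃ r > 0, (∃ K, LipschitzOnWith K G (Metric.closedBall 0 r)) ∧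
      ∀ z ∈ Metric.closedBall (0 : ℝ × ℝ) r,
        |(G z).1 - (a * z.1 + b * z.2)| ≤ ε * max |z.1| |z.2| ∧
        |(G z).2 - (c * z.1 + d * z.2)| ≤ ε * max |z.1| |z.2| := by
  obtain ⟨r, hr, hK, h⟩ := exists_square_approx hG hε
  refine ⟨r, hr, hK, fun z hz => ?_⟩
  simpa [h0] using h z hz 0 (Metric.mem_closedBall_self hr.le)

/-! ### Hyperbolic saddles -/

/-- In the horizontal cone each of the two error terms costs at most `ε x²`. Only `d ≤ 0` is needed,
so the degenerate direction of a saddle-node is admitted. -/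
lemma isConeExpanding_of_approx {G : ℝ × ℝ → ℝ × ℝ} {r a d ε : ℝ} (hr : 0 < r) (hε : 2 * ε < a)
    (hd : d ≤ 0) (h0 : G 0 = 0) (hK : ∃ K, LipschitzOnWith K G (Metric.closedBall 0 r))
    (h : ∀ z ∈ Metric.closedBall (0 : ℝ × ℝ) r, ∀ z' ∈ Metric.closedBall (0 : ℝ × ℝ) r,
        |(G z).1 - (G z').1 - a * (z.1 - z'.1)| ≤ ε * max |z.1 - z'.1| |z.2 - z'.2| ∧
        |(G z).2 - (G z').2 - d * (z.2 - z'.2)| ≤ ε * max |z.1 - z'.1| |z.2 - z'.2|) :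
    IsConeExpanding G r (a - 2 * ε) := by
  refine ⟨hr, by linarith, h0, hK, fun z hz z' hz' hc => ?_⟩
  obtain ⟨h1, h2⟩ := h z hz z' hz'
  rw [max_eq_left hc] at h1 h2
  set x := z.1 - z'.1
  set y := z.2 - z'.2
  set P := (G z).1 - (G z').1 - a * x with hP
  set R := (G z).2 - (G z').2 - d * y with hR
  have e1 : |x * P| ≤ ε * x ^ 2 := by
    rw [abs_mul, ← sq_abs x]
    nlinarith [mul_le_mul_of_nonneg_left h1 (abs_nonneg x)]
  have e2 : |y * R| ≤ ε * x ^ 2 := by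
    rw [abs_mul, ← sq_abs x]
    nlinarith [mul_le_mul hc h2 (abs_nonneg R) (abs_nonneg x)]
  have e3 : 0 ≤ -d * y ^ 2 := mul_nonneg (by linarith) (sq_nonneg y)
  have k1 : (G z).1 - (G z').1 = a * x + P := by rw [hP]; ring
  have k2 : (G z).2 - (G z').2 = d * y + R := by rw [hR]; ring
  rw [k1, k2]
  nlinarith [abs_le.mp e1, abs_le.mp e2]

/-- The local stable set of a field with an expanding and an attracting direction consists of two
trajectories, one on each side. -/
lemma IsConeExpanding.exists_stable_halves {G : ℝ × ℝ → ℝ × ℝ} {r c : ℝ}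
    (h : IsConeExpanding G r c)
    (hv : ∀ σ : ℝ, (σ = 1 ∨ σ = -1) → ∀ z ∈ Metric.closedBall (0 : ℝ × ℝ) r,
      |z.1| ≤ σ * z.2 → 0 < σ * z.2 → σ * (G z).2 < 0) :
    ∃ γ₁ γ₂, Approaches G γ₁ 0 ∧ Approaches G γ₂ 0 ∧ (∀ t, 0 ≤ t → |(γ₁ t).1| < (γ₁ t).2) ∧
      (∀ t, 0 ≤ t → |(γ₂ t).1| < -(γ₂ t).2) ∧
      ∀ q ∈ Metric.ball (0 : ℝ × ℝ) r, q ≠ 0 →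
        q ∈ halfOrbit γ₁ ∪ halfOrbit γ₂ ∨ Leaves G (Metric.ball 0 r) q := by
  obtain ⟨K, hK⟩ := h.lip
  obtain ⟨φ, hφ⟩ := exists_isCutoffFlow h.r_pos.le hK
  obtain ⟨γ₁, h1, c1, u1⟩ := h.exists_unique_approaching hφ (Or.inl rfl) (hv 1 (Or.inl rfl))
  obtain ⟨γ₂, h2, c2, u2⟩ := h.exists_unique_approaching hφ (Or.inr rfl) (hv (-1) (Or.inr rfl))
  refine ⟨γ₁, γ₂, h1, h2, by simpa using c1, by simpa using c2, fun q hq hne => ?_⟩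
  by_cases hst : ∀ t, 0 ≤ t → φ q t ∈ Metric.ball 0 r
  · have hst' := fun t ht => Metric.ball_subset_closedBall (hst t ht)
    have hlt := h.sq_lt_sq_of_forall_mem hφ hst' hne le_rfl
    rw [hφ.zero] at hlt
    left
    rcases lt_trichotomy q.2 0 with h0 | h0 | h0
    · exact Or.inr (u2 q hst' (by linarith))
    · rw [h0] at hlt
      nlinarith [sq_nonneg q.1]
    · exact Or.inl (u1 q hst' (by linarith))
  · push Not at hst
    exact Or.inr (hφ.leaves Metric.isOpen_ball Metric.ball_subset_closedBall hq hst)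

lemma vertical_attracting_of_approx {G : ℝ × ℝ → ℝ × ℝ} {r a d ε : ℝ} (hε : ε < -d)
    (h : ∀ z ∈ Metric.closedBall (0 : ℝ × ℝ) r,
        |(G z).1 - a * z.1| ≤ ε * max |z.1| |z.2| ∧
        |(G z).2 - d * z.2| ≤ ε * max |z.1| |z.2|) (σ : ℝ) (hσ : σ = 1 ∨ σ = -1)
    (z : ℝ × ℝ) (hz : z ∈ Metric.closedBall (0 : ℝ × ℝ) r) (hc : |z.1| ≤ σ * z.2)
    (h0 : 0 < σ * z.2) : σ * (G z).2 < 0 := by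
  have h1 := (h z hz).2
  have habs : |z.2| = σ * z.2 := by
    rw [← abs_of_pos h0, abs_mul]
    rcases hσ with rfl | rfl <;> simp
  rw [max_eq_right (habs ▸ hc), habs, abs_le] at h1
  rcases hσ with rfl | rfl <;> nlinarith

/-- The exchange of the two coordinates. -/
abbrev swapEquiv : (ℝ × ℝ) ≃L[ℝ] (ℝ × ℝ) := ContinuousLinearEquiv.prodComm ℝ ℝ ℝ

/-- The unstable branches are the stable ones of `-G` with coordinates exchanged, which has the same
form with `(a, d)` replaced by `(-d, -a)`. Stable branches lie in the vertical cone and unstable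
ones in the horizontal cone, whence disjointness. -/
lemma isSaddle_of_approx {G : ℝ × ℝ → ℝ × ℝ} {r a d ε : ℝ} (hr : 0 < r) (ha : 2 * ε < a)
    (hd : 2 * ε < -d) (hε : 0 < ε) (h0 : G 0 = 0)
    (hK : ∃ K, LipschitzOnWith K G (Metric.closedBall 0 r))
    (h : ∀ z ∈ Metric.closedBall (0 : ℝ × ℝ) r, ∀ z' ∈ Metric.closedBall (0 : ℝ × ℝ) r,
        |(G z).1 - (G z').1 - a * (z.1 - z'.1)| ≤ ε * max |z.1 - z'.1| |z.2 - z'.2| ∧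
        |(G z).2 - (G z').2 - d * (z.2 - z'.2)| ≤ ε * max |z.1 - z'.1| |z.2 - z'.2|) :
    IsSaddle G 0 := by
  set G' := conjField (-G) 0 swapEquiv with hG'
  have hG'v : ∀ z, G' z = (-(G z.swap).2, -(G z.swap).1) := fun z => by
    rw [hG', conjField, zero_add]; rfl
  have hswap : ∀ {z : ℝ × ℝ} {ρ : ℝ}, z ∈ Metric.closedBall (0 : ℝ × ℝ) ρ →
      z.swap ∈ Metric.closedBall (0 : ℝ × ℝ) ρ := fun hz => by
    rw [mem_closedBall_zero_prod] at hz ⊢; exact hz.symm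
  have hK' : ∃ K, LipschitzOnWith K G' (Metric.closedBall 0 r) := by
    obtain ⟨K, hK⟩ := hK
    refine ⟨K, LipschitzOnWith.of_dist_le_mul fun z hz z' hz' => ?_⟩
    have := hK.dist_le_mul _ (hswap hz) _ (hswap hz')
    rw [hG'v, hG'v]
    simpa [Prod.dist_eq, max_comm] using this
  have h' : ∀ z ∈ Metric.closedBall (0 : ℝ × ℝ) r, ∀ z' ∈ Metric.closedBall (0 : ℝ × ℝ) r,
        |(G' z).1 - (G' z').1 - -d * (z.1 - z'.1)| ≤ ε * max |z.1 - z'.1| |z.2 - z'.2| ∧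
        |(G' z).2 - (G' z').2 - -a * (z.2 - z'.2)| ≤ ε * max |z.1 - z'.1| |z.2 - z'.2| := by
    intro z hz z' hz'
    have := h _ (hswap hz) _ (hswap hz')
    simp only [Prod.fst_swap, Prod.snd_swap] at this
    rw [hG'v, hG'v, max_comm]
    refine ⟨?_, ?_⟩
    · rw [← abs_neg]; convert! this.2 using 2; ring
    · rw [← abs_neg]; convert! this.1 using 2; ring
  have h0' : G' 0 = 0 := by simp [hG'v, h0]
  have hz : ∀ {H : ℝ × ℝ → ℝ × ℝ} {a d : ℝ}, H 0 = 0 → (∀ z ∈ Metric.closedBall (0 : ℝ × ℝ) r,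
      ∀ z' ∈ Metric.closedBall (0 : ℝ × ℝ) r,
        |(H z).1 - (H z').1 - a * (z.1 - z'.1)| ≤ ε * max |z.1 - z'.1| |z.2 - z'.2| ∧
        |(H z).2 - (H z').2 - d * (z.2 - z'.2)| ≤ ε * max |z.1 - z'.1| |z.2 - z'.2|) →
      ∀ z ∈ Metric.closedBall (0 : ℝ × ℝ) r, |(H z).1 - a * z.1| ≤ ε * max |z.1| |z.2| ∧
        |(H z).2 - d * z.2| ≤ ε * max |z.1| |z.2| := fun hH0 hH z hz => by
    simpa [hH0] using hH z hz 0 (Metric.mem_closedBall_self hr.le)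
  obtain ⟨γ₁, γ₂, s1, s2, c1, c2, hs⟩ :=
    (isConeExpanding_of_approx hr ha (by linarith) h0 hK h).exists_stable_halves
      (vertical_attracting_of_approx (by linarith) (hz h0 h))
  obtain ⟨η₃, η₄, s3, s4, c3, c4, hs'⟩ :=
    (isConeExpanding_of_approx hr hd (by linarith) h0' hK' h').exists_stable_halves
      (vertical_attracting_of_approx (by linarith) (hz h0' h'))
  have k : ∀ z, affineHomeo 0 swapEquiv z = z.swap := fun z => by simp
  refine ⟨h0, γ₁, γ₂, _, _, s1, s2, s3.affineHomeo, s4.affineHomeo, ?_, Metric.ball 0 r,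
    Metric.ball_mem_nhds 0 hr, fun q hq hne => ⟨hs q hq hne, ?_⟩⟩
  · simp only [List.pairwise_cons, List.mem_cons, List.not_mem_nil, or_false, forall_eq_or_imp,
      forall_eq, false_imp_iff, implies_true, List.Pairwise.nil, and_true, Set.disjoint_left,
      halfOrbit]
    refine ⟨⟨?_, ?_, ?_⟩, ⟨?_, ?_⟩, ?_⟩ <;> rintro _ ⟨t, ht, rfl⟩ ⟨s, hs, he⟩
    · have := c1 t ht; have := c2 s hs; rw [he] at this
      linarith [abs_nonneg (γ₁ t).1]
    · have := c1 t ht; have := c3 s hs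
      rw [← he] at *
      simp only [Function.comp_apply, k, Prod.fst_swap, Prod.snd_swap] at *
      linarith [le_abs_self (η₃ s).1, le_abs_self (η₃ s).2]
    · have := c1 t ht; have := c4 s hs
      rw [← he] at *
      simp only [Function.comp_apply, k, Prod.fst_swap, Prod.snd_swap] at *
      linarith [le_abs_self (η₄ s).1, neg_le_abs (η₄ s).2]
    · have := c2 t ht; have := c3 s hs
      rw [← he] at *
      simp only [Function.comp_apply, k, Prod.fst_swap, Prod.snd_swap] at *
      linarith [neg_le_abs (η₃ s).1, le_abs_self (η₃ s).2]
    · have := c2 t ht; have := c4 s hs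
      rw [← he] at *
      simp only [Function.comp_apply, k, Prod.fst_swap, Prod.snd_swap] at *
      linarith [neg_le_abs (η₄ s).1, neg_le_abs (η₄ s).2]
    · have h3 := c3 t ht; have h4 := c4 s hs
      simp only [Function.comp_apply, k] at he
      rw [Prod.swap_inj.mp he] at h4
      linarith [abs_nonneg (η₃ t).1]
  · have hq' : q.swap ∈ Metric.ball (0 : ℝ × ℝ) r := by
      rw [mem_ball_zero_prod] at hq ⊢; exact hq.symm
    have himg : affineHomeo 0 swapEquiv '' Metric.ball (0 : ℝ × ℝ) r = Metric.ball 0 r := by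
      ext z
      simp only [mem_image, k, mem_ball_zero_prod]
      exact ⟨by rintro ⟨w, hw, rfl⟩; exact hw.symm, fun hz => ⟨z.swap, hz.symm, z.swap_swap⟩⟩
    have hkq : affineHomeo 0 swapEquiv q.swap = q := by rw [k, Prod.swap_swap]
    rcases hs' q.swap hq' (fun h => hne (by rw [← q.swap_swap, h]; rfl)) with hm | hl
    · left
      rw [halfOrbit_affineHomeo, halfOrbit_affineHomeo, ← image_union, ← hkq]
      exact mem_image_of_mem _ hm
    · right
      have := hl.affineHomeo
      rwa [himg, hkq] at this

/-- A critical point with one positive and one negative eigenvalue is a saddle. -/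
theorem isSaddle_of_hasStrictFDerivAt {F : ℝ × ℝ → ℝ × ℝ} {p : ℝ × ℝ} {A : ℝ × ℝ →L[ℝ] ℝ × ℝ}
    (hF : HasStrictFDerivAt F A p) (h0 : F p = 0) {u w : ℝ × ℝ}
    (hdet : u.1 * w.2 - u.2 * w.1 ≠ 0) {a d : ℝ} (hu : A u = a • u) (hw : A w = d • w)
    (ha : 0 < a) (hd : d < 0) : IsSaddle F p := by
  have hG := hasStrictFDerivAt_conjField hF hdet (a := a) (b := 0) (c := 0) (d := d)
    (by rw [hu]; module) (by rw [hw]; module)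
  have hG0 : conjField F p (basisEquiv u w hdet) 0 = 0 := conjField_zero_eq_zero_iff.mpr h0
  have hε : 0 < min a (-d) / 4 := div_pos (lt_min ha (by linarith)) (by norm_num)
  obtain ⟨r, hr, hK, h⟩ := exists_square_approx hG hε
  have m1 := min_le_left a (-d)
  have m2 := min_le_right a (-d)
  refine IsSaddle.of_conjField (L := basisEquiv u w hdet)
    (isSaddle_of_approx (a := a) (d := d) hr (by linarith) (by linarith) hε hG0 hK ?_)
  simpa using h

/-! ### Sinks -/

/-- On the square of half-side `r`, the Euclidean norm decays at rate `s`. -/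
structure IsSink (G : ℝ × ℝ → ℝ × ℝ) (r s : ℝ) : Prop where
  r_pos : 0 < r
  s_pos : 0 < s
  zero : G 0 = 0
  lip : ∃ K, LipschitzOnWith K G (Metric.closedBall 0 r)
  decay : ∀ z ∈ Metric.closedBall (0 : ℝ × ℝ) r,
    z.1 * (G z).1 + z.2 * (G z).2 ≤ -s * (z.1 ^ 2 + z.2 ^ 2)

lemma abs_mul_add_mul_le_of_max {x y f g ε : ℝ} (hf : |f| ≤ ε * max |x| |y|)
    (hg : |g| ≤ ε * max |x| |y|) : |x * f + y * g| ≤ 2 * ε * (x ^ 2 + y ^ 2) := by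
  set m := max |x| |y| with hm
  have hx : |x| ≤ m := le_max_left _ _
  have hy : |y| ≤ m := le_max_right _ _
  have hm0 : 0 ≤ m := (abs_nonneg x).trans hx
  have hm2 : m ^ 2 ≤ x ^ 2 + y ^ 2 := by
    rcases max_choice |x| |y| with h | h <;> rw [hm, h, sq_abs]
    · linarith [sq_nonneg y]
    · linarith [sq_nonneg x]
  have h1 : |x * f| ≤ m * (ε * m) := by
    rw [abs_mul]; exact mul_le_mul hx hf (abs_nonneg _) hm0
  have h2 : |y * g| ≤ m * (ε * m) := by
    rw [abs_mul]; exact mul_le_mul hy hg (abs_nonneg _) hm0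
  have hε : 0 ≤ ε * m := (abs_nonneg f).trans hf
  rcases hm0.eq_or_lt with h0 | h0
  · rw [← h0] at hx hy
    rw [abs_nonpos_iff.mp hx, abs_nonpos_iff.mp hy]
    simp
  · have hε0 : 0 ≤ ε := nonneg_of_mul_nonneg_left hε h0
    calc |x * f + y * g| ≤ |x * f| + |y * g| := abs_add_le _ _
      _ ≤ 2 * ε * m ^ 2 := by linarith
      _ ≤ _ := mul_le_mul_of_nonneg_left hm2 (by linarith)

/-- The margin `s' - s` absorbs the nonlinear error. The off-diagonal entries enter only through `b
+ c`, so a rotational part costs nothing. -/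
lemma exists_isSink {G : ℝ × ℝ → ℝ × ℝ} {a b c d s s' : ℝ} (h0 : G 0 = 0)
    (hG : HasStrictFDerivAt G (planarLinear a b c d) 0) (hs : 0 < s) (hss' : s < s')
    (hq : ∀ u v, a * u ^ 2 + (b + c) * (u * v) + d * v ^ 2 ≤ -s' * (u ^ 2 + v ^ 2)) :
    ∃ r, IsSink G r s := by
  obtain ⟨r, hr, hK, h⟩ := exists_square_approx_zero h0 hG (ε := (s' - s) / 2) (by linarith)
  refine ⟨r, hr, hs, h0, hK, fun z hz => ?_⟩
  have := (abs_le.mp (abs_mul_add_mul_le_of_max (h z hz).1 (h z hz).2)).2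
  have := hq z.1 z.2
  nlinarith

namespace IsSink

variable {G : ℝ × ℝ → ℝ × ℝ} {r s : ℝ} {φ : ℝ × ℝ → ℝ → ℝ × ℝ} {q : ℝ × ℝ}

lemma hasDerivAt_normSq (hφ : IsCutoffFlow G r φ) {t : ℝ}
    (hm : φ q t ∈ Metric.closedBall 0 r) :
    HasDerivAt (fun t => (φ q t).1 ^ 2 + (φ q t).2 ^ 2)
      (2 * ((φ q t).1 * (G (φ q t)).1 + (φ q t).2 * (G (φ q t)).2)) t := by
  convert! ((hφ.deriv_fst_of_mem hm).pow 2).add ((hφ.deriv_snd_of_mem hm).pow 2) using 1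
  push_cast
  ring

lemma mem_closedBall_of_lt (hr : 0 < r) {z : ℝ × ℝ} (h : z.1 ^ 2 + z.2 ^ 2 < r ^ 2) :
    z ∈ Metric.closedBall (0 : ℝ × ℝ) r := by
  rw [mem_closedBall_zero_prod]
  constructor <;> refine abs_le_of_sq_le_sq ?_ hr.le <;> nlinarith [sq_nonneg z.1, sq_nonneg z.2]

/-- The disc inscribed in the square is forward invariant: before a first exit the norm cannot
increase. -/
lemma normSq_lt (h : IsSink G r s) (hφ : IsCutoffFlow G r φ) (hq : q.1 ^ 2 + q.2 ^ 2 < r ^ 2)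
    {t : ℝ} (ht : 0 ≤ t) : (φ q t).1 ^ 2 + (φ q t).2 ^ 2 < r ^ 2 := by
  refine forall_mem_of_no_first_exit (U := {z : ℝ × ℝ | z.1 ^ 2 + z.2 ^ 2 < r ^ 2})
    (isOpen_lt (by fun_prop) continuous_const) (hφ.continuous q) (by rwa [hφ.zero]) ?_ t ht
  intro T hT hin
  have hcont : Continuous fun t => (φ q t).1 ^ 2 + (φ q t).2 ^ 2 :=
    ((hφ.continuous q).fst.pow 2).add ((hφ.continuous q).snd.pow 2)
  have anti : AntitoneOn (fun t => (φ q t).1 ^ 2 + (φ q t).2 ^ 2) (Icc 0 T) := by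
    refine antitoneOn_of_hasDerivWithinAt_nonpos (convex_Icc 0 T) hcont.continuousOn
      (f' := fun t => 2 * ((φ q t).1 * (G (φ q t)).1 + (φ q t).2 * (G (φ q t)).2))
      (fun t ht => ?_) fun t ht => ?_
    all_goals
      rw [interior_Icc] at ht
      have hm := mem_closedBall_of_lt h.r_pos (hin t ht.1.le ht.2)
    · exact (hasDerivAt_normSq hφ hm).hasDerivWithinAt
    · nlinarith [h.decay _ hm, h.s_pos, sq_nonneg (φ q t).1, sq_nonneg (φ q t).2]
  have := anti (left_mem_Icc.mpr hT.le) (right_mem_Icc.mpr hT.le) hT.le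
  simp only [hφ.zero] at this
  exact this.trans_lt hq

lemma mem (h : IsSink G r s) (hφ : IsCutoffFlow G r φ) (hq : q.1 ^ 2 + q.2 ^ 2 < r ^ 2)
    {t : ℝ} (ht : 0 ≤ t) : φ q t ∈ Metric.closedBall (0 : ℝ × ℝ) r :=
  mem_closedBall_of_lt h.r_pos (h.normSq_lt hφ hq ht)

lemma normSq_le (h : IsSink G r s) (hφ : IsCutoffFlow G r φ) (hq : q.1 ^ 2 + q.2 ^ 2 < r ^ 2)
    {t : ℝ} (ht : 0 ≤ t) :
    (φ q t).1 ^ 2 + (φ q t).2 ^ 2 ≤ (q.1 ^ 2 + q.2 ^ 2) * Real.exp (-(2 * s * t)) := by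
  have anti := antitoneOn_of_hasDerivAt_nonpos (a := 0)
    (f := fun t => ((φ q t).1 ^ 2 + (φ q t).2 ^ 2) * Real.exp (2 * s * t))
    (fun t ht => (hasDerivAt_normSq hφ (h.mem hφ hq ht)).mul
      (((hasDerivAt_id t).const_mul (2 * s)).exp)) (fun t ht => by
      have := h.decay _ (h.mem hφ hq ht)
      have he := Real.exp_pos (2 * s * t)
      simp only [id]
      nlinarith)
  have := anti (mem_Ici.mpr le_rfl) ht ht
  simp only [hφ.zero, mul_zero, Real.exp_zero, mul_one] at this
  rw [Real.exp_neg, ← div_eq_mul_inv, le_div_iff₀ (Real.exp_pos _)]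
  exact this

lemma normSq_lt_of_mem_ball {δ : ℝ} (hq : q ∈ Metric.ball 0 (δ / 2)) :
    q.1 ^ 2 + q.2 ^ 2 < δ ^ 2 := by
  rw [mem_ball_zero_prod] at hq
  have h1 := sq_lt_sq' (abs_lt.mp hq.1).1 (abs_lt.mp hq.1).2
  have h2 := sq_lt_sq' (abs_lt.mp hq.2).1 (abs_lt.mp hq.2).2
  nlinarith [sq_nonneg δ]

lemma tendsto (h : IsSink G r s) (hφ : IsCutoffFlow G r φ) (hq : q.1 ^ 2 + q.2 ^ 2 < r ^ 2) :
    Tendsto (φ q) atTop (𝓝 0) := by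
  have hexp : Tendsto (fun t => (q.1 ^ 2 + q.2 ^ 2) * Real.exp (-(2 * s * t))) atTop (𝓝 0) := by
    have h1 : Tendsto (fun t => 2 * s * t) atTop atTop :=
      tendsto_id.const_mul_atTop (by linarith [h.s_pos])
    simpa using (Real.tendsto_exp_neg_atTop_nhds_zero.comp h1).const_mul (q.1 ^ 2 + q.2 ^ 2)
  have key : ∀ f : ℝ → ℝ, (∀ t, 0 ≤ t → f t ^ 2 ≤ (φ q t).1 ^ 2 + (φ q t).2 ^ 2) →
      Tendsto f atTop (𝓝 0) := by
    intro f hf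
    have h2 : Tendsto (fun t => f t ^ 2) atTop (𝓝 0) := by
      refine squeeze_zero' (.of_forall fun t => sq_nonneg _) ?_ hexp
      filter_upwards [eventually_ge_atTop 0] with t ht
      exact (hf t ht).trans (h.normSq_le hφ hq ht)
    have h3 := h2.sqrt
    simp only [Real.sqrt_sq_eq_abs, Real.sqrt_zero] at h3
    exact (tendsto_zero_iff_abs_tendsto_zero f).mpr h3
  rw [show (0 : ℝ × ℝ) = (0, 0) from rfl]
  exact (key _ fun t _ => by linarith [sq_nonneg (φ q t).2]).prodMk_nhds
    (key _ fun t _ => by linarith [sq_nonneg (φ q t).1])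

lemma isForwardTrajectory (h : IsSink G r s) (hφ : IsCutoffFlow G r φ)
    (hq : q.1 ^ 2 + q.2 ^ 2 < r ^ 2) : IsForwardTrajectory G (φ q) q :=
  ⟨hφ.isIntegralCurveOn fun _ ht => h.mem hφ hq ht, hφ.zero q⟩

lemma flow_ne_zero (h : IsSink G r s) (hφ : IsCutoffFlow G r φ) (hne : q ≠ 0) (t : ℝ) :
    φ q t ≠ 0 := by
  obtain ⟨K, hK⟩ := h.lip
  intro h0
  exact hne (hφ.injective (t := t) (by rw [h0, zero_cutoffFlow h.r_pos.le hK h.zero hφ]))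

theorem isAsymptoticallyStable (h : IsSink G r s) : IsAsymptoticallyStable G 0 := by
  obtain ⟨K, hK⟩ := h.lip
  obtain ⟨φ, hφ⟩ := exists_isCutoffFlow h.r_pos.le hK
  refine ⟨h.zero, fun ε hε => ?_, r / 2, by linarith [h.r_pos], fun q hq => ?_⟩
  · refine ⟨min ε r / 2, half_pos (lt_min hε h.r_pos), fun q hq => ?_⟩
    have h1 := normSq_lt_of_mem_ball hq
    have h2 : (min ε r) ^ 2 ≤ r ^ 2 := pow_le_pow_left₀ (lt_min hε h.r_pos).le (min_le_right _ _) 2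
    have h3 : (min ε r) ^ 2 ≤ ε ^ 2 := pow_le_pow_left₀ (lt_min hε h.r_pos).le (min_le_left _ _) 2
    have hq' := h1.trans_le h2
    refine ⟨φ q, h.isForwardTrajectory hφ hq', fun t ht => ?_⟩
    have h4 := h.normSq_le hφ hq' ht
    have h5 : Real.exp (-(2 * s * t)) ≤ 1 := Real.exp_le_one_iff.mpr (by
      have := mul_nonneg h.s_pos.le ht; linarith)
    have h6 : (φ q t).1 ^ 2 + (φ q t).2 ^ 2 < ε ^ 2 := by
      nlinarith [sq_nonneg q.1, sq_nonneg q.2]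
    rw [mem_ball_zero_prod]
    constructor <;> refine abs_lt_of_sq_lt_sq ?_ hε.le <;>
      nlinarith [sq_nonneg (φ q t).1, sq_nonneg (φ q t).2]
  · have hq' := normSq_lt_of_mem_ball hq
    exact ⟨φ q, h.isForwardTrajectory hφ hq', h.tendsto hφ hq'⟩

/-- A sink all of whose trajectories have a limiting direction is a stable node. -/
theorem isStableNode (h : IsSink G r s)
    (hdir : ∀ φ q, IsCutoffFlow G r φ → q.1 ^ 2 + q.2 ^ 2 < r ^ 2 → q ≠ 0 →
      ∃ (k : ℝ → ℝ) (v : ℝ × ℝ), v ≠ 0 ∧ (∀ᶠ t in atTop, 0 < k t) ∧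
        Tendsto (fun t => k t • φ q t) atTop (𝓝 v)) : IsStableNode G 0 := by
  obtain ⟨K, hK⟩ := h.lip
  obtain ⟨φ, hφ⟩ := exists_isCutoffFlow h.r_pos.le hK
  refine ⟨h.isAsymptoticallyStable, r / 2, by linarith [h.r_pos], fun q hq hne => ?_⟩
  have hq' := normSq_lt_of_mem_ball hq
  obtain ⟨k, v, hv, hk, hlim⟩ := hdir φ q hφ hq' hne
  refine ⟨φ q, h.isForwardTrajectory hφ hq', h.tendsto hφ hq', _,
    smul_ne_zero (inv_ne_zero (norm_ne_zero_iff.mpr hv)) hv, ?_⟩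
  simpa using tendsto_normalized hv hk hlim

end IsSink

/-! ### Limiting directions: distinct eigenvalues -/

lemma tendsto_exp_mul_sub {κ T : ℝ} (hκ : 0 < κ) :
    Tendsto (fun t => Real.exp (κ * (T - t))) atTop (𝓝 0) := by
  refine Real.tendsto_exp_atBot.comp ?_
  have : Tendsto (fun t : ℝ => T - t) atTop atBot :=
    tendsto_atBot_add_const_left _ T tendsto_neg_atTop_atBot
  exact this.const_mul_atBot hκ

/-- Here `w' = -κ w + o(1)`. Completing the square turns the error bound `κ ε / 2` into `(w² -
ε²/4)' ≤ -κ (w² - ε²/4)`. -/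
lemma tendsto_zero_of_hasDerivAt_contracting {w w' : ℝ → ℝ} {κ T : ℝ} (hκ : 0 < κ)
    (hd : ∀ t, T ≤ t → HasDerivAt w (w' t) t)
    (hw : ∀ ε > 0, ∀ᶠ t in atTop, |w' t + κ * w t| ≤ ε) : Tendsto w atTop (𝓝 0) := by
  rw [Metric.tendsto_atTop']
  intro ε hε
  obtain ⟨T₁, hT₁⟩ := eventually_atTop.mp ((hw (κ * ε / 2) (by positivity)).and
    (eventually_ge_atTop T))
  have hdiff : ∀ t, T₁ ≤ t → 2 * w t * w' t ≤ -κ * (w t ^ 2 - ε ^ 2 / 4) := by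
    intro t ht
    have h1 := (hT₁ t ht).1
    have h2 : 2 * w t * (w' t + κ * w t) ≤ κ * w t ^ 2 + κ * (ε ^ 2 / 4) := by
      have h3 : 2 * w t * (w' t + κ * w t) ≤ 2 * |w t| * (κ * ε / 2) := by
        calc _ ≤ |2 * w t * (w' t + κ * w t)| := le_abs_self _
          _ = 2 * |w t| * |w' t + κ * w t| := by rw [abs_mul, abs_mul, abs_two]
          _ ≤ _ := by gcongr
      have h4 : 0 ≤ κ * (|w t| - ε / 2) ^ 2 := by positivity
      have h5 := sq_abs (w t)
      nlinarith
    nlinarith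
  have anti := antitoneOn_of_hasDerivAt_nonpos (a := T₁)
    (f := fun t => (w t ^ 2 - ε ^ 2 / 4) * Real.exp (κ * t))
    (fun t ht => (((hd t (hT₁ t ht).2).pow 2).sub_const (ε ^ 2 / 4)).mul
      (((hasDerivAt_id t).const_mul κ).exp)) (fun t ht => by
      have h1 := hdiff t ht
      have he := Real.exp_pos (κ * t)
      simp only [id, Pi.pow_apply]
      push_cast
      nlinarith)
  have hbound : ∀ t, T₁ ≤ t →
      w t ^ 2 ≤ ε ^ 2 / 4 + (w T₁ ^ 2) * Real.exp (κ * (T₁ - t)) := by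
    intro t ht
    have h1 := anti (mem_Ici.mpr le_rfl) ht ht
    simp only at h1
    have he := Real.exp_pos (κ * t)
    have h2 : Real.exp (κ * (T₁ - t)) = Real.exp (κ * T₁) / Real.exp (κ * t) := by
      rw [← Real.exp_sub]; ring_nf
    have h3 : w t ^ 2 - ε ^ 2 / 4 ≤ (w T₁ ^ 2 - ε ^ 2 / 4) * Real.exp (κ * (T₁ - t)) := by
      rw [h2, ← mul_div_assoc, le_div_iff₀ he]; exact h1
    have h4 := Real.exp_pos (κ * (T₁ - t))
    nlinarith [sq_nonneg ε]
  have hlim := (tendsto_exp_mul_sub (T := T₁) hκ).const_mul (w T₁ ^ 2)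
  rw [mul_zero] at hlim
  obtain ⟨T₂, hT₂⟩ := eventually_atTop.mp (hlim.eventually_lt_const
    (show (0 : ℝ) < ε ^ 2 / 4 by positivity))
  refine ⟨max T₁ T₂, fun t ht => ?_⟩
  have h1 := hbound t ((le_max_left _ _).trans ht.le)
  have h2 := hT₂ t ((le_max_right _ _).trans ht.le)
  rw [Real.dist_eq, sub_zero]
  refine abs_lt_of_sq_lt_sq ?_ hε.le
  nlinarith [sq_pos_of_pos hε]

/-- Now `w' = κ w + o(1)`, and `w² - ε²/4` satisfies the opposite inequality: once positive it grows
without bound. A bounded `w` must therefore tend to zero. -/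
lemma tendsto_zero_of_hasDerivAt_expanding {w w' : ℝ → ℝ} {κ T : ℝ} (hκ : 0 < κ)
    (hd : ∀ t, T ≤ t → HasDerivAt w (w' t) t) (hb : ∀ t, T ≤ t → w t ^ 2 ≤ 1)
    (hw : ∀ ε > 0, ∀ᶠ t in atTop, |w' t - κ * w t| ≤ ε) : Tendsto w atTop (𝓝 0) := by
  rw [Metric.tendsto_atTop']
  intro ε hε
  obtain ⟨T₁, hT₁⟩ := eventually_atTop.mp ((hw (κ * ε / 2) (by positivity)).and
    (eventually_ge_atTop T))
  have hdiff : ∀ t, T₁ ≤ t → κ * (w t ^ 2 - ε ^ 2 / 4) ≤ 2 * w t * w' t := by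
    intro t ht
    have h1 := (hT₁ t ht).1
    have h2 : -(κ * w t ^ 2 + κ * (ε ^ 2 / 4)) ≤ 2 * w t * (w' t - κ * w t) := by
      have h3 : -(2 * |w t| * (κ * ε / 2)) ≤ 2 * w t * (w' t - κ * w t) := by
        refine neg_le_of_neg_le ?_
        calc _ ≤ |2 * w t * (w' t - κ * w t)| := neg_le_abs _
          _ = 2 * |w t| * |w' t - κ * w t| := by rw [abs_mul, abs_mul, abs_two]
          _ ≤ _ := by gcongr
      have h4 : 0 ≤ κ * (|w t| - ε / 2) ^ 2 := by positivity
      have h5 := sq_abs (w t)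
      nlinarith
    nlinarith
  have mono := monotoneOn_of_hasDerivAt_nonneg (a := T₁)
    (f := fun t => (w t ^ 2 - ε ^ 2 / 4) * Real.exp (-κ * t))
    (fun t ht => (((hd t (hT₁ t ht).2).pow 2).sub_const (ε ^ 2 / 4)).mul
      (((hasDerivAt_id t).const_mul (-κ)).exp)) (fun t ht => by
      have h1 := hdiff t ht
      have he := Real.exp_pos (-κ * t)
      simp only [id, Pi.pow_apply]
      push_cast
      nlinarith)
  refine ⟨T₁, fun t ht => ?_⟩
  rw [Real.dist_eq, sub_zero]
  by_contra! hc
  have hm : 0 < w t ^ 2 - ε ^ 2 / 4 := by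
    have := pow_le_pow_left₀ hε.le hc 2
    rw [sq_abs] at this
    nlinarith [sq_pos_of_pos hε]
  have hge : ∀ s, t ≤ s → w t ^ 2 - ε ^ 2 / 4 ≤ w s ^ 2 - ε ^ 2 / 4 := by
    intro s hs
    have h1 := mono (mem_Ici.mpr ht.le) (mem_Ici.mpr (ht.le.trans hs)) hs
    simp only at h1
    have he : Real.exp (-κ * s) ≤ Real.exp (-κ * t) := Real.exp_le_exp.mpr (by nlinarith)
    have he0 := Real.exp_pos (-κ * s)
    have h2 : (w t ^ 2 - ε ^ 2 / 4) * Real.exp (-κ * s) ≤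
        (w s ^ 2 - ε ^ 2 / 4) * Real.exp (-κ * s) :=
      (mul_le_mul_of_nonneg_left he hm.le).trans h1
    exact le_of_mul_le_mul_right h2 he0
  refine not_bddAbove_of_le_hasDerivAt (f := fun s => w s ^ 2) (f' := fun s => 2 * w s * w' s)
    (a := t) (M := 1) (mul_pos hκ hm) (fun s hs => ?_) (fun s hs => ?_)
    (fun s hs => hb s (((hT₁ t ht.le).2).trans hs))
  · have := (hd s (((hT₁ t ht.le).2).trans hs)).pow 2
    push_cast at this
    simpa using! this
  · exact (mul_le_mul_of_nonneg_left (hge s hs) hκ.le).trans (hdiff s (ht.le.trans hs))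

lemma hasDerivAt_ratio {x y : ℝ → ℝ} {x' y' t : ℝ} (hx : HasDerivAt x x' t)
    (hy : HasDerivAt y y' t) (hne : x t ≠ 0) :
    HasDerivAt (fun t => y t / x t) ((y' * x t - y t * x') / x t ^ 2) t := hy.div hx hne

/-- The ratio `y / x` evolves at the difference of the two rates, and in the cone `|y| ≤ |x|` the
relative error is at most doubled. -/
lemma abs_ratio_sub_le {x y x' y' α β η : ℝ} (hne : x ≠ 0) (hxy : |y| ≤ |x|)
    (hf : |x' - α * x| ≤ η * |x|) (hg : |y' - β * y| ≤ η * |x|) :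
    |(y' * x - y * x') / x ^ 2 - (β - α) * (y / x)| ≤ 2 * η := by
  have hx0 : 0 < |x| := abs_pos.mpr hne
  have e : (y' * x - y * x') / x ^ 2 - (β - α) * (y / x) =
      ((y' - β * y) * x - y * (x' - α * x)) / x ^ 2 := by
    field_simp
    ring
  rw [e, abs_div, abs_of_pos (show 0 < x ^ 2 by positivity), div_le_iff₀ (by positivity),
    ← sq_abs x]
  calc _ ≤ |(y' - β * y) * x| + |y * (x' - α * x)| := abs_sub _ _
    _ ≤ η * |x| * |x| + |x| * (η * |x|) := by
      rw [abs_mul, abs_mul]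
      gcongr
    _ = _ := by ring

lemma exists_sign_of_ne_zero {x : ℝ → ℝ} {T : ℝ} (hcont : ContinuousOn x (Ici T))
    (h0 : ∀ t, T ≤ t → x t ≠ 0) :
    ∃ τ : ℝ, (τ = 1 ∨ τ = -1) ∧ ∀ t, T ≤ t → 0 < τ * x t := by
  rcases lt_or_gt_of_ne (h0 _ le_rfl) with h | h
  · refine ⟨-1, Or.inr rfl, fun t ht => ?_⟩
    by_contra! hc
    obtain ⟨s, hs, hs0⟩ := intermediate_value_Icc ht (hcont.mono Icc_subset_Ici_self)
      (show (0 : ℝ) ∈ Icc _ _ from ⟨h.le, by linarith⟩)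
    exact h0 s hs.1 hs0
  · refine ⟨1, Or.inl rfl, fun t ht => ?_⟩
    by_contra! hc
    obtain ⟨s, hs, hs0⟩ := intermediate_value_Icc' ht (hcont.mono Icc_subset_Ici_self)
      (show (0 : ℝ) ∈ Icc _ _ from ⟨by linarith, h.le⟩)
    exact h0 s hs.1 hs0

/-- The limiting direction of a planar trajectory whose linear part is diagonal with distinct
negative eigenvalues. -/
lemma exists_direction_of_distinct {x y x' y' : ℝ → ℝ} {a d : ℝ} (had : a < d)
    (hx : ∀ t, 0 ≤ t → HasDerivAt x (x' t) t) (hy : ∀ t, 0 ≤ t → HasDerivAt y (y' t) t)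
    (hne : ∀ t, 0 ≤ t → ¬ (x t = 0 ∧ y t = 0))
    (happ : ∀ η > 0, ∀ᶠ t in atTop, |x' t - -a * x t| ≤ η * max |x t| |y t| ∧
      |y' t - -d * y t| ≤ η * max |x t| |y t|) :
    ∃ (k : ℝ → ℝ) (v : ℝ × ℝ), v ≠ 0 ∧ (∀ᶠ t in atTop, 0 < k t) ∧
      Tendsto (fun t => k t • ((x t, y t) : ℝ × ℝ)) atTop (𝓝 v) := by
  have hκ : 0 < d - a := by linarith
  obtain ⟨T₀, hT₀⟩ := eventually_atTop.mp ((happ ((d - a) / 8) (by linarith)).and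
    (eventually_ge_atTop 0))
  have hT₀0 : 0 ≤ T₀ := (hT₀ T₀ le_rfl).2
  -- As `a < d`, the first coordinate decays more slowly and the cone `|y| ≤ |x|` is eventually
  -- forward invariant. An orbit that enters it becomes tangent to the slow direction. One that
  -- never does has a bounded ratio `x / y` with expanding dynamics, which must tend to zero.
  by_cases hA : ∃ t₁, T₀ ≤ t₁ ∧ y t₁ ^ 2 ≤ x t₁ ^ 2
  · obtain ⟨t₁, ht₁, hq⟩ := hA
    have hQ : ∀ t, t₁ < t → y t ^ 2 < x t ^ 2 := by
      intro t ht
      have := pos_of_hasDerivAt_pos_at_zeros (f := fun t => x t ^ 2 - y t ^ 2)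
        (f' := fun t => 2 * (x t * x' t - y t * y' t)) (a := t₁) (fun s hs => ?_) (by linarith)
        (fun s hs h0 => ?_) ht
      · linarith
      · have := ((hx s (by linarith)).pow 2).sub ((hy s (by linarith)).pow 2)
        convert! this using 1
        push_cast
        ring
      · have hab : |x s| = |y s| := by rw [← sq_eq_sq_iff_abs_eq_abs]; linarith
        obtain ⟨h1, h2⟩ := (hT₀ s (by linarith)).1
        have hneg : |-(y' s - -d * y s)| ≤ (d - a) / 8 * max |x s| |y s| := by rwa [abs_neg]
        have h3 := (abs_le.mp (abs_mul_add_mul_le_of_max h1 hneg)).1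
        have hx0 : x s ≠ 0 := fun h0 => by
          rw [h0, abs_zero] at hab
          exact hne s (by linarith) ⟨h0, abs_eq_zero.mp hab.symm⟩
        have hx2 : 0 < x s ^ 2 := by positivity
        have hy2 : y s ^ 2 = x s ^ 2 := by linarith
        have hpos := mul_pos hκ hx2
        have hdy : d * y s ^ 2 = d * x s ^ 2 := by rw [hy2]
        rw [hy2] at h3
        linarith
    have hx0 : ∀ t, t₁ + 1 ≤ t → x t ≠ 0 := fun t ht h0 => by
      have := hQ t (by linarith)
      rw [h0] at this
      nlinarith [sq_nonneg (y t)]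
    obtain ⟨τ, hτ, hpos⟩ := exists_sign_of_ne_zero (fun t ht =>
      (hx t (by linarith [mem_Ici.mp ht])).continuousAt.continuousWithinAt) hx0
    have hw := tendsto_zero_of_hasDerivAt_contracting (w := fun t => y t / x t) (T := t₁ + 1) hκ
      (fun t ht => hasDerivAt_ratio (hx t (by linarith)) (hy t (by linarith)) (hx0 t ht))
      (fun ε hε => by
        filter_upwards [happ (ε / 2) (by linarith), eventually_ge_atTop (t₁ + 1)] with t h1 ht
        have hle : |y t| ≤ |x t| := sq_le_sq.mp (hQ t (by linarith)).le
        rw [max_eq_left hle] at h1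
        have := abs_ratio_sub_le (hx0 t ht) hle h1.1 h1.2
        convert! this using 1
        · congr 1; ring
        · ring)
    -- `τ` is the constant sign of `x`, which makes the scaling factor positive.
    refine ⟨fun t => (τ * x t)⁻¹, (τ, 0), fun h0 => ?_, ?_, ?_⟩
    · have : τ = 0 := congrArg Prod.fst h0
      rcases hτ with rfl | rfl <;> norm_num at this
    · filter_upwards [eventually_ge_atTop (t₁ + 1)] with t ht
      exact inv_pos.mpr (hpos t ht)
    · have h1 : Tendsto (fun t => ((τ, τ * (y t / x t)) : ℝ × ℝ)) atTop (𝓝 (τ, τ * 0)) :=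
        tendsto_const_nhds.prodMk_nhds (hw.const_mul τ)
      rw [mul_zero] at h1
      refine h1.congr' ?_
      filter_upwards [eventually_ge_atTop (t₁ + 1)] with t ht
      have := hx0 t ht
      rcases hτ with rfl | rfl
      · ext
        · simp [this]
        · simp only [Prod.smul_mk, smul_eq_mul]; field_simp
      · ext
        · simp only [Prod.smul_mk, smul_eq_mul]; field_simp
        · simp only [Prod.smul_mk, smul_eq_mul]; field_simp
  · push Not at hA
    have hy0 : ∀ t, T₀ ≤ t → y t ≠ 0 := fun t ht h0 => by
      have := hA t ht
      rw [h0] at this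
      nlinarith [sq_nonneg (x t)]
    obtain ⟨τ, hτ, hpos⟩ := exists_sign_of_ne_zero (fun t ht =>
      (hy t (by linarith [mem_Ici.mp ht])).continuousAt.continuousWithinAt) hy0
    have hw := tendsto_zero_of_hasDerivAt_expanding (w := fun t => x t / y t) (T := T₀) hκ
      (fun t ht => hasDerivAt_ratio (hy t (by linarith)) (hx t (by linarith)) (hy0 t ht))
      (fun t ht => by
        have := hy0 t ht
        rw [div_pow, div_le_one (by positivity)]
        exact (hA t ht).le)
      (fun ε hε => by
        filter_upwards [happ (ε / 2) (by linarith), eventually_ge_atTop T₀] with t h1 ht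
        have hle : |x t| ≤ |y t| := sq_le_sq.mp (hA t ht).le
        rw [max_eq_right hle] at h1
        have := abs_ratio_sub_le (hy0 t ht) hle h1.2 h1.1
        convert! this using 1
        · congr 1; ring
        · ring)
    refine ⟨fun t => (τ * y t)⁻¹, (0, τ), fun h0 => ?_, ?_, ?_⟩
    · have : τ = 0 := congrArg Prod.snd h0
      rcases hτ with rfl | rfl <;> norm_num at this
    · filter_upwards [eventually_ge_atTop T₀] with t ht
      exact inv_pos.mpr (hpos t ht)
    · have h1 : Tendsto (fun t => ((τ * (x t / y t), τ) : ℝ × ℝ)) atTop (𝓝 (τ * 0, τ)) :=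
        (hw.const_mul τ).prodMk_nhds tendsto_const_nhds
      rw [mul_zero] at h1
      refine h1.congr' ?_
      filter_upwards [eventually_ge_atTop T₀] with t ht
      have := hy0 t ht
      rcases hτ with rfl | rfl
      · ext
        · simp only [Prod.smul_mk, smul_eq_mul]; field_simp
        · simp [this]
      · ext
        · simp only [Prod.smul_mk, smul_eq_mul]; field_simp
        · simp only [Prod.smul_mk, smul_eq_mul]; field_simp

/-- A critical point with two distinct negative eigenvalues is a stable node. -/
theorem isStableNode_of_distinct {F : ℝ × ℝ → ℝ × ℝ} {p : ℝ × ℝ} {A : ℝ × ℝ →L[ℝ] ℝ × ℝ}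
    (hF : HasStrictFDerivAt F A p) (h0 : F p = 0) {u w : ℝ × ℝ}
    (hdet : u.1 * w.2 - u.2 * w.1 ≠ 0) {a d : ℝ} (hu : A u = (-a) • u) (hw : A w = (-d) • w)
    (ha : 0 < a) (had : a < d) : IsStableNode F p := by
  have hG := hasStrictFDerivAt_conjField hF hdet (a := -a) (b := 0) (c := 0) (d := -d)
    (by rw [hu]; module) (by rw [hw]; module)
  have hG0 : conjField F p (basisEquiv u w hdet) 0 = 0 := conjField_zero_eq_zero_iff.mpr h0
  obtain ⟨r, hS⟩ := exists_isSink (s := a / 2) (s' := a) hG0 hG (by linarith) (by linarith)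
    (fun x y => by nlinarith [sq_nonneg y])
  refine IsStableNode.of_conjField (L := basisEquiv u w hdet)
    (hS.isStableNode fun φ q hφ hq hne => ?_)
  refine exists_direction_of_distinct had
    (fun t ht => hφ.deriv_fst_of_mem (hS.mem hφ hq ht))
    (fun t ht => hφ.deriv_snd_of_mem (hS.mem hφ hq ht))
    (fun t _ h => hS.flow_ne_zero hφ hne t (Prod.ext h.1 h.2)) fun η hη => ?_
  obtain ⟨ρ, hρ, -, h⟩ := exists_square_approx_zero hG0 hG hη
  filter_upwards [(hS.tendsto hφ hq).eventually (Metric.closedBall_mem_nhds 0 hρ)] with t ht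
  simpa using h _ ht

/-! ### Limiting directions: a double eigenvalue -/

/-- Adding and subtracting the primitive of the integrable bound gives two monotone functions, which
control the oscillation of `f` on `[s, ∞)`. -/
lemma exists_limit_of_exp_decay {f f' : ℝ → ℝ} {C η : ℝ} (hη : 0 < η)
    (hd : ∀ t, 0 ≤ t → HasDerivAt f (f' t) t) (hb : ∀ t, 0 ≤ t → |f' t| ≤ C * Real.exp (-η * t)) :
    ∃ ℓ, Tendsto f atTop (𝓝 ℓ) ∧ ∀ t, 0 ≤ t → |f t - ℓ| ≤ C / η * Real.exp (-η * t) := by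
  have hC : 0 ≤ C := by simpa using (abs_nonneg _).trans (hb 0 le_rfl)
  have hE : ∀ t, HasDerivAt (fun t => C / η * Real.exp (-η * t)) (-(C * Real.exp (-η * t))) t := by
    intro t
    convert! (((hasDerivAt_id t).const_mul (-η)).exp).const_mul (C / η) using 1
    simp only [id]
    field_simp
  have hE0 : Tendsto (fun t => C / η * Real.exp (-η * t)) atTop (𝓝 0) := by
    have h1 : Tendsto (fun t => -η * t) atTop atBot := tendsto_id.const_mul_atTop_of_neg (by linarith)
    simpa using (Real.tendsto_exp_atBot.comp h1).const_mul (C / η)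
  have hpos : ∀ t, 0 ≤ C / η * Real.exp (-η * t) := fun t =>
    mul_nonneg (div_nonneg hC hη.le) (Real.exp_pos _).le
  have anti := antitoneOn_of_hasDerivAt_nonpos (a := 0)
    (fun t ht => (hd t ht).add (hE t)) (fun t ht => by linarith [(abs_le.mp (hb t ht)).2])
  have mono := monotoneOn_of_hasDerivAt_nonneg (a := 0)
    (fun t ht => (hd t ht).sub (hE t)) (fun t ht => by linarith [(abs_le.mp (hb t ht)).1])
  have key : ∀ s t, 0 ≤ s → s ≤ t → |f t - f s| ≤ C / η * Real.exp (-η * s) := by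
    intro s t hs hst
    have h1 := anti (mem_Ici.mpr hs) (mem_Ici.mpr (hs.trans hst)) hst
    have h2 := mono (mem_Ici.mpr hs) (mem_Ici.mpr (hs.trans hst)) hst
    simp only [Pi.add_apply, Pi.sub_apply] at h1 h2
    have := hpos t
    rw [abs_le]
    constructor <;> linarith
  have hcau : CauchySeq f := by
    rw [Metric.cauchySeq_iff']
    intro ε hε
    obtain ⟨N, hN⟩ := ((hE0.eventually_lt_const hε).and (eventually_ge_atTop 0)).exists
    refine ⟨N, fun t ht => ?_⟩
    rw [Real.dist_eq]
    exact (key N t hN.2 ht).trans_lt hN.1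
  obtain ⟨ℓ, hℓ⟩ := cauchySeq_tendsto_of_complete hcau
  refine ⟨ℓ, hℓ, fun t ht => ?_⟩
  rw [abs_sub_comm]
  refine le_of_tendsto ((hℓ.sub_const (f t)).abs) ?_
  filter_upwards [eventually_ge_atTop t] with s hs
  exact key t s ht hs

lemma hasDerivAt_exp_mul {f : ℝ → ℝ} {f' a t : ℝ} (hf : HasDerivAt f f' t) :
    HasDerivAt (fun t => Real.exp (a * t) * f t) (Real.exp (a * t) * (f' + a * f t)) t := by
  convert! (((hasDerivAt_id t).const_mul a).exp).mul hf using 1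
  simp only [id]
  ring

/-- The limiting direction of a planar trajectory whose linear part is a multiple of the identity
or a Jordan block, with a quadratic remainder. -/
lemma exists_direction_of_double {x y x' y' : ℝ → ℝ} {a ε C M : ℝ} (ha : 0 < a)
    (hx : ∀ t, 0 ≤ t → HasDerivAt x (x' t) t) (hy : ∀ t, 0 ≤ t → HasDerivAt y (y' t) t)
    (hne : ∀ t, 0 ≤ t → ¬ (x t = 0 ∧ y t = 0)) (hC : 0 ≤ C)
    (hrx : ∀ t, 0 ≤ t → |x' t - (-a * x t + ε * y t)| ≤ C * (x t ^ 2 + y t ^ 2))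
    (hry : ∀ t, 0 ≤ t → |y' t - -a * y t| ≤ C * (x t ^ 2 + y t ^ 2))
    (hdec : ∀ t, 0 ≤ t → x t ^ 2 + y t ^ 2 ≤ M * Real.exp (-(2 * (4 / 5 * a) * t)))
    (hlow : ∀ᶠ t in atTop, -(6 / 5 * a) * (x t ^ 2 + y t ^ 2) ≤ x t * x' t + y t * y' t) :
    ∃ (k : ℝ → ℝ) (v : ℝ × ℝ), v ≠ 0 ∧ (∀ᶠ t in atTop, 0 < k t) ∧
      Tendsto (fun t => k t • ((x t, y t) : ℝ × ℝ)) atTop (𝓝 v) := by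
  -- The quadratic remainder decays like `exp (-(8/5) a t)`; after multiplication by `exp (a t)` the
  -- rate `3/5 * a` remains.
  set η := 3 / 5 * a with hη
  have hη0 : 0 < η := by positivity
  have hsmall : ∀ t, 0 ≤ t →
      Real.exp (a * t) * (C * (x t ^ 2 + y t ^ 2)) ≤ C * M * Real.exp (-η * t) := by
    intro t ht
    have h1 : Real.exp (-η * t) = Real.exp (a * t) * Real.exp (-(2 * (4 / 5 * a) * t)) := by
      rw [← Real.exp_add]; congr 1; rw [hη]; ring
    rw [h1]
    have := mul_le_mul_of_nonneg_left (hdec t ht) (mul_nonneg (Real.exp_pos (a * t)).le hC)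
    linarith
  obtain ⟨ℓy, hℓy, hby⟩ := exists_limit_of_exp_decay (C := C * M) hη0
    (fun t ht => hasDerivAt_exp_mul (a := a) (hy t ht)) (fun t ht => by
      refine le_trans ?_ (hsmall t ht)
      rw [abs_mul, abs_of_pos (Real.exp_pos _)]
      refine mul_le_mul_of_nonneg_left ?_ (Real.exp_pos _).le
      convert! hry t ht using 2
      ring)
  -- Subtracting `ε * ℓy * t` removes the secular term of the Jordan block.
  obtain ⟨ℓx, hℓx, hbx⟩ := exists_limit_of_exp_decay
    (f := fun t => Real.exp (a * t) * x t - ε * ℓy * t)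
    (f' := fun t => Real.exp (a * t) * (x' t + a * x t) - ε * ℓy)
    (C := C * M + |ε| * (C * M / η)) hη0
    (fun t ht => by
      simpa using! (hasDerivAt_exp_mul (a := a) (hx t ht)).sub
        ((hasDerivAt_id t).const_mul (ε * ℓy))) (fun t ht => by
      have e : Real.exp (a * t) * (x' t + a * x t) - ε * ℓy =
          Real.exp (a * t) * (x' t - (-a * x t + ε * y t)) +
            ε * (Real.exp (a * t) * y t - ℓy) := by ring
      rw [e]
      refine (abs_add_le _ _).trans ?_
      rw [abs_mul, abs_mul, abs_of_pos (Real.exp_pos _)]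
      have h1 := mul_le_mul_of_nonneg_left (hrx t ht) (Real.exp_pos (a * t)).le
      have h2 := mul_le_mul_of_nonneg_left (hby t ht) (abs_nonneg ε)
      have h3 := hsmall t ht
      nlinarith)
  -- If the secular coefficient is nonzero it dominates and the direction is that of the
  -- eigenvector; otherwise the rescaled orbit itself converges.
  by_cases hJ : ε * ℓy = 0
  · simp only [hJ, zero_mul, sub_zero] at hℓx hbx
    by_cases hz : ℓx = 0 ∧ ℓy = 0
    -- If both limits vanished, the squared norm would decay like `exp (-(16/5) a t)`, but by `hlow`
    -- it decays no faster than `exp (-(12/5) a t)`.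
    · exfalso
      obtain ⟨h1, h2⟩ := hz
      simp only [h1, h2, sub_zero] at hbx hby
      obtain ⟨T, hT⟩ := eventually_atTop.mp (hlow.and (eventually_ge_atTop 0))
      have hT0 : 0 ≤ T := (hT T le_rfl).2
      have mono := monotoneOn_of_hasDerivAt_nonneg (a := T)
        (f := fun t => Real.exp (12 / 5 * a * t) * (x t ^ 2 + y t ^ 2))
        (fun t ht => hasDerivAt_exp_mul (((hx t (hT0.trans ht)).pow 2).add
          ((hy t (hT0.trans ht)).pow 2))) (fun t ht => by
          refine mul_nonneg (Real.exp_pos _).le ?_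
          have := (hT t ht).1
          push_cast
          nlinarith)
      set B := C * M / η with hB
      set B' := (C * M + |ε| * (C * M / η)) / η with hB'
      have hupper : ∀ t, 0 ≤ t → Real.exp (12 / 5 * a * t) * (x t ^ 2 + y t ^ 2) ≤
          (B ^ 2 + B' ^ 2) * Real.exp (-(4 / 5 * a) * t) := by
        intro t ht
        have g1 := sq_le_sq' (abs_le.mp (hbx t ht)).1 (abs_le.mp (hbx t ht)).2
        have g2 := sq_le_sq' (abs_le.mp (hby t ht)).1 (abs_le.mp (hby t ht)).2
        have e1 : Real.exp (12 / 5 * a * t) = Real.exp (a * t) ^ 2 * Real.exp (2 / 5 * a * t) := by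
          rw [← Real.exp_nat_mul, ← Real.exp_add]; congr 1; push_cast; ring
        have e2 : Real.exp (-(4 / 5 * a) * t) = Real.exp (-η * t) ^ 2 * Real.exp (2 / 5 * a * t) := by
          rw [← Real.exp_nat_mul, ← Real.exp_add]; congr 1; rw [hη]; push_cast; ring
        rw [e1, e2]
        have := mul_le_mul_of_nonneg_right (add_le_add g1 g2) (Real.exp_pos (2 / 5 * a * t)).le
        nlinarith
      have hlim : Tendsto (fun t => (B ^ 2 + B' ^ 2) * Real.exp (-(4 / 5 * a) * t)) atTop (𝓝 0) := by
        have h1 : Tendsto (fun t => -(4 / 5 * a) * t) atTop atBot :=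
          tendsto_id.const_mul_atTop_of_neg (by linarith)
        simpa using (Real.tendsto_exp_atBot.comp h1).const_mul (B ^ 2 + B' ^ 2)
      have hpos : 0 < Real.exp (12 / 5 * a * T) * (x T ^ 2 + y T ^ 2) := by
        refine mul_pos (Real.exp_pos _) ?_
        have := hne T hT0
        by_contra! hc
        refine this ⟨?_, ?_⟩ <;> refine pow_eq_zero_iff two_ne_zero |>.mp ?_ <;>
          nlinarith [sq_nonneg (x T), sq_nonneg (y T)]
      obtain ⟨t, ht, htT⟩ := ((hlim.eventually_lt_const hpos).and (eventually_ge_atTop T)).exists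
      have := mono (mem_Ici.mpr le_rfl) htT htT
      simp only at this
      linarith [hupper t (hT0.trans htT)]
    · refine ⟨fun t => Real.exp (a * t), (ℓx, ℓy), fun h => hz ?_,
        .of_forall fun t => Real.exp_pos _, ?_⟩
      · exact ⟨congrArg Prod.fst h, congrArg Prod.snd h⟩
      · simpa using hℓx.prodMk_nhds hℓy
  · refine ⟨fun t => Real.exp (a * t) * t⁻¹, (ε * ℓy, 0), fun h => hJ (congrArg Prod.fst h), ?_, ?_⟩
    · filter_upwards [eventually_gt_atTop 0] with t ht
      positivity
    · have h1 := ((hℓx.mul tendsto_inv_atTop_zero).add_const (ε * ℓy)).prodMk_nhds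
        (hℓy.mul tendsto_inv_atTop_zero)
      simp only [mul_zero, zero_add] at h1
      refine h1.congr' ?_
      filter_upwards [eventually_gt_atTop 0] with t ht
      ext
      · simp only [Prod.smul_mk, smul_eq_mul]; field_simp; ring
      · simp only [Prod.smul_mk, smul_eq_mul]; field_simp

/-- The derivative is locally Lipschitz, hence within `K * ‖z‖` of `A` on the ball of radius `‖z‖`.
The mean value inequality supplies the second factor `‖z‖`. -/
lemma exists_quadratic_remainder {G : ℝ × ℝ → ℝ × ℝ} {A : ℝ × ℝ →L[ℝ] ℝ × ℝ} (hG : ContDiff ℝ 2 G)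
    (hA : HasStrictFDerivAt G A 0) (h0 : G 0 = 0) :
    ∃ ρ > 0, ∃ C, 0 ≤ C ∧ ∀ z ∈ Metric.closedBall (0 : ℝ × ℝ) ρ, ‖G z - A z‖ ≤ C * ‖z‖ ^ 2 := by
  have hA' : fderiv ℝ G 0 = A := hA.hasFDerivAt.fderiv
  have h1 : ContDiff ℝ 1 (fderiv ℝ G) := hG.fderiv_right (by norm_num)
  obtain ⟨K, t, ht, hK⟩ := (h1.contDiffAt (x := 0)).exists_lipschitzOnWith
  obtain ⟨ρ, hρ, hb⟩ := Metric.nhds_basis_closedBall.mem_iff.mp ht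
  refine ⟨ρ, hρ, K, K.2, fun z hz => ?_⟩
  rw [mem_closedBall_zero_iff] at hz
  have h2 := (convex_closedBall (0 : ℝ × ℝ) ‖z‖).norm_image_sub_le_of_norm_fderiv_le' (𝕜 := ℝ)
    (f := G) (φ := A) (C := K * ‖z‖) (x := 0) (y := z)
    (fun w _ => (hG.differentiable (by norm_num)).differentiableAt) (fun w hw => ?_)
    (Metric.mem_closedBall_self (norm_nonneg z)) (mem_closedBall_zero_iff.mpr le_rfl)
  · rw [h0, sub_zero, sub_zero] at h2
    rw [sq, ← mul_assoc]
    exact h2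
  · rw [mem_closedBall_zero_iff] at hw
    have := hK.dist_le_mul w (hb (mem_closedBall_zero_iff.mpr (hw.trans hz))) 0
      (hb (Metric.mem_closedBall_self hρ.le))
    rw [dist_eq_norm, dist_zero_right, hA'] at this
    exact this.trans (mul_le_mul_of_nonneg_left hw K.2)

lemma contDiff_conjField {F : ℝ × ℝ → ℝ × ℝ} {p : ℝ × ℝ} {L : (ℝ × ℝ) ≃L[ℝ] (ℝ × ℝ)}
    {n : WithTop ℕ∞}
    (hF : ContDiff ℝ n F) : ContDiff ℝ n (conjField F p L) :=
  L.symm.contDiff.comp (hF.comp (contDiff_const.add L.contDiff))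

/-- A critical point with a double negative eigenvalue is a stable node. -/
theorem isStableNode_of_double {F : ℝ × ℝ → ℝ × ℝ} {p : ℝ × ℝ} {A : ℝ × ℝ →L[ℝ] ℝ × ℝ}
    (hF2 : ContDiff ℝ 2 F) (hF : HasStrictFDerivAt F A p) (h0 : F p = 0) {u w : ℝ × ℝ}
    (hdet : u.1 * w.2 - u.2 * w.1 ≠ 0) {a ε : ℝ} (hu : A u = (-a) • u)
    (hw : A w = ε • u + (-a) • w) (ha : 0 < a) (hε : |ε| ≤ a / 10) : IsStableNode F p := by
  have hG := hasStrictFDerivAt_conjField hF hdet (a := -a) (b := ε) (c := 0) (d := -a)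
    (by rw [hu]; module) hw
  have hG0 : conjField F p (basisEquiv u w hdet) 0 = 0 := conjField_zero_eq_zero_iff.mpr h0
  have hquad : ∀ x y : ℝ, |ε * (x * y)| ≤ a / 20 * (x ^ 2 + y ^ 2) := by
    intro x y
    rw [abs_mul, abs_mul]
    have h1 : 0 ≤ (|x| - |y|) ^ 2 := sq_nonneg _
    have h2 := sq_abs x
    have h3 := sq_abs y
    have h4 := mul_le_mul_of_nonneg_right hε (mul_nonneg (abs_nonneg x) (abs_nonneg y))
    nlinarith
  -- By `hquad` the Jordan term costs `a / 20`, leaving the linear rate `19/20 * a`. Lowering it to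
  -- `4/5 * a` makes room for the remainder.
  obtain ⟨r₀, hS₀⟩ := exists_isSink (s := 4 / 5 * a) (s' := 19 / 20 * a) hG0 hG (by linarith)
    (by linarith) (fun x y => by have := (abs_le.mp (hquad x y)).2; nlinarith)
  obtain ⟨ρ, hρ, C, hC, hrem⟩ := exists_quadratic_remainder (contDiff_conjField hF2) hG hG0
  have hS : IsSink (conjField F p (basisEquiv u w hdet)) (min r₀ ρ) (4 / 5 * a) := by
    have hsub := Metric.closedBall_subset_closedBall (x := (0 : ℝ × ℝ)) (min_le_left r₀ ρ)
    obtain ⟨K, hK⟩ := hS₀.lip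
    exact ⟨lt_min hS₀.r_pos hρ, hS₀.s_pos, hG0, ⟨K, hK.mono hsub⟩, fun z hz => hS₀.decay z (hsub hz)⟩
  refine IsStableNode.of_conjField (L := basisEquiv u w hdet)
    (hS.isStableNode fun φ q hφ hq hne => ?_)
  set G := conjField F p (basisEquiv u w hdet)
  have hbound : ∀ z ∈ Metric.closedBall (0 : ℝ × ℝ) (min r₀ ρ),
      |(G z).1 - (-a * z.1 + ε * z.2)| ≤ C * (z.1 ^ 2 + z.2 ^ 2) ∧
      |(G z).2 - -a * z.2| ≤ C * (z.1 ^ 2 + z.2 ^ 2) := by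
    intro z hz
    have h1 := hrem z (Metric.closedBall_subset_closedBall (min_le_right _ _) hz)
    have h2 : ‖z‖ ^ 2 ≤ z.1 ^ 2 + z.2 ^ 2 := by
      rw [Prod.norm_def, Real.norm_eq_abs, Real.norm_eq_abs]
      rcases max_choice |z.1| |z.2| with h | h <;> rw [h, sq_abs]
      · linarith [sq_nonneg z.2]
      · linarith [sq_nonneg z.1]
    have h3 := h1.trans (mul_le_mul_of_nonneg_left h2 hC)
    rw [Prod.norm_def, max_le_iff] at h3
    simpa using h3
  refine exists_direction_of_double ha
    (fun t ht => hφ.deriv_fst_of_mem (hS.mem hφ hq ht))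
    (fun t ht => hφ.deriv_snd_of_mem (hS.mem hφ hq ht))
    (fun t _ h => hS.flow_ne_zero hφ hne t (Prod.ext h.1 h.2)) hC
    (fun t ht => (hbound _ (hS.mem hφ hq ht)).1) (fun t ht => (hbound _ (hS.mem hφ hq ht)).2)
    (fun t ht => hS.normSq_le hφ hq ht) ?_
  -- The error `a / 20` contributes `a / 10` to the quadratic form. With `a / 20` from `hquad` the
  -- decay rate is at most `23/20 * a`, within the allowed `6/5 * a`.
  obtain ⟨ρ', hρ', -, h⟩ := exists_square_approx_zero hG0 hG (ε := a / 20) (by positivity)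
  filter_upwards [(hS.tendsto hφ hq).eventually (Metric.closedBall_mem_nhds 0 hρ')] with t ht
  obtain ⟨h1, h2⟩ := h _ ht
  have h3 := (abs_le.mp (abs_mul_add_mul_le_of_max h1 h2)).1
  have h4 := (abs_le.mp (hquad (φ q t).1 (φ q t).2)).1
  nlinarith [sq_nonneg (φ q t).1, sq_nonneg (φ q t).2]

/-! ### Spiral sinks -/

/-- A nowhere vanishing `C¹` curve in the complex plane has a `C¹` logarithm. -/
lemma exists_log_lift {γ γ' : ℝ → ℂ} (hγ : ∀ t, HasDerivAt γ (γ' t) t) (hγ' : Continuous γ')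
    (hne : ∀ t, γ t ≠ 0) :
    ∃ ℓ : ℝ → ℂ, (∀ t, HasDerivAt ℓ (γ' t / γ t) t) ∧ ∀ t, Complex.exp (ℓ t) = γ t := by
  have hc : Continuous γ := continuous_iff_continuousAt.mpr fun t => (hγ t).continuousAt
  have hq : Continuous fun t => γ' t / γ t := hγ'.div hc hne
  have hℓ : ∀ t, HasDerivAt (fun t => Complex.log (γ 0) + ∫ s in (0 : ℝ)..t, γ' s / γ s)
      (γ' t / γ t) t := fun t => (hq.integral_hasStrictDerivAt 0 t).hasDerivAt.const_add _
  refine ⟨_, hℓ, fun t => ?_⟩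
  set ℓ := fun t => Complex.log (γ 0) + ∫ s in (0 : ℝ)..t, γ' s / γ s with hℓdef
  -- The integral of `γ' / γ` is a logarithm because `γ * exp (-ℓ)` has zero derivative.
  have hk : ∀ t, HasDerivAt (fun t => γ t * Complex.exp (-ℓ t)) 0 t := by
    intro t
    convert! (hγ t).mul (hℓ t).neg.cexp using 1
    have := hne t
    field_simp
    ring
  have hconst := is_const_of_deriv_eq_zero (fun t => (hk t).differentiableAt)
    (fun t => (hk t).deriv) t 0
  have h0 : Complex.exp (ℓ 0) = γ 0 := by simp [hℓdef, Complex.exp_log (hne 0)]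
  have e0 : γ 0 * Complex.exp (-ℓ 0) = 1 := by
    rw [← h0, ← Complex.exp_add, add_neg_cancel, Complex.exp_zero]
  rw [e0, Complex.exp_neg, ← div_eq_mul_inv, div_eq_one_iff_eq (Complex.exp_ne_zero _)] at hconst
  exact hconst.symm

/-- Modulus and angle are read off from a continuous complex logarithm; the angular velocity is the
imaginary part of `γ' / γ`. -/
lemma exists_polar_lift {γ γ' : ℝ → ℝ × ℝ} (hγ : ∀ t, HasDerivAt γ (γ' t) t)
    (hγ' : Continuous γ') (hne : ∀ t, γ t ≠ 0) :
    ∃ r θ : ℝ → ℝ, Continuous r ∧ (∀ t, 0 < r t) ∧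
      (∀ t, γ t = (r t * Real.cos (θ t), r t * Real.sin (θ t))) ∧
      ∀ t, HasDerivAt θ (((γ t).1 * (γ' t).2 - (γ t).2 * (γ' t).1) /
        ((γ t).1 ^ 2 + (γ t).2 ^ 2)) t := by
  obtain ⟨ℓ, hℓ, hexp⟩ := exists_log_lift
    (γ := fun t => Complex.equivRealProdCLM.symm (γ t))
    (γ' := fun t => Complex.equivRealProdCLM.symm (γ' t))
    (fun t => Complex.equivRealProdCLM.symm.hasFDerivAt.comp_hasDerivAt t (hγ t))
    (Complex.equivRealProdCLM.symm.continuous.comp hγ') (fun t => by simpa using hne t)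
  have hcont : Continuous ℓ := continuous_iff_continuousAt.mpr fun t => (hℓ t).continuousAt
  have hre : ∀ z : ℝ × ℝ, (Complex.equivRealProdCLM.symm z).re = z.1 := fun z => rfl
  have him : ∀ z : ℝ × ℝ, (Complex.equivRealProdCLM.symm z).im = z.2 := fun z => rfl
  refine ⟨fun t => Real.exp (ℓ t).re, fun t => (ℓ t).im,
    Real.continuous_exp.comp (Complex.continuous_re.comp hcont), fun t => Real.exp_pos _,
    fun t => ?_, fun t => ?_⟩
  · ext
    · rw [← hre, ← hexp, Complex.exp_re]
    · rw [← him, ← hexp, Complex.exp_im]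
  · have h1 := Complex.imCLM.hasFDerivAt.comp_hasDerivAt t (hℓ t)
    convert! h1 using 1
    rw [Complex.imCLM_apply, Complex.div_im, Complex.normSq_apply, hre, him, hre, him]
    rw [← sub_div]
    congr 1 <;> ring

/-- The squared norm times the angular velocity of a linear field is the form `c x² + (d - a) x y -
b y²`. A negative discriminant makes it definite, and determinant over absolute trace bounds the
moduli of its eigenvalues from below. -/
lemma exists_definite_bound {a b c d : ℝ} (hdisc : (a - d) ^ 2 + 4 * b * c < 0) :
    ∃ σ m : ℝ, (σ = 1 ∨ σ = -1) ∧ 0 < m ∧ ∀ x y : ℝ,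
      m * (x ^ 2 + y ^ 2) ≤ σ * (x * (c * x + d * y) - y * (a * x + b * y)) := by
  have hbc : b * c < 0 := by nlinarith [sq_nonneg (a - d)]
  set ω := -((a - d) ^ 2 / 4 + b * c) with hω
  have hω0 : 0 < ω := by rw [hω]; linarith
  rcases mul_neg_iff.mp hbc with ⟨hb, hc⟩ | ⟨hb, hc⟩
  · refine ⟨-1, ω / (b - c), Or.inr rfl, by apply div_pos <;> linarith, fun x y => ?_⟩
    rw [div_mul_eq_mul_div, div_le_iff₀ (by linarith), hω]
    nlinarith [sq_nonneg (c * x + (d - a) * y / 2), sq_nonneg ((d - a) * x / 2 - b * y)]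
  · refine ⟨1, ω / (c - b), Or.inl rfl, by apply div_pos <;> linarith, fun x y => ?_⟩
    rw [div_mul_eq_mul_div, div_le_iff₀ (by linarith), hω]
    nlinarith [sq_nonneg (c * x + (d - a) * y / 2), sq_nonneg ((d - a) * x / 2 - b * y)]

/-- A critical point with complex eigenvalues of negative real part is a spiral sink. -/
theorem isSpiralSink_of_hasStrictFDerivAt {F : ℝ × ℝ → ℝ × ℝ} {p : ℝ × ℝ} {a b c d : ℝ}
    (hF : HasStrictFDerivAt F (planarLinear a b c d) p) (h0 : F p = 0) (htr : a + d < 0)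
    (hdisc : (a - d) ^ 2 + 4 * b * c < 0) : IsSpiralSink F p := by
  have hω : 0 < -((a - d) ^ 2 / 4 + b * c) := by linarith
  set ω := √(-((a - d) ^ 2 / 4 + b * c)) with hωdef
  have hω0 : 0 < ω := Real.sqrt_pos.mpr hω
  have hω2 : ω ^ 2 = -((a - d) ^ 2 / 4 + b * c) := Real.sq_sqrt hω.le
  have hc : c ≠ 0 := fun h => by rw [h] at hdisc; nlinarith [sq_nonneg (a - d)]
  -- In the basis `u`, `w` the Jacobian is `(a + d) / 2` times the identity plus `ω` times a quarter
  -- turn, so its symmetric part is a negative multiple of the identity.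
  set u : ℝ × ℝ := (1, 0) with hu
  set w : ℝ × ℝ := ((a - d) / 2 / ω, c / ω) with hw
  have hdet : u.1 * w.2 - u.2 * w.1 ≠ 0 := by
    simp only [hu, hw, one_mul, zero_mul, sub_zero]
    positivity
  have hG := hasStrictFDerivAt_conjField hF hdet (a := (a + d) / 2) (b := -ω) (c := ω)
    (d := (a + d) / 2) (by
      ext
      · simp [hu, hw, mul_div_cancel₀ _ hω0.ne']; ring
      · simp [hu, hw, mul_div_cancel₀ _ hω0.ne']) (by
      ext
      · simp only [planarLinear_apply, hu, hw, Prod.fst_add, Prod.smul_fst, smul_eq_mul]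
        field_simp
        rw [hω2]
        ring
      · simp only [planarLinear_apply, hu, hw, Prod.snd_add, Prod.smul_snd, smul_eq_mul]
        field_simp
        ring)
  set L := basisEquiv u w hdet with hL
  have hG0 : conjField F p L 0 = 0 := conjField_zero_eq_zero_iff.mpr h0
  obtain ⟨r, hS⟩ := exists_isSink (s := -(a + d) / 4) (s' := -(a + d) / 2) hG0 hG (by linarith)
    (by linarith) (fun x y => by nlinarith)
  refine ⟨IsAsymptoticallyStable.of_conjField (L := L) hS.isAsymptoticallyStable, ?_⟩
  obtain ⟨K, hK⟩ := hS.lip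
  obtain ⟨φ, hφ⟩ := exists_isCutoffFlow hS.r_pos.le hK
  have hcont' : Tendsto (affineHomeo p L).symm (𝓝 p) (𝓝 0) := by
    have := (affineHomeo p L).symm.continuous.tendsto p
    rwa [(affineHomeo p L).symm_apply_eq.mpr affineHomeo_zero.symm] at this
  obtain ⟨δ, hδ, hb⟩ := Metric.mem_nhds_iff.mp
    (hcont' (Metric.ball_mem_nhds 0 (half_pos hS.r_pos)))
  refine ⟨δ, hδ, fun q hq hne => ?_⟩
  set q' := (affineHomeo p L).symm q with hq'
  have hqlt := IsSink.normSq_lt_of_mem_ball (hb hq)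
  have hne' : q' ≠ 0 := fun h => hne (by
    rw [hq', Homeomorph.symm_apply_eq, affineHomeo_zero] at h; exact h)
  have hlim := hS.tendsto hφ hqlt
  refine ⟨affineHomeo p L ∘ φ q', by
    simpa [hq'] using (hS.isForwardTrajectory hφ hqlt).affineHomeo, tendsto_affineHomeo hlim, ?_⟩
  -- The winding concerns the polar angle in the original coordinates, and `L` does not preserve
  -- angles. The lift is therefore taken for `L (φ q' t)` and estimated with the original Jacobian.
  have hder : ∀ t, HasDerivAt (fun t => L (φ q' t)) (L (conjField F p L (clampSq r (φ q' t)))) t :=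
    fun t => L.hasFDerivAt.comp_hasDerivAt t (hφ.deriv q' t)
  have hdercont : Continuous fun t => L (conjField F p L (clampSq r (φ q' t))) := by
    refine L.continuous.comp ?_
    exact hK.continuousOn.comp_continuous
      ((lipschitzWith_clampSq r).continuous.comp (hφ.continuous q'))
      fun t => clampSq_mem hS.r_pos.le _
  obtain ⟨ρ, θ, hρ, hρ0, hpol, hθ⟩ := exists_polar_lift hder hdercont
    (fun t => by simpa using hS.flow_ne_zero hφ hne' t)
  have hθc : Continuous θ := continuous_iff_continuousAt.mpr fun t => (hθ t).continuousAt
  refine ⟨ρ, θ, hρ.continuousOn, hθc.continuousOn, fun t _ => ⟨hρ0 t, ?_⟩, ?_⟩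
  · rw [Function.comp_apply, affineHomeo_apply, ← hpol t]
  obtain ⟨σ, m, hσ, hm, hdef⟩ := exists_definite_bound hdisc
  have hLlim : Tendsto (fun t => L (φ q' t)) atTop (𝓝 0) := by
    simpa [Function.comp_def] using (L.continuous.tendsto 0).comp hlim
  have hF' : HasStrictFDerivAt (fun z => F (p + z)) (planarLinear a b c d) 0 := by
    have h1 : HasStrictFDerivAt F (planarLinear a b c d) (p + 0) := by simpa using hF
    simpa using! h1.comp (0 : ℝ × ℝ) ((hasStrictFDerivAt_id (0 : ℝ × ℝ)).const_add p)
  -- The error `m / 4` is doubled in the quadratic form, so half of the angular rate `m` survives.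
  obtain ⟨ρ', hρ', -, happ⟩ := exists_square_approx_zero (by simpa using h0) hF'
    (ε := m / 4) (by positivity)
  have hrate : ∀ᶠ t in atTop, m / 2 ≤ σ * (((L (φ q' t)).1 *
      (L (conjField F p L (clampSq r (φ q' t)))).2 -
      (L (φ q' t)).2 * (L (conjField F p L (clampSq r (φ q' t)))).1) /
        ((L (φ q' t)).1 ^ 2 + (L (φ q' t)).2 ^ 2)) := by
    filter_upwards [hLlim.eventually (Metric.closedBall_mem_nhds 0 hρ'), eventually_ge_atTop 0]
      with t ht ht0
    rw [clampSq_of_mem (hS.mem hφ hqlt ht0)]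
    have hLG : L (conjField F p L (φ q' t)) = F (p + L (φ q' t)) := by simp [conjField]
    rw [hLG]
    have hz : L (φ q' t) ≠ 0 := by simpa using hS.flow_ne_zero hφ hne' t
    set z := L (φ q' t)
    have hpos : 0 < z.1 ^ 2 + z.2 ^ 2 := by
      by_contra! hc
      refine hz (Prod.ext ?_ ?_) <;> refine pow_eq_zero_iff two_ne_zero |>.mp ?_ <;>
        nlinarith [sq_nonneg z.1, sq_nonneg z.2]
    obtain ⟨h1, h2⟩ := happ z ht
    have h1' : |-((F (p + z)).1 - (a * z.1 + b * z.2))| ≤ m / 4 * max |z.2| |z.1| := by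
      rwa [abs_neg, max_comm]
    rw [max_comm] at h2
    have h3 := abs_le.mp (abs_mul_add_mul_le_of_max h1' h2)
    have h4 := hdef z.1 z.2
    rw [← mul_div_assoc, le_div_iff₀ hpos]
    rcases hσ with rfl | rfl <;> nlinarith
  obtain ⟨T, hT⟩ := eventually_atTop.mp hrate
  have hgrow : ∀ t, T ≤ t → σ * θ T + m / 2 * (t - T) ≤ |θ t| := by
    intro t ht
    refine (add_mul_le_of_le_hasDerivAt (f := fun t => σ * θ t)
      (fun s _ => (hθ s).const_mul σ) hT ht).trans ?_
    rcases hσ with rfl | rfl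
    · simpa using le_abs_self _
    · simpa using neg_le_abs _
  refine tendsto_atTop_mono' _ ((eventually_ge_atTop T).mono hgrow) ?_
  exact tendsto_atTop_add_const_left _ _
    ((tendsto_atTop_add_const_right _ (-T) tendsto_id).const_mul_atTop (by linarith))

/-! ### The saddle on the invariant axis -/

/-- Grönwall for `f' = f g`: orbits do not leave an invariant curve `f = 0` with bounded cofactor
`g`. The hypotheses concern times before `T` only, as suits a first exit time. -/
lemma eq_zero_of_hasDerivAt_mul {f g : ℝ → ℝ} {T K : ℝ} (hf : ContinuousOn f (Icc 0 T))
    (hd : ∀ t, 0 ≤ t → t < T → HasDerivAt f (f t * g t) t)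
    (hg : ∀ t, 0 ≤ t → t < T → |g t| ≤ K) (h0 : f 0 = 0) {t : ℝ} (ht : 0 ≤ t) (htT : t ≤ T) :
    f t = 0 := by
  refine eq_zero_of_abs_deriv_le_mul_abs_self_of_eq_zero_right (K := K) hf
    (fun s hs => (hd s hs.1 hs.2).hasDerivWithinAt) h0 (fun s hs => ?_) t ⟨ht, htT⟩
  rw [Real.norm_eq_abs, Real.norm_eq_abs, abs_mul, mul_comm]
  exact mul_le_mul_of_nonneg_right (hg s hs.1 hs.2) (abs_nonneg _)

lemma antitoneOn_Icc_of_hasDerivAt_nonpos {f f' : ℝ → ℝ} {T : ℝ} (hf : ContinuousOn f (Icc 0 T))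
    (hd : ∀ t, 0 ≤ t → t < T → HasDerivAt f (f' t) t)
    (h : ∀ t, 0 ≤ t → t < T → f' t ≤ 0) : AntitoneOn f (Icc 0 T) := by
  refine antitoneOn_of_hasDerivWithinAt_nonpos (f' := f') (convex_Icc 0 T) hf
    (fun t ht => ?_) fun t ht => ?_ <;> rw [interior_Icc] at ht
  · exact (hd t ht.1.le ht.2).hasDerivWithinAt
  · exact h t ht.1.le ht.2

lemma IsCutoffFlow.mem_closedBall_of_forall_lt {F : ℝ × ℝ → ℝ × ℝ} {r : ℝ}
    {φ : ℝ × ℝ → ℝ → ℝ × ℝ} (h : IsCutoffFlow F r φ) {q : ℝ × ℝ} {ρ T : ℝ} (hT : 0 < T)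
    (hin : ∀ t, 0 ≤ t → t < T → φ q t ∈ Metric.ball 0 ρ) : φ q T ∈ Metric.closedBall 0 ρ := by
  have : Tendsto (φ q) (𝓝[<] T) (𝓝 (φ q T)) := (h.continuous q).continuousAt.mono_left inf_le_left
  refine Metric.isClosed_closedBall.mem_of_tendsto this ?_
  filter_upwards [Ioo_mem_nhdsLT hT] with s hs
  exact Metric.ball_subset_closedBall (hin s hs.1.le hs.2)

/-- The exponential system in coordinates centred at a critical point on the invariant axis. -/
def axisField (β : ℝ) (z : ℝ × ℝ) : ℝ × ℝ :=
  (-2 * (1 + z.1) + β * z.2 ^ 2 - (1 + z.1) * z.2 ^ 2 + 2 * (1 + z.1) ^ 3,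
    z.2 * (1 - β * (1 + z.1) + 2 * (1 + z.1) ^ 2 - z.2 ^ 2))

namespace AxisSaddle

/-- The defining function of the invariant unit circle. -/
def circle (z : ℝ × ℝ) : ℝ := (1 + z.1) ^ 2 + z.2 ^ 2 - 1

lemma contDiff_axisField (β : ℝ) : ContDiff ℝ 1 (axisField β) := by
  unfold axisField
  fun_prop

lemma mem_bounds {z : ℝ × ℝ} (hz : z ∈ Metric.closedBall (0 : ℝ × ℝ) (1 / 4)) :
    -(1 / 4) ≤ z.1 ∧ z.1 ≤ 1 / 4 ∧ z.2 ^ 2 ≤ 1 / 16 := by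
  rw [mem_closedBall_zero_prod, abs_le, abs_le] at hz
  refine ⟨hz.1.1, hz.1.2, ?_⟩
  nlinarith [hz.2.1, hz.2.2]

/-- The unit circle is an invariant algebraic curve for every `β`. The factor `k` lets `k = 1` and
`k = -1` serve both directions of time. -/
lemma hasDerivAt_circle {β k : ℝ} {γ : ℝ → ℝ × ℝ} {t : ℝ}
    (h : HasDerivAt γ (k • axisField β (γ t)) t) :
    HasDerivAt (fun t => circle (γ t))
      (circle (γ t) * (k * (2 * (2 * (1 + (γ t).1) ^ 2 - (γ t).2 ^ 2)))) t := by
  have h1 := hasDerivAt_fst h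
  have h2 := hasDerivAt_snd h
  have h3 := ((h1.const_add 1).pow 2).add (h2.pow 2) |>.sub_const 1
  convert! h3 using 1
  simp only [circle, axisField, Prod.smul_fst, Prod.smul_snd, smul_eq_mul]
  push_cast
  ring

lemma hasDerivAt_sq_snd {β k : ℝ} {γ : ℝ → ℝ × ℝ} {t : ℝ}
    (h : HasDerivAt γ (k • axisField β (γ t)) t) :
    HasDerivAt (fun t => (γ t).2 ^ 2) (2 * (γ t).2 ^ 2 *
      (k * (1 - β * (1 + (γ t).1) + 2 * (1 + (γ t).1) ^ 2 - (γ t).2 ^ 2))) t := by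
  convert! (hasDerivAt_snd h).pow 2 using 1
  simp only [axisField, Prod.smul_snd, smul_eq_mul]
  push_cast
  ring

/-- On the circle the trajectories approach the critical point. -/
lemma circle_trajectory {β : ℝ} (hβ : 3 ≤ β) {φ : ℝ × ℝ → ℝ → ℝ × ℝ}
    (hφ : IsCutoffFlow (axisField β) (1 / 4) φ) {q : ℝ × ℝ} (hq : q ∈ Metric.ball 0 (1 / 4))
    (hc : circle q = 0) (hq2 : q.2 ^ 2 ≤ 1 / 64) :
    (∀ t, 0 ≤ t → φ q t ∈ Metric.ball 0 (1 / 4)) ∧ (∀ t, 0 ≤ t → circle (φ q t) = 0) ∧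
      Tendsto (φ q) atTop (𝓝 0) := by
  have hder : ∀ {t}, φ q t ∈ Metric.ball 0 (1 / 4) →
      HasDerivAt (φ q) ((1 : ℝ) • axisField β (φ q t)) t := fun hm => by
    rw [one_smul]; exact hφ.deriv_of_mem (Metric.ball_subset_closedBall hm)
  have hcont := hφ.continuous q
  have hcirc : Continuous fun t => circle (φ q t) := by
    unfold circle; exact (((continuous_const.add hcont.fst).pow 2).add (hcont.snd.pow 2)).sub
      continuous_const
  have hzero : ∀ T, 0 < T → (∀ t, 0 ≤ t → t < T → φ q t ∈ Metric.ball 0 (1 / 4)) →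
      ∀ t, 0 ≤ t → t ≤ T → circle (φ q t) = 0 := by
    intro T hT hin t ht htT
    refine eq_zero_of_hasDerivAt_mul (K := 7) hcirc.continuousOn
      (fun s hs hsT => hasDerivAt_circle (hder (hin s hs hsT))) (fun s hs hsT => ?_)
      (by rw [hφ.zero, hc]) ht htT
    obtain ⟨b1, b2, b3⟩ := mem_bounds (Metric.ball_subset_closedBall (hin s hs hsT))
    rw [abs_le]
    constructor <;> nlinarith [sq_nonneg (φ q s).2, sq_nonneg (1 + (φ q s).1)]
  have hin : ∀ t, 0 ≤ t → φ q t ∈ Metric.ball 0 (1 / 4) := by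
    refine forall_mem_of_no_first_exit Metric.isOpen_ball hcont (by rwa [hφ.zero]) fun T hT hin => ?_
    have hz := hzero T hT hin
    have anti := antitoneOn_Icc_of_hasDerivAt_nonpos (f := fun t => (φ q t).2 ^ 2) (T := T)
      (hcont.snd.pow 2).continuousOn
      (fun s hs hsT => hasDerivAt_sq_snd (hder (hin s hs hsT))) (fun s hs hsT => by
        obtain ⟨b1, b2, b3⟩ := mem_bounds (Metric.ball_subset_closedBall (hin s hs hsT))
        have hD := hz s hs hsT.le
        unfold circle at hD
        have hle : (φ q s).1 ≤ 0 := by nlinarith [sq_nonneg (φ q s).2]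
        -- With `x = 1 + z.1` and `y² = 1 - x²` the left side equals `x (3 x - β)`, and `0 < x ≤ 1`,
        -- `3 ≤ β`.
        have e : 1 - β * (1 + (φ q s).1) + 2 * (1 + (φ q s).1) ^ 2 - (φ q s).2 ^ 2 ≤ 0 := by
          nlinarith
        nlinarith [mul_nonneg (sq_nonneg (φ q s).2) (neg_nonneg.mpr e)])
    have hlast := anti (left_mem_Icc.mpr hT.le) (right_mem_Icc.mpr hT.le) hT.le
    simp only [hφ.zero] at hlast
    obtain ⟨b1, b2, b3⟩ := mem_bounds (hφ.mem_closedBall_of_forall_lt hT hin)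
    have hD := hz T hT.le le_rfl
    unfold circle at hD
    rw [mem_ball_zero_prod]
    constructor
    · rw [abs_lt]; constructor <;> nlinarith [sq_nonneg (φ q T).2]
    · refine abs_lt_of_sq_lt_sq ?_ (by norm_num); nlinarith
  have hD : ∀ t, 0 ≤ t → circle (φ q t) = 0 := fun t ht =>
    hzero (t + 1) (by linarith) (fun s hs _ => hin s hs) t ht (by linarith)
  refine ⟨hin, hD, ?_⟩
  have hcirc' : Continuous circle := by unfold circle; fun_prop
  have hlim := tendsto_zero_of_lyapunov (z := φ q) (W := fun z => z.2 ^ 2)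
    (w := fun z => 2 * z.2 ^ 2 * (1 * (1 - β * (1 + z.1) + 2 * (1 + z.1) ^ 2 - z.2 ^ 2))) (a := 0)
    (S := Metric.closedBall 0 (1 / 4) ∩ {z | circle z = 0})
    ((isCompact_closedBall _ _).inter_right (isClosed_eq hcirc' continuous_const))
    (fun t ht => ⟨Metric.ball_subset_closedBall (hin t ht), hD t ht⟩)
    (fun t ht => hasDerivAt_sq_snd (hder (hin t ht))) (by fun_prop) (by fun_prop)
    (fun z _ => sq_nonneg _) (fun z hz => ?_) (fun z hz h0 => ?_)
  · have h1 : Tendsto (fun t => (φ q t).2) atTop (𝓝 0) := by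
      have := hlim.sqrt
      simp only [Real.sqrt_sq_eq_abs, Real.sqrt_zero] at this
      exact (tendsto_zero_iff_abs_tendsto_zero _).mpr this
    have h2 : Tendsto (fun t => (φ q t).1) atTop (𝓝 0) := by
      refine squeeze_zero_norm' ?_ hlim
      filter_upwards [eventually_ge_atTop 0] with t ht
      obtain ⟨b1, b2, b3⟩ := mem_bounds (Metric.ball_subset_closedBall (hin t ht))
      have := hD t ht
      unfold circle at this
      rw [Real.norm_eq_abs, abs_le]
      constructor <;> nlinarith [sq_nonneg (φ q t).2]
    exact h2.prodMk_nhds h1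
  · obtain ⟨b1, b2, b3⟩ := mem_bounds hz.1
    have hD := hz.2
    simp only [circle, mem_ofPred_eq] at hD
    have hle : z.1 ≤ 0 := by nlinarith [sq_nonneg z.2]
    have e : 1 - β * (1 + z.1) + 2 * (1 + z.1) ^ 2 - z.2 ^ 2 ≤ 0 := by nlinarith
    nlinarith [mul_nonneg (sq_nonneg z.2) (neg_nonneg.mpr e)]
  · obtain ⟨b1, b2, b3⟩ := mem_bounds hz.1
    have hD := hz.2
    simp only [circle, mem_ofPred_eq] at hD
    have hlt : z.1 < 0 := by
      nlinarith
    have e : 1 - β * (1 + z.1) + 2 * (1 + z.1) ^ 2 - z.2 ^ 2 < 0 := by nlinarith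
    nlinarith [mul_pos h0 (neg_pos.mpr e)]

/-- Off the circle the trajectories leave. -/
lemma circle_eq_zero_of_forall_mem {β : ℝ} {φ : ℝ × ℝ → ℝ → ℝ × ℝ}
    (hφ : IsCutoffFlow (axisField β) (1 / 4) φ) {q : ℝ × ℝ}
    (hq : ∀ t, 0 ≤ t → φ q t ∈ Metric.closedBall 0 (1 / 4)) : circle q = 0 := by
  by_contra hne
  have hder : ∀ t, 0 ≤ t → HasDerivAt (fun t => circle (φ q t) ^ 2)
      (circle (φ q t) ^ 2 * (4 * (2 * (1 + (φ q t).1) ^ 2 - (φ q t).2 ^ 2))) t := fun t ht => by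
    have h1 : HasDerivAt (φ q) ((1 : ℝ) • axisField β (φ q t)) t := by
      rw [one_smul]; exact hφ.deriv_of_mem (hq t ht)
    convert! (hasDerivAt_circle h1).pow 2 using 1
    push_cast
    ring
  have hrate : ∀ t, 0 ≤ t → circle (φ q t) ^ 2 ≤
      circle (φ q t) ^ 2 * (4 * (2 * (1 + (φ q t).1) ^ 2 - (φ q t).2 ^ 2)) := fun t ht => by
    obtain ⟨b1, b2, b3⟩ := mem_bounds (hq t ht)
    refine le_mul_of_one_le_right (sq_nonneg _) ?_
    nlinarith
  have mono := monotoneOn_of_hasDerivAt_nonneg hder fun t ht => (sq_nonneg _).trans (hrate t ht)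
  refine not_bddAbove_of_le_hasDerivAt (a := 0) (m := circle q ^ 2) (M := 1) (by positivity) hder
    (fun t ht => le_trans ?_ (hrate t ht)) (fun t ht => ?_)
  · have := mono (mem_Ici.mpr le_rfl) ht ht
    simpa only [hφ.zero] using this
  · obtain ⟨b1, b2, b3⟩ := mem_bounds (hq t ht)
    rw [← one_pow 2, sq_le_sq, abs_one, abs_le, circle]
    constructor <;> nlinarith [sq_nonneg (φ q t).2]

/-- The axis is invariant, and on it the reversed field is `-X (4 + 6 X + 2 X²)`, which contracts.
-/
lemma axis_trajectory {β : ℝ} {ψ : ℝ × ℝ → ℝ → ℝ × ℝ}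
    (hψ : IsCutoffFlow (-axisField β) (1 / 4) ψ) {q : ℝ × ℝ} (hq : q ∈ Metric.ball 0 (1 / 4))
    (hq2 : q.2 = 0) :
    (∀ t, 0 ≤ t → ψ q t ∈ Metric.ball 0 (1 / 4)) ∧ (∀ t, 0 ≤ t → (ψ q t).2 = 0) ∧
      Tendsto (ψ q) atTop (𝓝 0) := by
  have hder : ∀ {t}, ψ q t ∈ Metric.ball 0 (1 / 4) →
      HasDerivAt (ψ q) (-axisField β (ψ q t)) t := fun hm =>
    hψ.deriv_of_mem (Metric.ball_subset_closedBall hm)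
  have hcont := hψ.continuous q
  have hzero : ∀ T, 0 < T → (∀ t, 0 ≤ t → t < T → ψ q t ∈ Metric.ball 0 (1 / 4)) →
      ∀ t, 0 ≤ t → t ≤ T → (ψ q t).2 = 0 := by
    intro T hT hin t ht htT
    refine eq_zero_of_hasDerivAt_mul (K := 6 + 2 * |β|) (f := fun t => (ψ q t).2)
      (g := fun t => -(1 - β * (1 + (ψ q t).1) + 2 * (1 + (ψ q t).1) ^ 2 - (ψ q t).2 ^ 2))
      hcont.snd.continuousOn
      (fun s hs hsT => ?_) (fun s hs hsT => ?_) (by simp only [hψ.zero, hq2]) ht htT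
    · convert! hasDerivAt_snd (hder (hin s hs hsT)) using 1
      simp only [axisField, Prod.snd_neg]
      ring
    · obtain ⟨b1, b2, b3⟩ := mem_bounds (Metric.ball_subset_closedBall (hin s hs hsT))
      have h1 : |β * (1 + (ψ q s).1)| ≤ |β| * 2 := by
        rw [abs_mul]
        refine mul_le_mul_of_nonneg_left ?_ (abs_nonneg β)
        rw [abs_le]; constructor <;> linarith
      have h2 := abs_le.mp h1
      simp only [abs_le]
      constructor <;> nlinarith [sq_nonneg (ψ q s).2]
  have hder2 : ∀ {t}, ψ q t ∈ Metric.ball 0 (1 / 4) → HasDerivAt (fun t => (ψ q t).1 ^ 2)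
      (2 * (ψ q t).1 * -(axisField β (ψ q t)).1) t := fun hm => by
    convert! (hasDerivAt_fst (hder hm)).pow 2 using 1
    simp
  have hsign : ∀ z : ℝ × ℝ, z ∈ Metric.closedBall (0 : ℝ × ℝ) (1 / 4) → z.2 = 0 →
      2 * z.1 * -(axisField β z).1 ≤ - z.1 ^ 2 := by
    intro z hz h0
    obtain ⟨b1, b2, b3⟩ := mem_bounds hz
    simp only [axisField, h0]
    have : 2 * z.1 * -(-2 * (1 + z.1) + β * 0 ^ 2 - (1 + z.1) * 0 ^ 2 + 2 * (1 + z.1) ^ 3) =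
      - (z.1 ^ 2 * (8 + 12 * z.1 + 4 * z.1 ^ 2)) := by ring
    rw [this]
    have h1 : 1 ≤ 8 + 12 * z.1 + 4 * z.1 ^ 2 := by nlinarith [sq_nonneg z.1]
    nlinarith [mul_le_mul_of_nonneg_left h1 (sq_nonneg z.1)]
  have hin : ∀ t, 0 ≤ t → ψ q t ∈ Metric.ball 0 (1 / 4) := by
    refine forall_mem_of_no_first_exit Metric.isOpen_ball hcont (by rwa [hψ.zero]) fun T hT hin => ?_
    have hz := hzero T hT hin
    have anti := antitoneOn_Icc_of_hasDerivAt_nonpos (f := fun t => (ψ q t).1 ^ 2) (T := T)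
      (hcont.fst.pow 2).continuousOn
      (fun s hs hsT => hder2 (hin s hs hsT)) (fun s hs hsT => by
        have := hsign _ (Metric.ball_subset_closedBall (hin s hs hsT)) (hz s hs hsT.le)
        nlinarith [sq_nonneg (ψ q s).1])
    have hlast := anti (left_mem_Icc.mpr hT.le) (right_mem_Icc.mpr hT.le) hT.le
    simp only [hψ.zero] at hlast
    rw [mem_ball_zero_prod] at hq ⊢
    refine ⟨(sq_le_sq.mp hlast).trans_lt hq.1, ?_⟩
    rw [hz T hT.le le_rfl]
    norm_num
  have hD : ∀ t, 0 ≤ t → (ψ q t).2 = 0 := fun t ht =>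
    hzero (t + 1) (by linarith) (fun s hs _ => hin s hs) t ht (by linarith)
  refine ⟨hin, hD, ?_⟩
  have hlim := tendsto_zero_of_lyapunov (z := ψ q) (W := fun z => z.1 ^ 2)
    (w := fun z => 2 * z.1 * -(axisField β z).1) (a := 0)
    (S := Metric.closedBall 0 (1 / 4) ∩ {z | z.2 = 0})
    ((isCompact_closedBall _ _).inter_right (isClosed_eq continuous_snd continuous_const))
    (fun t ht => ⟨Metric.ball_subset_closedBall (hin t ht), hD t ht⟩)
    (fun t ht => hder2 (hin t ht)) (by fun_prop) (by unfold axisField; fun_prop)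
    (fun z _ => sq_nonneg _)
    (fun z hz => by have := hsign z hz.1 hz.2; nlinarith [sq_nonneg z.1])
    (fun z hz h0 => by have := hsign z hz.1 hz.2; linarith)
  have h1 : Tendsto (fun t => (ψ q t).1) atTop (𝓝 0) := by
    have := hlim.sqrt
    simp only [Real.sqrt_sq_eq_abs, Real.sqrt_zero] at this
    exact (tendsto_zero_iff_abs_tendsto_zero _).mpr this
  have h2 : Tendsto (fun t => (ψ q t).2) atTop (𝓝 0) := by
    refine tendsto_const_nhds.congr' ?_
    filter_upwards [eventually_ge_atTop 0] with t ht
    exact (hD t ht).symm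
  exact h1.prodMk_nhds h2

/-- Off the axis the trajectories leave backward in time. -/
lemma snd_eq_zero_of_forall_mem {β : ℝ} (hβ : 3 ≤ β) {ψ : ℝ × ℝ → ℝ → ℝ × ℝ}
    (hψ : IsCutoffFlow (-axisField β) (1 / 4) ψ) {q : ℝ × ℝ}
    (hq : ∀ t, 0 ≤ t → ψ q t ∈ Metric.closedBall 0 (1 / 4)) : q.2 = 0 := by
  by_contra hne
  have hder : ∀ t, 0 ≤ t → HasDerivAt (ψ q) ((-1 : ℝ) • axisField β (ψ q t)) t := fun t ht => by
    rw [neg_one_smul]; exact hψ.deriv_of_mem (hq t ht)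
  set c := |circle q| with hc
  have hcpos : 0 ≤ c := abs_nonneg _
  -- Backward in time the circle attracts exponentially; the rate `1` is not optimal but suffices.
  have hcirc : ∀ t, 0 ≤ t → |circle (ψ q t)| ≤ c * Real.exp (-t) := by
    intro t ht
    have anti := antitoneOn_of_hasDerivAt_nonpos (a := 0)
      (f := fun t => Real.exp (2 * t) * circle (ψ q t) ^ 2)
      (fun t ht => hasDerivAt_exp_mul ((hasDerivAt_circle (hder t ht)).pow 2)) (fun t ht => by
        obtain ⟨b1, b2, b3⟩ := mem_bounds (hq t ht)
        refine mul_nonpos_of_nonneg_of_nonpos (Real.exp_pos _).le ?_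
        have h1 : 1 ≤ 2 * (1 + (ψ q t).1) ^ 2 - (ψ q t).2 ^ 2 := by nlinarith
        push_cast
        nlinarith [mul_le_mul_of_nonneg_left h1 (sq_nonneg (circle (ψ q t)))])
    have h1 := anti (mem_Ici.mpr le_rfl) ht ht
    simp only [hψ.zero, mul_zero, Real.exp_zero, one_mul] at h1
    refine abs_le_of_sq_le_sq ?_ (mul_nonneg hcpos (Real.exp_pos _).le)
    have h2 : (c * Real.exp (-t)) ^ 2 = circle q ^ 2 / Real.exp (2 * t) := by
      rw [mul_pow, hc, sq_abs, ← Real.exp_nat_mul, div_eq_mul_inv, ← Real.exp_neg]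
      congr 2
      push_cast
      ring
    rw [h2, le_div_iff₀ (Real.exp_pos _)]
    linarith
  -- The reversed flow satisfies `(y²)' ≥ 2 y⁴ - 2 c e^{-t} y²`, the error measuring the distance to
  -- the circle. The exponential is the integrating factor for this integrable error, so `P` grows.
  -- The term `y⁴` carries the case `β = 3`, where the linear rate vanishes.
  set P := fun t => (ψ q t).2 ^ 2 * Real.exp (-2 * c * Real.exp (-t)) with hP
  have hPd : ∀ t, 0 ≤ t → HasDerivAt P ((2 * (ψ q t).2 ^ 2 *
      (-1 * (1 - β * (1 + (ψ q t).1) + 2 * (1 + (ψ q t).1) ^ 2 - (ψ q t).2 ^ 2)) +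
        (ψ q t).2 ^ 2 * (2 * c * Real.exp (-t))) * Real.exp (-2 * c * Real.exp (-t))) t := by
    intro t ht
    convert! (hasDerivAt_sq_snd (hder t ht)).mul
      (((hasDerivAt_neg t).exp.const_mul (-2 * c)).exp) using 1
    ring
  have hkey : ∀ t, 0 ≤ t → 2 * ((ψ q t).2 ^ 2) ^ 2 ≤ 2 * (ψ q t).2 ^ 2 *
      (-1 * (1 - β * (1 + (ψ q t).1) + 2 * (1 + (ψ q t).1) ^ 2 - (ψ q t).2 ^ 2)) +
        (ψ q t).2 ^ 2 * (2 * c * Real.exp (-t)) := by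
    intro t ht
    obtain ⟨b1, b2, b3⟩ := mem_bounds (hq t ht)
    have h1 := hcirc t ht
    set x := 1 + (ψ q t).1 with hx
    set D := circle (ψ q t) with hD
    have hDe : (ψ q t).2 ^ 2 - D = 1 - x ^ 2 := by rw [hD, circle]; ring
    have hpos : 0 ≤ |D| := abs_nonneg D
    -- For `β = 3` the rate contains `3 x - 1 - 2 x² = (2 x - 1)(1 - x)`; the identity `(1 + x)(1 -
    -- x) = y² - D` bounds it below by the defect `D`.
    have h2 : -|D| ≤ (2 * x - 1) * (1 - x) := by
      have h3 : -((1 + x) * |D|) ≤ (1 + x) * ((2 * x - 1) * (1 - x)) := by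
        have h4 : (1 + x) * ((2 * x - 1) * (1 - x)) =
          (2 * x - 1) * (ψ q t).2 ^ 2 - (2 * x - 1) * D := by rw [← mul_sub, hDe]; ring
        have h5 : (2 * x - 1) * D ≤ (1 + x) * |D| := by
          nlinarith [mul_nonneg (show 0 ≤ 2 * x - 1 by linarith)
              (sub_nonneg.mpr (le_abs_self D)), mul_nonneg (show 0 ≤ 2 - x by linarith) hpos]
        have h6 : 0 ≤ (2 * x - 1) * (ψ q t).2 ^ 2 :=
          mul_nonneg (by linarith) (sq_nonneg _)
        linarith
      have h7 : 0 < 1 + x := by linarith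
      by_contra! hc'
      nlinarith [mul_lt_mul_of_pos_left hc' h7]
    have h8 : (ψ q t).2 ^ 2 - c * Real.exp (-t) ≤
        -1 * (1 - β * x + 2 * x ^ 2 - (ψ q t).2 ^ 2) := by
      nlinarith [mul_nonneg (show 0 ≤ β - 3 by linarith) (show 0 ≤ x by linarith)]
    nlinarith [mul_le_mul_of_nonneg_left h8 (sq_nonneg (ψ q t).2)]
  have mono := monotoneOn_of_hasDerivAt_nonneg hPd fun t ht =>
    mul_nonneg (le_trans (by positivity) (hkey t ht)) (Real.exp_pos _).le
  have hP0 : 0 < P 0 := by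
    simp only [hP, hψ.zero]
    positivity
  have hPle : ∀ t, 0 ≤ t → P t ≤ (ψ q t).2 ^ 2 := fun t ht => by
    refine mul_le_of_le_one_right (sq_nonneg _) (Real.exp_le_one_iff.mpr ?_)
    have := mul_nonneg hcpos (Real.exp_pos (-t)).le
    linarith
  refine not_bddAbove_of_le_hasDerivAt (a := 0) (M := 1)
    (m := 2 * P 0 ^ 2 * Real.exp (-2 * c)) (by positivity) hPd (fun t ht => ?_) (fun t ht => ?_)
  · have h1 : P 0 ≤ (ψ q t).2 ^ 2 := (mono (mem_Ici.mpr le_rfl) ht ht).trans (hPle t ht)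
    have h2 : 2 * P 0 ^ 2 ≤ 2 * ((ψ q t).2 ^ 2) ^ 2 :=
      mul_le_mul_of_nonneg_left (pow_le_pow_left₀ hP0.le h1 2) zero_le_two
    have h3 : Real.exp (-2 * c) ≤ Real.exp (-2 * c * Real.exp (-t)) := by
      refine Real.exp_le_exp.mpr ?_
      have : Real.exp (-t) ≤ 1 := Real.exp_le_one_iff.mpr (by linarith)
      nlinarith
    exact mul_le_mul (h2.trans (hkey t ht)) h3 (Real.exp_pos _).le
      (le_trans (by positivity) (hkey t ht))
  · linarith [hPle t ht, (mem_bounds (hq t ht)).2.2]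

/-- The point of the circle at height `σ / 8`. -/
noncomputable def circlePoint (σ : ℝ) : ℝ × ℝ := (√(1 - 1 / 64) - 1, σ * (1 / 8))

lemma circlePoint_spec {σ : ℝ} (hσ : σ = 1 ∨ σ = -1) :
    circlePoint σ ∈ Metric.ball (0 : ℝ × ℝ) (1 / 4) ∧ circle (circlePoint σ) = 0 ∧
      (circlePoint σ).2 ^ 2 ≤ 1 / 64 := by
  have hσ2 : σ ^ 2 = 1 := by rcases hσ with rfl | rfl <;> norm_num
  have h1 := Real.sq_sqrt (show (0 : ℝ) ≤ 1 - 1 / 64 by norm_num)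
  have h2 : √(1 - 1 / 64 : ℝ) < 1 := by
    rw [Real.sqrt_lt' one_pos]; norm_num
  have h3 : (7 / 8 : ℝ) < √(1 - 1 / 64) := by
    apply Real.lt_sqrt_of_sq_lt; norm_num
  refine ⟨?_, ?_, ?_⟩
  · rw [mem_ball_zero_prod]
    simp only [circlePoint, abs_lt]
    refine ⟨⟨by linarith, by linarith⟩, ?_, ?_⟩ <;> rcases hσ with rfl | rfl <;> norm_num
  · simp only [circle, circlePoint]
    rw [mul_pow, hσ2]
    linarith
  · simp only [circlePoint]
    rw [mul_pow, hσ2]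
    norm_num

end AxisSaddle

-- Two arcs of the circle are the stable branches and two halves of the axis the unstable ones.
-- Forward in time only points of the circle can stay nearby, backward only points of the axis. The
-- argument is uniform in `β` and includes the non-hyperbolic value `3`.
open AxisSaddle in
theorem isSaddle_axisField {β : ℝ} (hβ : 3 ≤ β) : IsSaddle (axisField β) 0 := by
  have h0 : axisField β 0 = 0 := by simp [axisField]
  obtain ⟨K, hK⟩ := (contDiff_axisField β).contDiffOn.exists_lipschitzOnWith one_ne_zero
    (convex_closedBall (0 : ℝ × ℝ) (1 / 4)) (isCompact_closedBall _ _)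
  obtain ⟨K', hK'⟩ := (contDiff_axisField β).neg.contDiffOn.exists_lipschitzOnWith one_ne_zero
    (convex_closedBall (0 : ℝ × ℝ) (1 / 4)) (isCompact_closedBall _ _)
  obtain ⟨φ, hφ⟩ := exists_isCutoffFlow (by norm_num) hK
  obtain ⟨ψ, hψ⟩ := exists_isCutoffFlow (by norm_num) hK'
  have hK'' : LipschitzOnWith K' (-axisField β) (Metric.closedBall 0 (1 / 4)) := hK'
  have hne : ∀ {q : ℝ × ℝ}, q ≠ 0 → ∀ t, φ q t ≠ 0 := fun hq t h =>
    hq (hφ.injective (t := t) (by rw [h, zero_cutoffFlow (by norm_num) hK h0 hφ]))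
  have hne' : ∀ {q : ℝ × ℝ}, q ≠ 0 → ∀ t, ψ q t ≠ 0 := fun hq t h =>
    hq (hψ.injective (t := t) (by
      rw [h, zero_cutoffFlow (by norm_num) hK'' (by simp [h0]) hψ]))
  -- Near the critical point the arc is a graph over the second coordinate.
  have circ_fst : ∀ {z z' : ℝ × ℝ}, z ∈ Metric.closedBall (0 : ℝ × ℝ) (1 / 4) →
      z' ∈ Metric.closedBall (0 : ℝ × ℝ) (1 / 4) → circle z = 0 → circle z' = 0 → z.2 = z'.2 →
      z = z' := by
    intro z z' hz hz' hc hc' h2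
    obtain ⟨b1, -, -⟩ := mem_bounds hz
    obtain ⟨b1', -, -⟩ := mem_bounds hz'
    unfold circle at hc hc'
    rw [h2] at hc
    have : (z.1 - z'.1) * (2 + z.1 + z'.1) = 0 := by linarith
    rcases mul_eq_zero.mp this with h | h
    · exact Prod.ext (by linarith) h2
    · linarith
  -- the two branches of the circle
  have hbranch : ∀ σ : ℝ, (σ = 1 ∨ σ = -1) →
      Approaches (axisField β) (φ (circlePoint σ)) 0 ∧
      (∀ t, 0 ≤ t → circle (φ (circlePoint σ) t) = 0) ∧
      (∀ t, 0 ≤ t → 0 < σ * (φ (circlePoint σ) t).2) ∧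
      ∀ q ∈ Metric.ball (0 : ℝ × ℝ) (1 / 8), circle q = 0 → 0 < σ * q.2 →
        q ∈ halfOrbit (φ (circlePoint σ)) := by
    intro σ hσ
    obtain ⟨s1, s2, s3⟩ := circlePoint_spec hσ
    obtain ⟨t1, t2, t3⟩ := circle_trajectory hβ hφ s1 s2 s3
    have hσ2 : σ * σ = 1 := by rcases hσ with rfl | rfl <;> norm_num
    have hz : circlePoint σ ≠ 0 := fun h => by
      have : σ * (1 / 8) = 0 := congrArg Prod.snd h
      rcases hσ with rfl | rfl <;> norm_num at this
    have hcont : Continuous fun t => σ * (φ (circlePoint σ) t).2 :=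
      continuous_const.mul (hφ.continuous _).snd
    have hstart : σ * (φ (circlePoint σ) 0).2 = 1 / 8 := by
      rw [hφ.zero, circlePoint, ← mul_assoc, hσ2, one_mul]
    refine ⟨⟨hφ.isIntegralCurveOn fun t ht => Metric.ball_subset_closedBall (t1 t ht),
      fun t _ => hne hz t, t3⟩, t2, fun t ht => ?_, fun q hq hc hpos => ?_⟩
    · refine forall_pos_of_ne_zero hcont (by rw [hstart]; norm_num) (fun s hs h => ?_) ht
      have h2 : (φ (circlePoint σ) s).2 = 0 := by rcases hσ with rfl | rfl <;> simpa using h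
      exact hne hz s (circ_fst (Metric.ball_subset_closedBall (t1 s hs))
        (Metric.mem_closedBall_self (by norm_num)) (t2 s hs) (by simp [circle]) h2)
    · have hlim : Tendsto (fun t => σ * (φ (circlePoint σ) t).2) atTop (𝓝 0) := by
        simpa using! ((continuous_snd.tendsto (0 : ℝ × ℝ)).comp t3).const_mul σ
      obtain ⟨T, hT, hT0⟩ := ((hlim.eventually_lt_const hpos).and (eventually_ge_atTop 0)).exists
      rw [mem_ball_zero_prod] at hq
      have hle : σ * q.2 ≤ 1 / 8 := by
        have := abs_lt.mp hq.2
        rcases hσ with rfl | rfl <;> linarith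
      -- The branch starts at height `1/8` and tends to `0`, so it passes the height of `q`; on the
      -- arc equal heights mean equal points.
      obtain ⟨t, ht, hte⟩ := intermediate_value_Icc' hT0 hcont.continuousOn
        (show σ * q.2 ∈ Icc _ _ from ⟨hT.le, by rw [hstart]; exact hle⟩)
      refine ⟨t, ht.1, circ_fst (Metric.ball_subset_closedBall (t1 t ht.1)) ?_ (t2 t ht.1) hc ?_⟩
      · rw [mem_closedBall_zero_prod]; constructor <;> linarith
      · rcases hσ with rfl | rfl <;> simpa using hte
  -- the two branches of the axis
  have haxis : ∀ σ : ℝ, (σ = 1 ∨ σ = -1) →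
      Approaches (-axisField β) (ψ (σ * (1 / 8), 0)) 0 ∧
      (∀ t, 0 ≤ t → (ψ (σ * (1 / 8), 0) t).2 = 0) ∧
      (∀ t, 0 ≤ t → 0 < σ * (ψ (σ * (1 / 8), 0) t).1) ∧
      ∀ q ∈ Metric.ball (0 : ℝ × ℝ) (1 / 8), q.2 = 0 → 0 < σ * q.1 →
        q ∈ halfOrbit (ψ (σ * (1 / 8), 0)) := by
    intro σ hσ
    have hσ2 : σ * σ = 1 := by rcases hσ with rfl | rfl <;> norm_num
    obtain ⟨t1, t2, t3⟩ := axis_trajectory hψ (q := (σ * (1 / 8), 0)) (by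
      rw [mem_ball_zero_prod]
      refine ⟨?_, by norm_num⟩
      rcases hσ with rfl | rfl <;> rw [abs_lt] <;> norm_num) rfl
    have hz : ((σ * (1 / 8), 0) : ℝ × ℝ) ≠ 0 := fun h => by
      have : σ * (1 / 8) = 0 := congrArg Prod.fst h
      rcases hσ with rfl | rfl <;> norm_num at this
    have hcont : Continuous fun t => σ * (ψ (σ * (1 / 8), 0) t).1 :=
      continuous_const.mul (hψ.continuous _).fst
    have hstart : σ * (ψ (σ * (1 / 8), 0) 0).1 = 1 / 8 := by
      rw [hψ.zero, ← mul_assoc, hσ2, one_mul]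
    refine ⟨⟨hψ.isIntegralCurveOn fun t ht => Metric.ball_subset_closedBall (t1 t ht),
      fun t _ => hne' hz t, t3⟩, t2, fun t ht => ?_, fun q hq hc hpos => ?_⟩
    · refine forall_pos_of_ne_zero hcont (by rw [hstart]; norm_num) (fun s hs h => ?_) ht
      have h2 : (ψ (σ * (1 / 8), 0) s).1 = 0 := by rcases hσ with rfl | rfl <;> simpa using h
      exact hne' hz s (Prod.ext h2 (t2 s hs))
    · have hlim : Tendsto (fun t => σ * (ψ (σ * (1 / 8), 0) t).1) atTop (𝓝 0) := by
        simpa using! ((continuous_fst.tendsto (0 : ℝ × ℝ)).comp t3).const_mul σ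
      obtain ⟨T, hT, hT0⟩ := ((hlim.eventually_lt_const hpos).and (eventually_ge_atTop 0)).exists
      rw [mem_ball_zero_prod] at hq
      have hle : σ * q.1 ≤ 1 / 8 := by
        have := abs_lt.mp hq.1
        rcases hσ with rfl | rfl <;> linarith
      obtain ⟨t, ht, hte⟩ := intermediate_value_Icc' hT0 hcont.continuousOn
        (show σ * q.1 ∈ Icc _ _ from ⟨hT.le, by rw [hstart]; exact hle⟩)
      refine ⟨t, ht.1, Prod.ext ?_ ((t2 t ht.1).trans hc.symm)⟩
      rcases hσ with rfl | rfl <;> simpa using hte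
  obtain ⟨a1, b1, c1, d1⟩ := hbranch 1 (Or.inl rfl)
  obtain ⟨a2, b2, c2, d2⟩ := hbranch (-1) (Or.inr rfl)
  obtain ⟨a3, b3, c3, d3⟩ := haxis 1 (Or.inl rfl)
  obtain ⟨a4, b4, c4, d4⟩ := haxis (-1) (Or.inr rfl)
  have hsub : Metric.ball (0 : ℝ × ℝ) (1 / 8) ⊆ Metric.closedBall 0 (1 / 4) :=
    (Metric.ball_subset_ball (by norm_num)).trans Metric.ball_subset_closedBall
  refine ⟨h0, _, _, _, _, a1, a2, a3, a4, ?_, Metric.ball 0 (1 / 8),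
    Metric.ball_mem_nhds 0 (by norm_num), fun q hq hq0 => ⟨?_, ?_⟩⟩
  · simp only [List.pairwise_cons, List.mem_cons, List.not_mem_nil, or_false, forall_eq_or_imp,
      forall_eq, false_imp_iff, implies_true, List.Pairwise.nil, and_true, Set.disjoint_left,
      halfOrbit]
    refine ⟨⟨?_, ?_, ?_⟩, ⟨?_, ?_⟩, ?_⟩ <;> rintro _ ⟨t, ht, rfl⟩ ⟨s, hs, he⟩
    · have h1 := c1 t ht; have h2 := c2 s hs; rw [he] at h2; linarith
    · have h1 := c1 t ht; have h2 := b3 s hs; rw [he] at h2; rw [h2] at h1; linarith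
    · have h1 := c1 t ht; have h2 := b4 s hs; rw [he] at h2; rw [h2] at h1; linarith
    · have h1 := c2 t ht; have h2 := b3 s hs; rw [he] at h2; rw [h2] at h1; linarith
    · have h1 := c2 t ht; have h2 := b4 s hs; rw [he] at h2; rw [h2] at h1; linarith
    · have h1 := c3 t ht; have h2 := c4 s hs; rw [he] at h2; linarith
  · by_cases hst : ∀ t, 0 ≤ t → φ q t ∈ Metric.ball 0 (1 / 8)
    · left
      have hc := circle_eq_zero_of_forall_mem hφ fun t ht => hsub (hst t ht)
      rcases lt_trichotomy q.2 0 with h | h | h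
      · exact Or.inr (d2 q hq hc (by linarith))
      · exact absurd (circ_fst (hsub hq) (Metric.mem_closedBall_self (by norm_num)) hc
          (by simp [circle]) h) hq0
      · exact Or.inl (d1 q hq hc (by linarith))
    · push Not at hst
      exact Or.inr (hφ.leaves Metric.isOpen_ball hsub hq hst)
  · by_cases hst : ∀ t, 0 ≤ t → ψ q t ∈ Metric.ball 0 (1 / 8)
    · left
      have hc := snd_eq_zero_of_forall_mem hβ hψ fun t ht => hsub (hst t ht)
      rcases lt_trichotomy q.1 0 with h | h | h
      · exact Or.inr (d4 q hq hc (by linarith))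
      · exact absurd (Prod.ext h hc) hq0
      · exact Or.inl (d3 q hq hc (by linarith))
    · push Not at hst
      exact Or.inr (hψ.leaves Metric.isOpen_ball hsub hq hst)

/-! ### The saddle-node -/

/-- In reversed time a zero at `t` would propagate back to time `0`. -/
lemma ne_zero_of_hasDerivAt_mul {f g : ℝ → ℝ} {T K : ℝ}
    (hd : ∀ t, 0 ≤ t → t ≤ T → HasDerivAt f (f t * g t) t)
    (hg : ∀ t, 0 ≤ t → t ≤ T → |g t| ≤ K) (h0 : f 0 ≠ 0) {t : ℝ} (ht : 0 ≤ t) (htT : t ≤ T) :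
    f t ≠ 0 := by
  intro hz
  have hs : ∀ {s}, 0 ≤ s → s ≤ t → 0 ≤ t - s ∧ t - s ≤ T := fun h1 h2 => by
    constructor <;> linarith
  have hrev : ∀ s, 0 ≤ s → s ≤ t → HasDerivAt (fun s => f (t - s)) (f (t - s) * -g (t - s)) s := by
    intro s h1 h2
    have := (hd (t - s) (hs h1 h2).1 (hs h1 h2).2).scomp s ((hasDerivAt_id s).const_sub t)
    convert! this using 1
    simp
  have := eq_zero_of_hasDerivAt_mul (f := fun s => f (t - s)) (g := fun s => -g (t - s)) (K := K)
    (fun s hs' => (hrev s hs'.1 hs'.2).continuousAt.continuousWithinAt)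
    (fun s h1 h2 => hrev s h1 h2.le)
    (fun s h1 h2 => by rw [abs_neg]; exact hg _ (hs h1 h2.le).1 (hs h1 h2.le).2)
    (by simpa using hz) ht le_rfl
  exact h0 (by simpa using this)

lemma neg_of_hasDerivAt_mul {f g : ℝ → ℝ} {T K : ℝ}
    (hd : ∀ t, 0 ≤ t → t ≤ T → HasDerivAt f (f t * g t) t)
    (hg : ∀ t, 0 ≤ t → t ≤ T → |g t| ≤ K) (h0 : f 0 < 0) {t : ℝ} (ht : 0 ≤ t) (htT : t ≤ T) :
    f t < 0 := by
  by_contra! hc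
  obtain ⟨s, hs, hs0⟩ := intermediate_value_Icc ht
    (fun s hs => (hd s hs.1 (hs.2.trans htT)).continuousAt.continuousWithinAt) ⟨h0.le, hc⟩
  exact ne_zero_of_hasDerivAt_mul hd hg h0.ne hs.1 (hs.2.trans htT) hs0

lemma nonpos_of_hasDerivAt_mul {f g : ℝ → ℝ} {T K : ℝ}
    (hd : ∀ t, 0 ≤ t → t ≤ T → HasDerivAt f (f t * g t) t)
    (hg : ∀ t, 0 ≤ t → t ≤ T → |g t| ≤ K) (h0 : f 0 ≤ 0) {t : ℝ} (ht : 0 ≤ t) (htT : t ≤ T) :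
    f t ≤ 0 := by
  rcases h0.lt_or_eq with h | h
  · exact (neg_of_hasDerivAt_mul hd hg h ht htT).le
  · exact (eq_zero_of_hasDerivAt_mul
      (fun s hs => (hd s hs.1 hs.2).continuousAt.continuousWithinAt)
      (fun s h1 h2 => hd s h1 h2.le) (fun s h1 h2 => hg s h1 h2.le) h ht htT).le

/-- Left difference quotients suffice: at a first exit time only the past is controlled. -/
lemma nonneg_of_hasDerivAt_of_le {f : ℝ → ℝ} {f' T : ℝ} (hT : 0 < T) (hf : HasDerivAt f f' T)
    (h : ∀ t, 0 ≤ t → t < T → f t ≤ f T) : 0 ≤ f' := by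
  have h1 := (hasDerivWithinAt_iff_tendsto_slope' (s := Iio T) (by simp)).mp hf.hasDerivWithinAt
  refine ge_of_tendsto h1 ?_
  filter_upwards [Ioo_mem_nhdsLT hT] with s hs
  rw [slope_def_field]
  exact div_nonneg_of_nonpos (by linarith [h s hs.1.le hs.2]) (by linarith [hs.2])

/-- `localStableSet` speaks of arbitrary trajectories; while these stay in the square, uniqueness
identifies them with the cut-off flow. -/
lemma IsCutoffFlow.eqOn_of_isIntegralCurveOn {F : ℝ × ℝ → ℝ × ℝ} {r : ℝ} (hr : 0 ≤ r) {K : NNReal}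
    (hF : LipschitzOnWith K F (Metric.closedBall 0 r)) {φ : ℝ × ℝ → ℝ → ℝ × ℝ}
    (h : IsCutoffFlow F r φ) {γ : ℝ → ℝ × ℝ} (hγ : IsIntegralCurveOn γ (fun _ => F) (Ici 0))
    (hm : ∀ t, 0 ≤ t → γ t ∈ Metric.closedBall 0 r) {t : ℝ} (ht : 0 ≤ t) : γ t = φ (γ 0) t := by
  have hL : LipschitzWith K (fun z => F (clampSq r z)) := by
    have := hF.comp (lipschitzWith_clampSq r).lipschitzOnWith
      (fun z _ => clampSq_mem hr z : MapsTo (clampSq r) univ _)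
    rw [mul_one] at this
    exact lipschitzOnWith_univ.mp this
  refine ODE_solution_unique (v := fun _ z => F (clampSq r z)) (K := K) (a := 0) (b := t)
    (fun _ => hL) (fun s hs => (hγ s hs.1).continuousWithinAt.mono Icc_subset_Ici_self)
    (fun s hs => ?_) (h.continuous _).continuousOn (fun s _ => (h.deriv _ s).hasDerivWithinAt)
    (h.zero _).symm ⟨ht, le_rfl⟩
  have := (hγ s hs.1).mono (Ici_subset_Ici.mpr hs.1)
  rwa [clampSq_of_mem (hm s hs.1)]

/-- The exponential system in coordinates centred at a degenerate critical point on the unit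
circle. -/
noncomputable def saddleNodeField (z : ℝ × ℝ) : ℝ × ℝ :=
  (-2 * z.1 + (4 * z.2 ^ 2 - 4 * z.1 * z.2 - z.1 ^ 2) +
      z.1 * (10 * z.2 ^ 2 - 6 * z.1 * z.2 + z.1 ^ 2 / 2),
    8 * z.2 ^ 2 - 5 * z.1 * z.2 + z.1 ^ 2 / 2 +
      z.2 * (10 * z.2 ^ 2 - 6 * z.1 * z.2 + z.1 ^ 2 / 2))

namespace SaddleNode

/-- The defining function of the invariant unit circle. -/
noncomputable def circle (z : ℝ × ℝ) : ℝ := 4 * z.2 + 6 * z.2 ^ 2 - 2 * z.1 * z.2 + z.1 ^ 2 / 2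

/-- The growth rate of `circle` along trajectories. -/
noncomputable def rate (z : ℝ × ℝ) : ℝ :=
    2 * (4 * z.2 - 2 * z.1 + 10 * z.2 ^ 2 - 6 * z.1 * z.2 + z.1 ^ 2 / 2)

lemma contDiff_saddleNodeField : ContDiff ℝ 1 saddleNodeField := by
  unfold saddleNodeField
  fun_prop

lemma continuous_circle : Continuous circle := by unfold circle; fun_prop

lemma circle_zero : circle 0 = 0 := by simp [circle]

lemma hasStrictFDerivAt_saddleNodeField :
    HasStrictFDerivAt saddleNodeField (planarLinear (-2) 0 0 0) 0 := by
  have h := (contDiff_saddleNodeField.contDiffAt (x := 0)).hasStrictFDerivAt one_ne_zero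
  have h1 : HasFDerivAt (fun z : ℝ × ℝ => z.1) (ContinuousLinearMap.fst ℝ ℝ ℝ) (0 : ℝ × ℝ) :=
    hasFDerivAt_fst
  have h2 : HasFDerivAt (fun z : ℝ × ℝ => z.2) (ContinuousLinearMap.snd ℝ ℝ ℝ) (0 : ℝ × ℝ) :=
    hasFDerivAt_snd
  have h3 : HasFDerivAt saddleNodeField (planarLinear (-2) 0 0 0) 0 := by
    have hq := ((((h2.pow 2).const_mul 10).sub ((h1.const_mul 6).mul h2)).add
      ((h1.pow 2).mul_const (1 / 2)))
    have := (((h1.const_mul (-2)).add ((((h2.pow 2).const_mul 4).sub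
      ((h1.const_mul 4).mul h2)).sub (h1.pow 2))).add (h1.mul hq)).prodMk
      (((((h2.pow 2).const_mul 8).sub ((h1.const_mul 5).mul h2)).add
      ((h1.pow 2).mul_const (1 / 2))).add (h2.mul hq))
    convert! this using 1
    · funext z
      refine Prod.ext ?_ ?_ <;>
        simp only [saddleNodeField, Pi.add_apply, Pi.sub_apply, Pi.mul_apply] <;> ring
    · ext <;> simp
  rwa [h3.fderiv] at h

variable {z : ℝ × ℝ}

lemma steep_bounds (hc : |z.1| ≤ |z.2|) :
    z.1 ^ 2 ≤ z.2 ^ 2 ∧ -z.2 ^ 2 ≤ z.1 * z.2 ∧ z.1 * z.2 ≤ z.2 ^ 2 := by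
  have h := mul_le_mul_of_nonneg_right hc (abs_nonneg z.2)
  rw [← abs_mul, abs_mul_abs_self, abs_le] at h
  exact ⟨sq_le_sq.mpr hc, by nlinarith, by nlinarith⟩

lemma flat_bounds (hc : |z.2| ≤ |z.1|) :
    z.2 ^ 2 ≤ z.1 ^ 2 ∧ -z.1 ^ 2 ≤ z.1 * z.2 ∧ z.1 * z.2 ≤ z.1 ^ 2 := by
  have h := mul_le_mul_of_nonneg_right hc (abs_nonneg z.1)
  rw [← abs_mul, abs_mul_abs_self, abs_le] at h
  exact ⟨sq_le_sq.mpr hc, by nlinarith, by nlinarith⟩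

/-- In the steep cone the term `8 z.2²` dominates, so orbits rise: toward the point from below, away
from it above. -/
lemma sq_snd_le (hz : z ∈ Metric.closedBall (0 : ℝ × ℝ) (1 / 100)) (hc : |z.1| ≤ |z.2|) :
    z.2 ^ 2 ≤ (saddleNodeField z).2 := by
  obtain ⟨b1, b2, b3⟩ := steep_bounds hc
  rw [mem_closedBall_zero_prod, abs_le, abs_le] at hz
  simp only [saddleNodeField]
  have h1 : 0 ≤ (10 * z.2 ^ 2 - 6 * z.1 * z.2 + z.1 ^ 2 / 2) := by nlinarith
  have h2 := mul_le_mul_of_nonneg_right hz.2.1 h1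
  nlinarith [sq_nonneg z.1, sq_nonneg z.2]

/-- In the flat cone the linear contraction `-2 z.1` dominates. -/
lemma mul_fst_le (hz : z ∈ Metric.closedBall (0 : ℝ × ℝ) (1 / 100)) (hc : |z.2| ≤ |z.1|) :
    z.1 * (saddleNodeField z).1 ≤ -z.1 ^ 2 := by
  obtain ⟨b1, b2, b3⟩ := flat_bounds hc
  rw [mem_closedBall_zero_prod] at hz
  simp only [saddleNodeField]
  have h1 : |4 * z.2 ^ 2 - 4 * z.1 * z.2 - z.1 ^ 2| ≤ 9 * z.1 ^ 2 := by
    rw [abs_le]; constructor <;> nlinarith [sq_nonneg z.1, sq_nonneg z.2]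
  have h2 : z.1 * (4 * z.2 ^ 2 - 4 * z.1 * z.2 - z.1 ^ 2) ≤ 1 / 100 * (9 * z.1 ^ 2) := by
    refine (le_abs_self _).trans ?_
    rw [abs_mul]
    exact mul_le_mul hz.1 h1 (abs_nonneg _) (by norm_num)
  have h3 : 10 * z.2 ^ 2 - 6 * z.1 * z.2 + z.1 ^ 2 / 2 ≤ 1 / 100 := by
    nlinarith [sq_le_sq' (abs_le.mp hz.1).1 (abs_le.mp hz.1).2]
  nlinarith [mul_le_mul_of_nonneg_left h3 (sq_nonneg z.1)]

/-- Hence `z.2² - z.1²` increases on the diagonals, and the steep cone is forward invariant. -/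
lemma mul_fst_lt_mul_snd (hz : z ∈ Metric.closedBall (0 : ℝ × ℝ) (1 / 100)) (hne : z ≠ 0)
    (hc : z.2 ^ 2 = z.1 ^ 2) :
    z.1 * (saddleNodeField z).1 < z.2 * (saddleNodeField z).2 := by
  have habs : |z.2| = |z.1| := sq_eq_sq_iff_abs_eq_abs _ _ |>.mp hc
  have h1 := mul_fst_le hz habs.le
  have hpos : 0 < z.1 ^ 2 := by
    refine (sq_nonneg _).lt_of_ne' fun h => hne (Prod.ext ?_ ?_)
    · exact pow_eq_zero_iff two_ne_zero |>.mp h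
    · exact pow_eq_zero_iff two_ne_zero |>.mp (hc.trans h)
  obtain ⟨b1, b2, b3⟩ := flat_bounds habs.le
  rw [mem_closedBall_zero_prod] at hz
  simp only [saddleNodeField] at h1 ⊢
  have h2 : |8 * z.2 ^ 2 - 5 * z.1 * z.2 + z.1 ^ 2 / 2| ≤ 14 * z.1 ^ 2 := by
    rw [abs_le]; constructor <;> nlinarith
  have h3 : |z.2 * (8 * z.2 ^ 2 - 5 * z.1 * z.2 + z.1 ^ 2 / 2)| ≤ 1 / 100 * (14 * z.1 ^ 2) := by
    rw [abs_mul]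
    exact mul_le_mul hz.2 h2 (abs_nonneg _) (by norm_num)
  have h4 : 0 ≤ 10 * z.2 ^ 2 - 6 * z.1 * z.2 + z.1 ^ 2 / 2 := by nlinarith
  nlinarith [mul_nonneg (sq_nonneg z.2) h4, (abs_le.mp h3).1]

/-- The linear term `4 z.2` decides the sign in the steep cone, so the arcs of the circle lie in the
flat one. -/
lemma circle_pos (hc : |z.1| ≤ |z.2|)
    (h : 0 < z.2) : 0 < circle z := by
  obtain ⟨b1, b2, b3⟩ := steep_bounds hc
  unfold circle
  nlinarith [sq_nonneg z.1, sq_nonneg z.2]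

lemma circle_neg (hz : z ∈ Metric.closedBall (0 : ℝ × ℝ) (1 / 100)) (hc : |z.1| ≤ |z.2|)
    (h : z.2 < 0) : circle z < 0 := by
  obtain ⟨b1, b2, b3⟩ := steep_bounds hc
  rw [mem_closedBall_zero_prod, abs_le, abs_le] at hz
  unfold circle
  nlinarith [sq_nonneg z.1, sq_nonneg z.2]

/-- Growth along vertical lines makes the zero set a graph over the first coordinate. -/
lemma circle_lt {u v v' : ℝ} (h : (u, v) ∈ Metric.closedBall (0 : ℝ × ℝ) (1 / 100))
    (h' : (u, v') ∈ Metric.closedBall (0 : ℝ × ℝ) (1 / 100)) (hlt : v < v') :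
    circle (u, v) < circle (u, v') := by
  rw [mem_closedBall_zero_prod, abs_le, abs_le] at h h'
  simp only at h h'
  simp only [circle]
  nlinarith [mul_pos (sub_pos.mpr hlt) (show 0 < 4 + 6 * (v + v') - 2 * u by linarith)]

lemma rate_le (hz : z ∈ Metric.closedBall (0 : ℝ × ℝ) (1 / 100)) : |rate z| ≤ 1 := by
  rw [mem_closedBall_zero_prod, abs_le, abs_le] at hz
  unfold rate
  rw [abs_le]
  constructor <;> nlinarith [sq_nonneg z.1, sq_nonneg z.2, sq_nonneg (z.1 + z.2),
    sq_nonneg (z.1 - z.2)]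

/-- Since `|z.1|` decays exponentially along flat orbits, this lower bound for the rate is
integrable there. -/
lemma rate_ge (hz : z ∈ Metric.closedBall (0 : ℝ × ℝ) (1 / 100)) (hc : |z.2| ≤ |z.1|) :
    -(14 * |z.1|) ≤ rate z := by
  obtain ⟨b1, b2, b3⟩ := flat_bounds hc
  rw [mem_closedBall_zero_prod] at hz
  have h1 : z.1 ^ 2 ≤ 1 / 100 * |z.1| := by
    rw [← sq_abs, sq]; exact mul_le_mul_of_nonneg_right hz.1 (abs_nonneg _)
  unfold rate
  nlinarith [neg_abs_le z.2, le_abs_self z.1, sq_nonneg z.2, sq_nonneg z.1]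

lemma hasDerivAt_circle {γ : ℝ → ℝ × ℝ} {t : ℝ} (h : HasDerivAt γ (saddleNodeField (γ t)) t) :
    HasDerivAt (fun t => circle (γ t)) (circle (γ t) * rate (γ t)) t := by
  have h1 := hasDerivAt_fst h
  have h2 := hasDerivAt_snd h
  have h3 := (((h2.const_mul 4).add ((h2.pow 2).const_mul 6)).sub ((h1.const_mul 2).mul h2)).add
    ((h1.pow 2).div_const 2)
  convert! h3 using 1
  simp only [circle, rate, saddleNodeField]
  push_cast
  ring

section Flow

variable {r : ℝ} {φ : ℝ × ℝ → ℝ → ℝ × ℝ} {q : ℝ × ℝ}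

/-- The part of a square inside the unit disc is trapping. A flat exit point is excluded by the
horizontal contraction, a steep one below by the upward motion, and a steep one above by the sign of
`circle`. -/
lemma forall_mem_ball_of_circle_nonpos (hr : r ≤ 1 / 100) (hφ : IsCutoffFlow saddleNodeField r φ)
    {s : ℝ} (hs : s ≤ r) (hq : q ∈ Metric.ball 0 s) (hD : circle q ≤ 0) {t : ℝ} (ht : 0 ≤ t) :
    φ q t ∈ Metric.ball 0 s := by
  refine forall_mem_of_no_first_exit Metric.isOpen_ball (hφ.continuous q) (by rwa [hφ.zero])
    (fun T hT hin => ?_) t ht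
  have hcl : ∀ t, 0 ≤ t → t ≤ T → φ q t ∈ Metric.closedBall 0 s := fun t ht htT => by
    rcases htT.lt_or_eq with h | rfl
    · exact Metric.ball_subset_closedBall (hin t ht h)
    · exact hφ.mem_closedBall_of_forall_lt hT hin
  have hder : ∀ t, 0 ≤ t → t ≤ T → HasDerivAt (φ q) (saddleNodeField (φ q t)) t :=
    fun t ht htT => hφ.deriv_of_mem (Metric.closedBall_subset_closedBall hs (hcl t ht htT))
  have hsmall : ∀ {z : ℝ × ℝ}, z ∈ Metric.closedBall (0 : ℝ × ℝ) s →
      z ∈ Metric.closedBall (0 : ℝ × ℝ) (1 / 100) :=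
    fun h => Metric.closedBall_subset_closedBall (hs.trans hr) h
  have hDT : circle (φ q T) ≤ 0 := nonpos_of_hasDerivAt_mul
    (fun t h1 h2 => hasDerivAt_circle (hder t h1 h2))
    (fun t h1 h2 => rate_le (hsmall (hcl t h1 h2))) (by rwa [hφ.zero]) hT.le le_rfl
  have hT' := hcl T hT.le le_rfl
  have hd := hder T hT.le le_rfl
  set z := φ q T with hz
  have hspos : 0 < s := (norm_nonneg q).trans_lt (mem_ball_zero_iff.mp hq)
  rw [mem_ball_zero_prod]
  by_contra! hout
  have hz' := mem_closedBall_zero_prod.mp hT'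
  rcases le_or_gt |z.1| |z.2| with hc | hc
  · have h2 : |z.2| = s := by
      rcases hz'.1.lt_or_eq with h | h
      · exact le_antisymm hz'.2 (hout h)
      · exact le_antisymm hz'.2 (h ▸ hc)
    have hneg : z.2 < 0 := by
      rcases lt_trichotomy z.2 0 with h | h | h
      · exact h
      · rw [h, abs_zero] at h2; linarith
      · linarith [circle_pos hc h]
    rw [abs_of_neg hneg] at h2
    have h3 := nonneg_of_hasDerivAt_of_le hT (hasDerivAt_snd hd).neg fun t h1 h4 => by
      have := (abs_lt.mp (mem_ball_zero_prod.mp (hin t h1 h4)).2).1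
      simp only [Pi.neg_apply]
      linarith
    have h4 := sq_snd_le (hsmall hT') hc
    nlinarith
  · have h2 : |z.1| = s := le_antisymm hz'.1 (by
      by_contra! h
      linarith [hout h])
    have h3 := nonneg_of_hasDerivAt_of_le hT ((hasDerivAt_fst hd).pow 2) fun t h1 h4 => by
      have := (mem_ball_zero_prod.mp (hin t h1 h4)).1
      simp only [Pi.pow_apply]
      rw [← hz, sq_le_sq, h2]
      exact this.le
    have h4 := mul_fst_le (hsmall hT') hc.le
    have h5 : 0 < z.1 ^ 2 := by rw [← sq_abs, h2]; positivity
    push_cast at h3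
    nlinarith

lemma fst_bound (hr : r ≤ 1 / 100) (hφ : IsCutoffFlow saddleNodeField r φ)
    (hq : ∀ t, 0 ≤ t → φ q t ∈ Metric.closedBall 0 r)
    (hflat : ∀ t, 0 ≤ t → (φ q t).2 ^ 2 ≤ (φ q t).1 ^ 2) {t : ℝ} (ht : 0 ≤ t) :
    |(φ q t).1| ≤ |q.1| * Real.exp (-t) := by
  have anti := antitoneOn_of_hasDerivAt_nonpos (a := 0)
    (f := fun t => Real.exp (2 * t) * (φ q t).1 ^ 2)
    (fun t ht => hasDerivAt_exp_mul ((hφ.deriv_fst_of_mem (hq t ht)).pow 2)) (fun t ht => by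
      have h1 := mul_fst_le (Metric.closedBall_subset_closedBall hr (hq t ht))
        (sq_le_sq.mp (hflat t ht))
      refine mul_nonpos_of_nonneg_of_nonpos (Real.exp_pos _).le ?_
      push_cast
      nlinarith)
  have h1 := anti (mem_Ici.mpr le_rfl) ht ht
  simp only [hφ.zero, mul_zero, Real.exp_zero, one_mul] at h1
  refine abs_le_of_sq_le_sq ?_ (mul_nonneg (abs_nonneg _) (Real.exp_pos _).le)
  have h2 : (|q.1| * Real.exp (-t)) ^ 2 = q.1 ^ 2 / Real.exp (2 * t) := by
    rw [mul_pow, sq_abs, ← Real.exp_nat_mul, div_eq_mul_inv, ← Real.exp_neg]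
    congr 2
    push_cast
    ring
  rw [h2, le_div_iff₀ (Real.exp_pos _)]
  linarith

/-- A steep orbit remains steep. In the upper half its height would grow without bound, so an orbit
that stays must be in the lower half. -/
lemma neg_of_steep (hr : r ≤ 1 / 100) (hφ : IsCutoffFlow saddleNodeField r φ)
    (hq : ∀ t, 0 ≤ t → φ q t ∈ Metric.closedBall 0 r)
    (hne : ∀ t, 0 ≤ t → φ q t ≠ 0) {a : ℝ} (ha : 0 ≤ a)
    (hsteep : (φ q a).1 ^ 2 ≤ (φ q a).2 ^ 2) {t : ℝ} (ht : a < t) :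
    (φ q t).1 ^ 2 < (φ q t).2 ^ 2 ∧ (φ q t).2 < 0 := by
  have hcone : ∀ {t}, a < t → (φ q t).1 ^ 2 < (φ q t).2 ^ 2 := fun {t} ht => by
    have := pos_of_hasDerivAt_pos_at_zeros (a := a)
      (fun t h => ((hφ.deriv_snd_of_mem (hq t (ha.trans h))).pow 2).sub
        ((hφ.deriv_fst_of_mem (hq t (ha.trans h))).pow 2)) (by simpa using hsteep)
      (fun s hs h0 => ?_) ht
    · simpa using this
    · have := mul_fst_lt_mul_snd (Metric.closedBall_subset_closedBall hr (hq s (ha.trans hs)))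
        (hne s (ha.trans hs)) (by simpa [sub_eq_zero] using h0)
      push_cast
      nlinarith
  refine ⟨hcone ht, ?_⟩
  by_contra! hc
  have hder := fun s (hs : t ≤ s) => hφ.deriv_snd_of_mem (hq s (ha.trans (ht.le.trans hs)))
  have hge : ∀ s, t ≤ s → (φ q s).2 ^ 2 ≤ (saddleNodeField (φ q s)).2 := fun s hs =>
    sq_snd_le (Metric.closedBall_subset_closedBall hr (hq s (ha.trans (ht.le.trans hs))))
      (sq_le_sq.mp (hcone (ht.trans_le hs)).le)
  have hpos : 0 < (φ q t).2 := hc.lt_of_ne fun h => by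
    have := hcone ht
    rw [← h] at this
    nlinarith [sq_nonneg (φ q t).1]
  have mono := monotoneOn_of_hasDerivAt_nonneg hder fun s hs => (sq_nonneg _).trans (hge s hs)
  refine not_bddAbove_of_le_hasDerivAt (m := (φ q t).2 ^ 2) (M := r) (by positivity) hder
    (fun s hs => ?_) fun s hs =>
      (abs_le.mp (mem_closedBall_zero_prod.mp (hq s (ha.trans (ht.le.trans hs)))).2).2
  exact (pow_le_pow_left₀ hc (mono (mem_Ici.mpr le_rfl) hs hs) 2).trans (hge s hs)

/-- Either the orbit is flat forever and contracts exponentially, or it ends in the lower steep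
cone, where its depth is a Lyapunov function. -/
lemma tendsto_of_forall_mem (hr : r ≤ 1 / 100) (hφ : IsCutoffFlow saddleNodeField r φ)
    (hq : ∀ t, 0 ≤ t → φ q t ∈ Metric.closedBall 0 r)
    (hne : ∀ t, 0 ≤ t → φ q t ≠ 0) : Tendsto (φ q) atTop (𝓝 0) := by
  by_cases hflat : ∀ t, 0 ≤ t → (φ q t).2 ^ 2 ≤ (φ q t).1 ^ 2
  · have hlim : Tendsto (fun t => |q.1| * Real.exp (-t)) atTop (𝓝 0) := by
      simpa using (Real.tendsto_exp_neg_atTop_nhds_zero).const_mul |q.1|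
    have h1 : Tendsto (fun t => (φ q t).1) atTop (𝓝 0) := squeeze_zero_norm' (by
      filter_upwards [eventually_ge_atTop 0] with t ht
      exact fst_bound hr hφ hq hflat ht) hlim
    have h2 : Tendsto (fun t => (φ q t).2) atTop (𝓝 0) := squeeze_zero_norm' (by
      filter_upwards [eventually_ge_atTop 0] with t ht
      exact (sq_le_sq.mp (hflat t ht)).trans (fst_bound hr hφ hq hflat ht)) hlim
    exact h1.prodMk_nhds h2
  · push Not at hflat
    obtain ⟨a, ha, hsteep⟩ := hflat
    have hneg := fun {t} (ht : a + 1 ≤ t) => neg_of_steep hr hφ hq hne ha hsteep.le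
      (show a < t by linarith)
    have hge : ∀ t, a + 1 ≤ t → 0 ≤ t := fun t ht => by linarith
    have hlim := tendsto_zero_of_lyapunov (z := φ q) (a := a + 1) (W := fun z => -z.2)
      (w := fun z => -(saddleNodeField z).2)
      (S := Metric.closedBall 0 r ∩ {z | |z.1| ≤ |z.2| ∧ z.2 ≤ 0})
      ((isCompact_closedBall _ _).inter_right ((isClosed_le continuous_fst.abs
        continuous_snd.abs).inter (isClosed_le continuous_snd continuous_const)))
      (fun t ht => ⟨hq t (hge t ht), (sq_lt_sq.mp (hneg ht).1).le, (hneg ht).2.le⟩)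
      (fun t ht => (hφ.deriv_snd_of_mem (hq t (hge t ht))).neg) (by fun_prop)
      (by unfold saddleNodeField; fun_prop) (fun z hz => neg_nonneg.mpr hz.2.2)
      (fun z hz => ?_) fun z hz hpos => ?_
    · have h2 : Tendsto (fun t => (φ q t).2) atTop (𝓝 0) := by simpa using hlim.neg
      have h1 : Tendsto (fun t => (φ q t).1) atTop (𝓝 0) := squeeze_zero_norm' (by
        filter_upwards [eventually_ge_atTop (a + 1)] with t ht
        exact (sq_lt_sq.mp (hneg ht).1).le) (by simpa using h2.norm)
      exact h1.prodMk_nhds h2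
    · have := sq_snd_le (Metric.closedBall_subset_closedBall hr hz.1) hz.2.1
      linarith [sq_nonneg z.2]
    · have := sq_snd_le (Metric.closedBall_subset_closedBall hr hz.1) hz.2.1
      nlinarith

/-- An orbit with `circle > 0` cannot become steep, since in the lower steep cone `circle < 0`. If
it is flat it converges to the origin, so `circle` tends to zero; but the decay rate is integrable,
which keeps `circle` above a positive constant. -/
lemma circle_nonpos_of_forall_mem (hr : r ≤ 1 / 100) (hφ : IsCutoffFlow saddleNodeField r φ)
    (hq : ∀ t, 0 ≤ t → φ q t ∈ Metric.closedBall 0 r)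
    (hne : ∀ t, 0 ≤ t → φ q t ≠ 0) : circle q ≤ 0 := by
  by_contra! hpos
  have hder := fun t (ht : 0 ≤ t) => hasDerivAt_circle (hφ.deriv_of_mem (hq t ht))
  have hcircle : ∀ t, 0 ≤ t → 0 < circle (φ q t) := fun t ht => by
    refine forall_pos_of_ne_zero (continuous_circle.comp (hφ.continuous q)) (a := 0)
      (by simpa [hφ.zero] using hpos) (fun s hs => ?_) ht
    exact ne_zero_of_hasDerivAt_mul (T := s) (fun t ht _ => hder t ht)
      (fun t ht _ => rate_le (Metric.closedBall_subset_closedBall hr (hq t ht)))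
      (by simpa [hφ.zero] using hpos.ne') hs le_rfl
  by_cases hflat : ∀ t, 0 ≤ t → (φ q t).2 ^ 2 ≤ (φ q t).1 ^ 2
  -- The added exponential is the integrating factor for the bound `rate ≥ -14 |q.1| e^{-t}`.
  · have mono := monotoneOn_of_hasDerivAt_nonneg (a := 0)
      (fun t ht => (hder t ht).mul ((hasDerivAt_neg t).exp.const_mul (-14 * |q.1|)).exp)
      (fun t ht => by
        have h1 := rate_ge (Metric.closedBall_subset_closedBall hr (hq t ht))
          (sq_le_sq.mp (hflat t ht))
        have h2 := fst_bound hr hφ hq hflat ht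
        have h3 := mul_nonneg (hcircle t ht).le
          (show 0 ≤ rate (φ q t) + 14 * (|q.1| * Real.exp (-t)) by linarith)
        have h4 := mul_nonneg h3 (Real.exp_pos (-14 * |q.1| * Real.exp (-t))).le
        linarith)
    have hlim : Tendsto (fun t => circle (φ q t)) atTop (𝓝 0) := by
      have := (continuous_circle.tendsto 0).comp (tendsto_of_forall_mem hr hφ hq hne)
      rwa [circle_zero] at this
    have hle : ∀ t, 0 ≤ t → circle q * Real.exp (-14 * |q.1|) ≤ circle (φ q t) := fun t ht => by
      have h1 := mono (mem_Ici.mpr le_rfl) ht ht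
      simp only [Pi.mul_apply, hφ.zero, neg_zero, Real.exp_zero, mul_one] at h1
      refine h1.trans (mul_le_of_le_one_right (hcircle t ht).le (Real.exp_le_one_iff.mpr ?_))
      nlinarith [mul_nonneg (abs_nonneg q.1) (Real.exp_pos (-t)).le]
    have := ge_of_tendsto hlim (eventually_atTop.mpr ⟨0, hle⟩)
    linarith [mul_pos hpos (Real.exp_pos (-14 * |q.1|))]
  · push Not at hflat
    obtain ⟨a, ha, hsteep⟩ := hflat
    have h1 := neg_of_steep hr hφ hq hne ha hsteep.le (show a < a + 1 by linarith)
    have h2 := circle_neg (Metric.closedBall_subset_closedBall hr (hq (a + 1) (by linarith)))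
      (sq_lt_sq.mp h1.1).le h1.2
    linarith [hcircle (a + 1) (by linarith)]

end Flow

end SaddleNode

/-! ### The parabolic sector and its boundary arcs -/

namespace SaddleNode

lemma circle_eq_zero_unique {r : ℝ} (hr : r ≤ 1 / 100) {z z' : ℝ × ℝ}
    (hz : z ∈ Metric.closedBall (0 : ℝ × ℝ) r) (hz' : z' ∈ Metric.closedBall (0 : ℝ × ℝ) r)
    (hc : circle z = 0) (hc' : circle z' = 0) (h : z.1 = z'.1) : z = z' := by
  obtain ⟨u, v⟩ := z
  obtain ⟨u', v'⟩ := z'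
  obtain rfl : u = u' := h
  have hz := Metric.closedBall_subset_closedBall hr hz
  have hz' := Metric.closedBall_subset_closedBall hr hz'
  rcases lt_trichotomy v v' with hv | rfl | hv
  · linarith [circle_lt hz hz' hv]
  · rfl
  · linarith [circle_lt hz' hz hv]

lemma abs_snd_lt_of_circle_eq_zero {r : ℝ} (hr : r ≤ 1 / 100) {z : ℝ × ℝ}
    (hz : z ∈ Metric.closedBall (0 : ℝ × ℝ) r) (hc : circle z = 0) (hne : z ≠ 0) :
    |z.2| < |z.1| := by
  by_contra! h
  rcases lt_trichotomy z.2 0 with hv | hv | hv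
  · linarith [circle_neg (Metric.closedBall_subset_closedBall hr hz) h hv]
  · rw [hv, abs_zero] at h
    exact hne (Prod.ext (abs_nonpos_iff.mp h) hv)
  · linarith [circle_pos h hv]

/-- The arc of the circle on one side of the origin is a trajectory. -/
lemma exists_circle_branch {r : ℝ} (hr0 : 0 < r) (hr : r ≤ 1 / 100) {φ : ℝ × ℝ → ℝ → ℝ × ℝ}
    (hφ : IsCutoffFlow saddleNodeField r φ)
    (hne : ∀ {q : ℝ × ℝ}, q ≠ 0 → ∀ t, φ q t ≠ 0) {σ : ℝ} (hσ : σ = 1 ∨ σ = -1) :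
    ∃ γ, Approaches saddleNodeField γ 0 ∧
      (∀ t, 0 ≤ t → 0 < σ * (γ t).1 ∧ |(γ t).2| < |(γ t).1| ∧ circle (γ t) = 0) ∧
      ∀ q ∈ Metric.ball (0 : ℝ × ℝ) (r / 2), circle q = 0 → 0 < σ * q.1 → q ∈ halfOrbit γ := by
  have hσ2 : σ * σ = 1 := by rcases hσ with rfl | rfl <;> norm_num
  have hσabs : |σ| = 1 := by rcases hσ with rfl | rfl <;> norm_num
  have hus : |σ * (r / 2)| = r / 2 := by rw [abs_mul, hσabs, one_mul, abs_of_pos (by linarith)]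
  have hbox : ∀ v, |v| ≤ r / 2 → (σ * (r / 2), v) ∈ Metric.closedBall (0 : ℝ × ℝ) (1 / 100) :=
    fun v hv => mem_closedBall_zero_prod.mpr ⟨by rw [hus]; linarith, hv.trans (by linarith)⟩
  -- On the vertical line at `σ * (r / 2)` the function `circle` changes sign between the two
  -- diagonals, so an arc crosses it.
  obtain ⟨v, hv, hv0⟩ := intermediate_value_Icc (show -(r / 2) ≤ r / 2 by linarith)
    (f := fun v => circle (σ * (r / 2), v))
    (continuous_circle.comp (by fun_prop)).continuousOn (show (0 : ℝ) ∈ Icc _ _ from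
      ⟨(circle_neg (hbox _ (by rw [abs_neg, abs_of_pos (by linarith)]))
        (by simp only [hus, abs_neg]; exact le_abs_self _) (by simpa using hr0)).le,
      (circle_pos (by simp only [hus]; exact le_abs_self _) (by simpa using hr0)).le⟩)
  set p : ℝ × ℝ := (σ * (r / 2), v) with hp
  have hpne : p ≠ 0 := fun h => by
    have : σ * (r / 2) = 0 := congrArg Prod.fst h
    rw [this, abs_zero] at hus
    linarith
  have hpball : p ∈ Metric.ball (0 : ℝ × ℝ) r := mem_ball_zero_prod.mpr
    ⟨by simp only [hp, hus]; linarith, (abs_le.mpr hv).trans_lt (by linarith)⟩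
  have hm : ∀ t, 0 ≤ t → φ p t ∈ Metric.closedBall 0 r := fun t ht =>
    Metric.ball_subset_closedBall (forall_mem_ball_of_circle_nonpos hr hφ le_rfl hpball hv0.le ht)
  have hlim := tendsto_of_forall_mem hr hφ hm fun t _ => hne hpne t
  have hc : ∀ t, 0 ≤ t → circle (φ p t) = 0 := fun t ht =>
    eq_zero_of_hasDerivAt_mul (K := 1) (continuous_circle.comp (hφ.continuous p)).continuousOn
      (fun s hs _ => hasDerivAt_circle (hφ.deriv_of_mem (hm s hs)))
      (fun s hs _ => rate_le (Metric.closedBall_subset_closedBall hr (hm s hs)))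
      (by simpa [hφ.zero] using hv0) ht le_rfl
  have hflat := fun t (ht : 0 ≤ t) => abs_snd_lt_of_circle_eq_zero hr (hm t ht) (hc t ht)
    (hne hpne t)
  have hcont : Continuous fun t => σ * (φ p t).1 := continuous_const.mul (hφ.continuous _).fst
  have hstart : σ * (φ p 0).1 = r / 2 := by rw [hφ.zero, ← mul_assoc, hσ2, one_mul]
  refine ⟨φ p, ⟨hφ.isIntegralCurveOn hm, fun t _ => hne hpne t, hlim⟩,
    fun t ht => ⟨?_, hflat t ht, hc t ht⟩, fun q hq hq0 hpos => ?_⟩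
  · refine forall_pos_of_ne_zero hcont (by rw [hstart]; linarith) (fun s hs h => ?_) ht
    have h2 : (φ p s).1 = 0 := by rcases hσ with rfl | rfl <;> simpa using h
    have h3 := hflat s hs
    rw [h2, abs_zero] at h3
    exact absurd h3 (abs_nonneg _).not_gt
  · have hlim' : Tendsto (fun t => σ * (φ p t).1) atTop (𝓝 0) := by
      simpa using! ((continuous_fst.tendsto (0 : ℝ × ℝ)).comp hlim).const_mul σ
    obtain ⟨T, hT, hT0⟩ := ((hlim'.eventually_lt_const hpos).and (eventually_ge_atTop 0)).exists
    have hqb := mem_ball_zero_prod.mp hq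
    have hle : σ * q.1 ≤ r / 2 := by
      have := abs_lt.mp hqb.1
      rcases hσ with rfl | rfl <;> linarith
    obtain ⟨t, ht, hte⟩ := intermediate_value_Icc' hT0 hcont.continuousOn
      (show σ * q.1 ∈ Icc _ _ from ⟨hT.le, by rw [hstart]; exact hle⟩)
    refine ⟨t, ht.1, circle_eq_zero_unique hr (hm t ht.1) ?_ (hc t ht.1) hq0 ?_⟩
    · exact mem_closedBall_zero_prod.mpr ⟨by linarith, by linarith⟩
    · rcases hσ with rfl | rfl <;> simpa using hte

/-- Trapping gives one inclusion, `circle_nonpos_of_forall_mem` the other: locally the parabolic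
sector is the unit disc. -/
lemma localStableSet_eq {r : ℝ} (hr0 : 0 < r) (hr : r ≤ 1 / 100) {φ : ℝ × ℝ → ℝ → ℝ × ℝ}
    {K : NNReal}
    (hK : LipschitzOnWith K saddleNodeField (Metric.closedBall 0 r))
    (hφ : IsCutoffFlow saddleNodeField r φ)
    (hne : ∀ {q : ℝ × ℝ}, q ≠ 0 → ∀ t, φ q t ≠ 0) (hz : ∀ t, φ 0 t = 0) :
    localStableSet saddleNodeField (Metric.ball 0 (r / 2)) 0 =
      Metric.ball 0 (r / 2) ∩ {q | circle q ≤ 0} := by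
  have hsub : Metric.ball (0 : ℝ × ℝ) (r / 2) ⊆ Metric.closedBall 0 r :=
    Metric.ball_subset_closedBall.trans (Metric.closedBall_subset_closedBall (by linarith))
  ext q
  constructor
  · rintro ⟨γ, ⟨hγ, rfl⟩, hm, -⟩
    refine ⟨hm 0 le_rfl, ?_⟩
    by_cases h0 : γ 0 = 0
    · rw [h0]; exact circle_zero.le
    · refine circle_nonpos_of_forall_mem hr hφ (fun t ht => ?_) fun t _ => hne h0 t
      rw [← hφ.eqOn_of_isIntegralCurveOn hr0.le hK hγ (fun t ht => hsub (hm t ht)) ht]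
      exact hsub (hm t ht)
  · rintro ⟨hq, hc⟩
    have hm := fun t (ht : 0 ≤ t) =>
      forall_mem_ball_of_circle_nonpos hr hφ (show r / 2 ≤ r by linarith) hq hc ht
    have hm' := fun t (ht : 0 ≤ t) => hsub (hm t ht)
    refine ⟨φ q, ⟨hφ.isIntegralCurveOn hm', hφ.zero q⟩, hm, ?_⟩
    by_cases h0 : q = 0
    · simp only [h0, funext hz]
      exact tendsto_const_nhds
    · exact tendsto_of_forall_mem hr hφ hm' fun t _ => hne h0 t

lemma sublevel_subset_interior {s : ℝ} :
    Metric.ball (0 : ℝ × ℝ) s ∩ {q | circle q < 0} ⊆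
      interior (Metric.ball 0 s ∩ {q | circle q ≤ 0}) :=
  interior_maximal (inter_subset_inter_right _ fun q (hq : circle q < 0) => hq.le)
    (Metric.isOpen_ball.inter (isOpen_lt continuous_circle continuous_const))

lemma zero_mem_closure_interior {s : ℝ} (hs0 : 0 < s) (hs : s ≤ 1 / 100) :
    (0 : ℝ × ℝ) ∈ closure (interior (Metric.ball 0 s ∩ {q | circle q ≤ 0})) := by
  have hlim : Tendsto (fun v : ℝ => ((0, v) : ℝ × ℝ)) (𝓝[<] 0) (𝓝 0) :=
    ((by fun_prop : Continuous fun v : ℝ => ((0, v) : ℝ × ℝ)).tendsto 0).mono_left inf_le_left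
  refine mem_closure_of_tendsto hlim ?_
  filter_upwards [Ioo_mem_nhdsLT (show -s < 0 by linarith)] with v hv
  have hb : ((0, v) : ℝ × ℝ) ∈ Metric.ball 0 s :=
    mem_ball_zero_prod.mpr ⟨by simpa using hs0, abs_lt.mpr ⟨hv.1, hv.2.trans hs0⟩⟩
  exact sublevel_subset_interior ⟨hb, circle_neg (Metric.closedBall_subset_closedBall hs
    (Metric.ball_subset_closedBall hb)) (by simp) hv.2⟩

/-- By vertical monotonicity `circle` is positive directly above each of its zeros, so no zero is
interior to the sublevel set. -/
lemma ball_inter_frontier {s : ℝ} (hs : s ≤ 1 / 100) :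
    Metric.ball (0 : ℝ × ℝ) s ∩ frontier (Metric.ball 0 s ∩ {q | circle q ≤ 0}) =
      Metric.ball 0 s ∩ {q | circle q = 0} := by
  have hsub := (Metric.ball_subset_closedBall (x := (0 : ℝ × ℝ))).trans
    (Metric.closedBall_subset_closedBall hs)
  ext q
  refine and_congr_right fun hq => ⟨fun hf => ?_, fun hc : circle q = 0 => ?_⟩
  · have h1 : circle q ≤ 0 := closure_minimal inter_subset_right
      (isClosed_le continuous_circle continuous_const) hf.1
    exact h1.eq_of_not_lt fun h => hf.2 (sublevel_subset_interior ⟨hq, h⟩)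
  · refine ⟨subset_closure ⟨hq, hc.le⟩, fun hint => ?_⟩
    have hlim : Tendsto (fun v : ℝ => ((q.1, v) : ℝ × ℝ)) (𝓝[>] q.2) (𝓝 q) :=
      ((by fun_prop : Continuous fun v : ℝ => ((q.1, v) : ℝ × ℝ)).tendsto q.2).mono_left
        inf_le_left
    obtain ⟨v, hv, hv'⟩ := ((hlim.eventually (isOpen_interior.mem_nhds hint)).and
      self_mem_nhdsWithin).exists
    have h1 := interior_subset hv
    have h2 : circle (q.1, q.2) < circle (q.1, v) := circle_lt (hsub hq) (hsub h1.1) hv'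
    have h3 : circle (q.1, v) ≤ 0 := h1.2
    rw [Prod.mk.eta, hc] at h2
    linarith

end SaddleNode

-- The two arcs bound the parabolic sector. For the emanating orbit time is reversed: the linear
-- part becomes `diag (2, 0)`, so `IsConeExpanding` applies with vertical rate zero, and only the
-- upper vertical cone is attracted.
open SaddleNode in
theorem isAttractingSaddleNode_saddleNodeField : IsAttractingSaddleNode saddleNodeField 0 := by
  have h0 : saddleNodeField 0 = 0 := by simp [saddleNodeField]
  have hneg : HasStrictFDerivAt (-saddleNodeField) (planarLinear 2 0 0 0) 0 := by
    convert! hasStrictFDerivAt_saddleNodeField.neg using 1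
    ext <;> simp
  obtain ⟨r₀, hr₀, ⟨K', hK'⟩, happ⟩ := exists_square_approx hneg (ε := 1 / 2) (by norm_num)
  obtain ⟨r, hr0, hrr, hr⟩ : ∃ r, 0 < r ∧ r ≤ r₀ ∧ r ≤ 1 / 100 :=
    ⟨min r₀ (1 / 100), lt_min hr₀ (by norm_num), min_le_left _ _, min_le_right _ _⟩
  have hbr := Metric.closedBall_subset_closedBall (x := (0 : ℝ × ℝ)) hrr
  have hK' := hK'.mono hbr
  obtain ⟨K, hK⟩ := contDiff_saddleNodeField.contDiffOn.exists_lipschitzOnWith one_ne_zero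
    (convex_closedBall (0 : ℝ × ℝ) r) (isCompact_closedBall _ _)
  have hcone : IsConeExpanding (-saddleNodeField) r (2 - 2 * (1 / 2)) :=
    isConeExpanding_of_approx (d := 0) hr0 (by norm_num) le_rfl (by simp [h0]) ⟨K', hK'⟩
      fun z hz z' hz' => by simpa using happ z (hbr hz) z' (hbr hz')
  obtain ⟨φ, hφ⟩ := exists_isCutoffFlow hr0.le hK
  obtain ⟨ψ, hψ⟩ := exists_isCutoffFlow hr0.le hK'
  have hz : ∀ t, φ 0 t = 0 := zero_cutoffFlow hr0.le hK h0 hφ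
  have hne : ∀ {q : ℝ × ℝ}, q ≠ 0 → ∀ t, φ q t ≠ 0 := fun hq t h =>
    hq (hφ.injective (t := t) (by rw [h, hz]))
  have hsub : Metric.ball (0 : ℝ × ℝ) (r / 2) ⊆ Metric.closedBall 0 r :=
    Metric.ball_subset_closedBall.trans (Metric.closedBall_subset_closedBall (by linarith))
  have hin := fun {z : ℝ × ℝ} (h : z ∈ Metric.closedBall (0 : ℝ × ℝ) r) =>
    Metric.closedBall_subset_closedBall hr h
  obtain ⟨α, hα, hα', hα''⟩ := exists_circle_branch hr0 hr hφ hne (Or.inl rfl)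
  obtain ⟨β, hβ, hβ', hβ''⟩ := exists_circle_branch hr0 hr hφ hne (Or.inr rfl)
  obtain ⟨ω, hω, hω', hω''⟩ := hcone.exists_unique_approaching hψ (Or.inl rfl) fun z hz hc hpos => by
    rw [one_mul] at hc hpos ⊢
    have := sq_snd_le (hin hz) (hc.trans (le_abs_self _))
    simp only [Pi.neg_apply, Prod.snd_neg]
    nlinarith
  have hstable := localStableSet_eq hr0 hr hK hφ hne hz
  refine ⟨h0, α, β, ω, hα, hβ, hω, ?_, Metric.ball 0 (r / 2), Metric.isOpen_ball,
    Metric.mem_ball_self (by linarith), fun q hq hq0 => ?_, fun q hq => ?_, ?_, ?_⟩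
  · simp only [List.pairwise_cons, List.mem_cons, List.not_mem_nil, or_false, forall_eq_or_imp,
      forall_eq, false_imp_iff, implies_true, List.Pairwise.nil, and_true, Set.disjoint_left,
      halfOrbit]
    have hωs : ∀ t, 0 ≤ t → |(ω t).1| < |(ω t).2| := fun t ht =>
      (hω' t ht).trans_le (by rw [one_mul]; exact le_abs_self _)
    refine ⟨⟨?_, ?_⟩, ?_⟩ <;> rintro _ ⟨t, ht, rfl⟩ ⟨s, hs, he⟩
    · have h1 := (hα' t ht).1; have h2 := (hβ' s hs).1; rw [he] at h2; linarith
    · have h1 := (hα' t ht).2.1; have h2 := hωs s hs; rw [he] at h2; linarith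
    · have h1 := (hβ' t ht).2.1; have h2 := hωs s hs; rw [he] at h2; linarith
  · by_cases hst : ∀ t, 0 ≤ t → ψ q t ∈ Metric.ball 0 (r / 2)
    · left
      have hst' := fun t (ht : 0 ≤ t) => hsub (hst t ht)
      rcases lt_or_ge 0 q.2 with hpos | hneg
      · exact hω'' q hst' (by linarith)
      -- The reversed flow descends in the steep cone, so an orbit in the lower half would leave the
      -- square.
      · exfalso
        have hsteep := fun t (ht : 0 ≤ t) => hcone.sq_lt_sq_of_forall_mem hψ hst' hq0 ht
        have hv : ∀ t, 0 ≤ t → 0 < -(ψ q t).2 := fun t ht => by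
          have hnz : ∀ s, 0 ≤ s → -(ψ q s).2 ≠ 0 := fun s hs h => by
            have := hsteep s hs
            rw [neg_eq_zero.mp h] at this
            nlinarith [sq_nonneg (ψ q s).1]
          refine forall_pos_of_ne_zero (a := 0) (hψ.continuous q).snd.neg ?_ hnz ht
          exact lt_of_le_of_ne (by simpa [hψ.zero] using hneg) (hnz 0 le_rfl).symm
        have hder := fun t (ht : 0 ≤ t) => (hψ.deriv_snd_of_mem (hst' t ht)).neg
        have hge : ∀ t, 0 ≤ t → (ψ q t).2 ^ 2 ≤ -((-saddleNodeField) (ψ q t)).2 := fun t ht => by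
          simpa using sq_snd_le (hin (hst' t ht)) (sq_lt_sq.mp (hsteep t ht)).le
        have mono := monotoneOn_of_hasDerivAt_nonneg hder fun t ht =>
          (sq_nonneg _).trans (hge t ht)
        refine not_bddAbove_of_le_hasDerivAt (m := (ψ q 0).2 ^ 2) (M := r) ?_ hder
          (fun t ht => ?_) fun t ht => ?_
        · have := hv 0 le_rfl
          nlinarith
        · refine le_trans ?_ (hge t ht)
          rw [← neg_sq, ← neg_sq (ψ q t).2]
          exact pow_le_pow_left₀ (hv 0 le_rfl).le (mono (mem_Ici.mpr le_rfl) ht ht) 2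
        · have := (abs_le.mp (mem_closedBall_zero_prod.mp (hst' t ht)).2).1
          simp only [Pi.neg_apply]
          linarith
    · push Not at hst
      exact Or.inr (hψ.leaves Metric.isOpen_ball hsub hq hst)
  · by_cases hst : ∀ t, 0 ≤ t → φ q t ∈ Metric.ball 0 (r / 2)
    · left
      rw [hstable]
      refine ⟨hq, ?_⟩
      by_cases hq0 : q = 0
      · rw [hq0]; exact circle_zero.le
      · exact circle_nonpos_of_forall_mem hr hφ (fun t ht => hsub (hst t ht)) fun t _ => hne hq0 t
    · push Not at hst
      exact Or.inr (hφ.leaves Metric.isOpen_ball hsub hq hst)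
  · rw [hstable]
    exact zero_mem_closure_interior (by linarith) (by linarith)
  · rw [hstable, ball_inter_frontier (by linarith)]
    ext q
    refine and_congr_right fun hq => ⟨fun hc : circle q = 0 => ?_, ?_⟩
    · rcases lt_trichotomy q.1 0 with h | h | h
      · exact Or.inr (hβ'' q hq hc (by linarith))
      · refine Or.inl (Or.inl ?_)
        by_contra hq0
        have := abs_snd_lt_of_circle_eq_zero hr (hsub hq) hc hq0
        rw [h, abs_zero] at this
        exact absurd this (abs_nonneg _).not_gt
      · exact Or.inl (Or.inr (hα'' q hq hc (by linarith)))
    · rintro ((rfl | ⟨t, ht, rfl⟩) | ⟨t, ht, rfl⟩)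
      · exact circle_zero
      · exact (hα' t ht).2.2
      · exact (hβ' t ht).2.2

/-! ### Affine invariance of saddle-nodes -/

section Conjugation

variable {F : ℝ × ℝ → ℝ × ℝ} {p : ℝ × ℝ} {L : (ℝ × ℝ) ≃L[ℝ] (ℝ × ℝ)}

/-- The frontier condition requires the transported stable set exactly, hence the converse
inclusion, obtained by pulling trajectories back. -/
lemma localStableSet_affineHomeo {N : Set (ℝ × ℝ)} :
    localStableSet F (affineHomeo p L '' N) p =
      affineHomeo p L '' localStableSet (conjField F p L) N 0 := by
  refine Subset.antisymm ?_ localStableSet_image_subset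
  rintro q ⟨γ, ⟨hγ, h0⟩, hN, hlim⟩
  refine ⟨(affineHomeo p L).symm q, ⟨(affineHomeo p L).symm ∘ γ, ⟨fun t ht => ?_, ?_⟩,
    fun t ht => ?_, ?_⟩, (affineHomeo p L).apply_symm_apply q⟩
  · have h1 := L.symm.hasFDerivAt.comp_hasDerivWithinAt t ((hγ t ht).sub_const p)
    have h2 : conjField F p L (((affineHomeo p L).symm ∘ γ) t) = L.symm (F (γ t)) := by
      simp [conjField, affineHomeo_symm_apply]
    simp only [h2]
    convert! h1 using 1
    exact funext fun s => affineHomeo_symm_apply _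
  · simp [h0]
  · obtain ⟨z, hz, hze⟩ := hN t ht
    rwa [Function.comp_apply, ← hze, Homeomorph.symm_apply_apply]
  · have := ((affineHomeo p L).symm.continuous.tendsto p).comp hlim
    rwa [(affineHomeo p L).symm_apply_eq.mpr affineHomeo_zero.symm] at this

lemma ScalarFieldCosmology.IsAttractingSaddleNode.of_conjField
    (h : IsAttractingSaddleNode (conjField F p L) 0) : IsAttractingSaddleNode F p := by
  obtain ⟨h0, α, β, ω, hα, hβ, hω, hd, N, hN, hN0, h1, h2, h3, h4⟩ := h
  rw [← conjField_neg] at hω h1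
  refine ⟨conjField_zero_eq_zero_iff.mp h0, _, _, _, hα.affineHomeo, hβ.affineHomeo,
    hω.affineHomeo, ?_, affineHomeo p L '' N, (affineHomeo p L).isOpenMap _ hN,
    ⟨0, hN0, affineHomeo_zero⟩, ?_, ?_, ?_, ?_⟩
  · simp only [halfOrbit_affineHomeo]
    simp only [List.pairwise_cons, List.mem_cons, List.not_mem_nil, or_false, forall_eq_or_imp,
      forall_eq, false_imp_iff, implies_true, List.Pairwise.nil, and_true] at hd ⊢
    exact ⟨⟨disjoint_image_affineHomeo hd.1.1, disjoint_image_affineHomeo hd.1.2⟩,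
      disjoint_image_affineHomeo hd.2⟩
  · rintro _ ⟨q, hq, rfl⟩ hne
    refine (h1 q hq fun h => hne (by rw [h, affineHomeo_zero])).imp (fun h => ?_) fun h =>
      h.affineHomeo
    rw [halfOrbit_affineHomeo]
    exact mem_image_of_mem _ h
  · rintro _ ⟨q, hq, rfl⟩
    refine (h2 q hq).imp (fun h => ?_) fun h => h.affineHomeo
    rw [localStableSet_affineHomeo]
    exact mem_image_of_mem _ h
  · rw [localStableSet_affineHomeo, ← Homeomorph.image_interior, ← Homeomorph.image_closure]
    exact ⟨0, h3, affineHomeo_zero⟩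
  · rw [localStableSet_affineHomeo, ← Homeomorph.image_frontier, halfOrbit_affineHomeo,
      halfOrbit_affineHomeo, ← image_inter (affineHomeo p L).injective, h4,
      image_inter (affineHomeo p L).injective, image_union, image_union, image_singleton,
      affineHomeo_zero]

end Conjugation

/-! ### The exponential system -/

lemma contDiff_expSystem (ν : ℝ) {n : WithTop ℕ∞} : ContDiff ℝ n (expSystem ν) := by
  unfold expSystem
  fun_prop

lemma hasStrictFDerivAt_expSystem (ν x y : ℝ) :
    HasStrictFDerivAt (expSystem ν) (planarLinear (-2 - y ^ 2 + 6 * x ^ 2)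
      (2 * (√(3 / 2) * ν) * y - 2 * x * y) (-(√(3 / 2) * ν) * y + 4 * x * y)
      (1 - √(3 / 2) * ν * x + 2 * x ^ 2 - 3 * y ^ 2)) (x, y) := by
  have h := ((contDiff_expSystem ν (n := 1)).contDiffAt (x := (x, y))).hasStrictFDerivAt one_ne_zero
  have h1 : HasFDerivAt (fun z : ℝ × ℝ => z.1) (ContinuousLinearMap.fst ℝ ℝ ℝ) (x, y) :=
    hasFDerivAt_fst
  have h2 : HasFDerivAt (fun z : ℝ × ℝ => z.2) (ContinuousLinearMap.snd ℝ ℝ ℝ) (x, y) :=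
    hasFDerivAt_snd
  have h3 : HasFDerivAt (expSystem ν) (planarLinear (-2 - y ^ 2 + 6 * x ^ 2)
      (2 * (√(3 / 2) * ν) * y - 2 * x * y) (-(√(3 / 2) * ν) * y + 4 * x * y)
      (1 - √(3 / 2) * ν * x + 2 * x ^ 2 - 3 * y ^ 2)) (x, y) := by
    have := ((((h1.const_mul (-2)).add ((h2.pow 2).const_mul (√(3 / 2) * ν))).sub
      (h1.mul (h2.pow 2))).add ((h1.pow 3).const_mul 2)).prodMk
      (((h2.sub ((h1.const_mul (√(3 / 2) * ν)).mul h2)).add (((h1.pow 2).const_mul 2).mul h2)).sub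
      (h2.pow 3))
    convert! this using 1
    ext <;> simp <;> ring
  rwa [h3.fderiv] at h

lemma HasStrictFDerivAt.neg_planarLinear {F : ℝ × ℝ → ℝ × ℝ} {a b c d : ℝ} {p : ℝ × ℝ}
    (h : HasStrictFDerivAt F (planarLinear a b c d) p) :
    HasStrictFDerivAt (-F) (planarLinear (-a) (-b) (-c) (-d)) p := by
  convert! h.neg using 1
  ext <;> simp

lemma generalSystem_expPotential {V₀ : ℝ} (hV₀ : 0 < V₀) (ν φ : ℝ) (p : ℝ × ℝ) :
    generalSystem (expPotential V₀ ν) φ p = expSystem ν p := by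
  have hd : HasDerivAt (expPotential V₀ ν) (V₀ * (Real.exp (-(ν * φ)) * -(ν * 1))) φ :=
    (((hasDerivAt_id φ).const_mul ν).neg.exp).const_mul V₀
  have h : deriv (expPotential V₀ ν) φ / expPotential V₀ ν φ = -ν := by
    rw [hd.deriv, expPotential]
    field_simp
  simp only [generalSystem, expSystem, h]
  refine Prod.ext ?_ ?_ <;> simp only <;> ring

/-! ### Eigenvalues -/

/-- A monic quadratic is determined by the sum and product of its roots, which treats real, complex
and double eigenvalues alike. -/
lemma eigenvalues_eq {F : ℝ × ℝ → ℝ × ℝ} {p : ℝ × ℝ} {a b c d : ℝ}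
    (h : HasStrictFDerivAt F (planarLinear a b c d) p) {l₁ l₂ : ℂ} (htr : l₁ + l₂ = (a + d : ℝ))
    (hdet : l₁ * l₂ = (a * d - b * c : ℝ)) : eigenvalues F p = {l₁, l₂} := by
  have hM : LinearMap.toMatrix (Module.Basis.finTwoProd ℝ) (Module.Basis.finTwoProd ℝ)
      (planarLinear a b c d : ℝ × ℝ →ₗ[ℝ] ℝ × ℝ) = !![a, b; c, d] := by
    ext i j
    fin_cases i <;> fin_cases j <;> simp [LinearMap.toMatrix_apply]
  have hp : ((planarLinear a b c d : ℝ × ℝ →ₗ[ℝ] ℝ × ℝ).charpoly.map (algebraMap ℝ ℂ)) =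
      (Polynomial.X - Polynomial.C l₁) * (Polynomial.X - Polynomial.C l₂) := by
    rw [← LinearMap.charpoly_toMatrix _ (Module.Basis.finTwoProd ℝ), hM, Matrix.charpoly_fin_two,
      Matrix.trace_fin_two_of, Matrix.det_fin_two_of]
    simp only [Polynomial.map_add, Polynomial.map_sub, Polynomial.map_pow, Polynomial.map_X,
      Polynomial.map_mul, Polynomial.map_C, Complex.coe_algebraMap, ← htr, ← hdet]
    rw [Polynomial.C_add, Polynomial.C_mul]
    ring
  rw [eigenvalues, h.hasFDerivAt.fderiv, hp, Polynomial.roots_mul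
    (mul_ne_zero (Polynomial.X_sub_C_ne_zero _) (Polynomial.X_sub_C_ne_zero _)),
    Polynomial.roots_X_sub_C, Polynomial.roots_X_sub_C]
  rfl

/-! ### The coordinates of the critical points -/

lemma sq_sqrt_mul (ν : ℝ) : (√(3 / 2) * ν) ^ 2 = 3 / 2 * ν ^ 2 := by
  rw [mul_pow, Real.sq_sqrt (by norm_num)]

lemma sqrt_three_halves_mul (ν : ℝ) : √(3 / 2) * ν = 3 * (ν / √6) := by
  have h : √(3 / 2 : ℝ) = 3 / √6 := by
    rw [Real.sqrt_eq_iff_mul_self_eq (by norm_num) (by positivity), div_mul_div_comm,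
      Real.mul_self_sqrt (by norm_num)]
    norm_num
  rw [h]
  ring

lemma div_sqrt_six_sq (ν : ℝ) : (ν / √6) ^ 2 = ν ^ 2 / 6 := by
  rw [div_pow, Real.sq_sqrt (by norm_num)]

/-- Polynomial relations describe both points of the pair at once; `ν² ≤ 6` is exactly the
solvability of the second relation. -/
lemma circle_point_iff {ν : ℝ} {p : ℝ × ℝ} :
    (√(3 / 2) * ν = 3 * p.1 ∧ p.1 ^ 2 + p.2 ^ 2 = 1) ↔ ν ^ 2 ≤ 6 ∧ (p = P3 ν ∨ p = P4 ν) := by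
  have h6 := div_sqrt_six_sq ν
  obtain ⟨x, y⟩ := p
  simp only [P3, P4, Prod.mk.injEq, ← and_or_left, sqrt_three_halves_mul]
  constructor
  · rintro ⟨h1, h2⟩
    have hx : x = ν / √6 := by linarith
    have hy : y ^ 2 = 1 - ν ^ 2 / 6 := by rw [← h6, ← hx]; linarith
    have hle : 0 ≤ 1 - ν ^ 2 / 6 := hy ▸ sq_nonneg y
    refine ⟨by linarith, hx, sq_eq_sq_iff_eq_or_eq_neg.mp ?_⟩
    rw [hy, Real.sq_sqrt hle]
  · rintro ⟨h1, rfl, h2⟩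
    refine ⟨rfl, ?_⟩
    rw [sq_eq_sq_iff_eq_or_eq_neg.mpr h2, Real.sq_sqrt (by linarith), h6]
    ring

lemma scaling_point_iff {ν : ℝ} {p : ℝ × ℝ} :
    (√(3 / 2) * ν * p.1 = 1 ∧ p.2 ^ 2 = 2 * p.1 ^ 2) ↔ ν ≠ 0 ∧ (p = P5 ν ∨ p = P6 ν) := by
  obtain ⟨x, y⟩ := p
  have hs : √(3 / 2 : ℝ) * √(2 / 3) = 1 := by
    rw [← Real.sqrt_mul (by norm_num)]; norm_num
  have hs2 : √(2 / 3 : ℝ) ^ 2 = 2 / 3 := Real.sq_sqrt (by norm_num)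
  simp only [P5, P6, Prod.mk.injEq, ← and_or_left, ← sq_eq_sq_iff_eq_or_eq_neg]
  have hy : ν ≠ 0 → 2 * (1 / ν * √(2 / 3)) ^ 2 = (2 / (√3 * ν)) ^ 2 := fun h => by
    rw [mul_pow, hs2, div_pow, div_pow, mul_pow, Real.sq_sqrt (by norm_num)]
    field_simp
  constructor
  · rintro ⟨h1, h2⟩
    have hν : ν ≠ 0 := by rintro rfl; simp at h1
    have hx : x = 1 / ν * √(2 / 3) := by
      field_simp
      linear_combination √(2 / 3) * h1 - x * ν * hs
    exact ⟨hν, hx, by rw [h2, hx, hy hν]⟩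
  · rintro ⟨hν, rfl, h2⟩
    refine ⟨?_, by rw [h2, hy hν]⟩
    field_simp
    linarith

lemma expSystem_eq_zero_iff (ν : ℝ) (p : ℝ × ℝ) : expSystem ν p = 0 ↔
    p = P0 ∨ p = P1 ∨ p = P2 ∨ (ν ^ 2 ≤ 6 ∧ (p = P3 ν ∨ p = P4 ν)) ∨
      (ν ≠ 0 ∧ (p = P5 ν ∨ p = P6 ν)) := by
  rw [← circle_point_iff, ← scaling_point_iff]
  obtain ⟨x, y⟩ := p
  simp only [expSystem, P0, P1, P2, Prod.mk_eq_zero, Prod.mk.injEq]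
  set b := √(3 / 2) * ν
  constructor
  · rintro ⟨h1, h2⟩
    by_cases hy : y = 0
    · subst hy
      have : x * ((x - 1) * (x + 1)) = 0 := by linear_combination 1 / 2 * h1
      rcases mul_eq_zero.mp this with h | h
      · exact Or.inl ⟨h, rfl⟩
      · rcases mul_eq_zero.mp h with h | h
        · exact Or.inr (Or.inl ⟨by linarith, rfl⟩)
        · exact Or.inr (Or.inr (Or.inl ⟨by linarith, rfl⟩))
    · have h3 : 1 - b * x + 2 * x ^ 2 - y ^ 2 = 0 := by
        refine (mul_eq_zero.mp (?_ : y * _ = 0)).resolve_left hy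
        linear_combination h2
      -- Eliminating `y²` leaves one factor for the scaling points and one for the points on the
      -- circle.
      have h4 : (b * x - 1) * (3 * x - b) = 0 := by linear_combination h1 + (b - x) * h3
      rcases mul_eq_zero.mp h4 with h | h
      · exact Or.inr (Or.inr (Or.inr (Or.inr ⟨by linarith, by linarith⟩)))
      · refine Or.inr (Or.inr (Or.inr (Or.inl ⟨by linarith, ?_⟩)))
        linear_combination -h3 + x * h
  · rintro (⟨rfl, rfl⟩ | ⟨rfl, rfl⟩ | ⟨rfl, rfl⟩ | ⟨h1, h2⟩ | ⟨h1, h2⟩)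
    · norm_num
    · norm_num
    · norm_num
    · rw [h1]
      constructor
      · linear_combination 2 * x * h2
      · linear_combination -y * h2
    · constructor
      · linear_combination (b - x) * h2 + 2 * x * h1
      · linear_combination -y * h1 - y * h2

/-! ### The critical points on the axis -/

section Axis

variable {ν x : ℝ}

lemma expSystem_axis_eq_zero (hx : x ^ 2 = 1) : expSystem ν (x, 0) = 0 := by
  simp only [expSystem, Prod.mk_eq_zero]
  constructor
  · linear_combination 2 * x * hx
  · ring

lemma hasStrictFDerivAt_axis (hx : x ^ 2 = 1) :
    HasStrictFDerivAt (expSystem ν) (planarLinear 4 0 0 (3 - √(3 / 2) * ν * x)) (x, 0) := by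
  convert! hasStrictFDerivAt_expSystem ν x 0 using 2
  · linear_combination -6 * hx
  · ring
  · ring
  · linear_combination -2 * hx

lemma isUnstableNode_axis (hx : x ^ 2 = 1) (h : √(3 / 2) * ν * x < 3) :
    IsUnstableNode (expSystem ν) (x, 0) := by
  have hF := (hasStrictFDerivAt_axis (ν := ν) hx).neg_planarLinear
  have h0 : (-expSystem ν) (x, 0) = 0 := by
    rw [Pi.neg_apply, expSystem_axis_eq_zero hx, neg_zero]
  set μ := 3 - √(3 / 2) * ν * x with hμ
  have hpos : 0 < μ := by linarith
  -- Which eigenvalue is the slow one depends on `ν`; equality gives a double eigenvalue.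
  rcases lt_trichotomy 4 μ with h4 | h4 | h4
  · exact isStableNode_of_distinct hF h0 (u := (1, 0)) (w := (0, 1)) (a := 4) (d := μ) (by simp)
      (by simp) (by simp) (by norm_num) h4
  · exact isStableNode_of_double (contDiff_expSystem ν).neg hF h0 (u := (1, 0)) (w := (0, 1))
      (a := 4) (ε := 0) (by simp) (by simp) (by simp [← h4]) (by norm_num) (by norm_num)
  · exact isStableNode_of_distinct hF h0 (u := (0, 1)) (w := (1, 0)) (a := μ) (d := 4) (by simp)
      (by simp) (by simp) hpos h4

/-- The frame `(x, 0)`, `(0, 1)` reflects the case `x = -1` onto `x = 1`, with parameter `β = √(3/2)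
ν x`. -/
lemma isSaddle_axis (hx : x ^ 2 = 1) (h : 3 ≤ √(3 / 2) * ν * x) :
    IsSaddle (expSystem ν) (x, 0) := by
  have hdet : ((x, 0) : ℝ × ℝ).1 * ((0, 1) : ℝ × ℝ).2 - ((x, 0) : ℝ × ℝ).2 * ((0, 1) : ℝ × ℝ).1 ≠
      0 := by
    simp only [mul_one, mul_zero, sub_zero]
    rintro rfl
    norm_num at hx
  have hc : conjField (expSystem ν) (x, 0) (basisEquiv (x, 0) (0, 1) hdet) =
      axisField (√(3 / 2) * ν * x) := by
    funext z
    rw [conjField, ContinuousLinearEquiv.symm_apply_eq]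
    simp only [basisEquiv_apply, expSystem, axisField, Prod.smul_mk, Prod.mk_add_mk, smul_eq_mul,
      Prod.mk.injEq]
    constructor
    · linear_combination (-√(3 / 2) * ν * z.2 ^ 2 + 2 * x * (1 + z.1) ^ 3) * hx
    · linear_combination (2 * (1 + z.1) ^ 2 * z.2) * hx
  exact IsSaddle.of_conjField (hc ▸ isSaddle_axisField h)

end Axis

/-! ### The critical points on the unit circle -/

section Circle

variable {ν x y : ℝ}

lemma expSystem_circle_eq_zero (hb : √(3 / 2) * ν = 3 * x) (hxy : x ^ 2 + y ^ 2 = 1) :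
    expSystem ν (x, y) = 0 := by
  simp only [expSystem, hb, Prod.mk_eq_zero]
  constructor
  · linear_combination 2 * x * hxy
  · linear_combination -y * hxy

lemma hasStrictFDerivAt_circle (hb : √(3 / 2) * ν = 3 * x) (hxy : x ^ 2 + y ^ 2 = 1) :
    HasStrictFDerivAt (expSystem ν) (planarLinear (-3 + 7 * x ^ 2) (4 * x * y) (x * y) (-2 * y ^ 2))
      (x, y) := by
  convert! hasStrictFDerivAt_expSystem ν x y using 2
  · linear_combination hxy
  · rw [hb]; ring
  · rw [hb]; ring
  · rw [hb]; linear_combination hxy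

/-- One eigenvector is the tangent `(-y, x)` of the invariant circle. -/
lemma circle_eigenvectors (hxy : x ^ 2 + y ^ 2 = 1) :
    planarLinear (-3 + 7 * x ^ 2) (4 * x * y) (x * y) (-2 * y ^ 2) (-y, x) =
      (-(3 * y ^ 2)) • (-y, x) ∧
    planarLinear (-3 + 7 * x ^ 2) (4 * x * y) (x * y) (-2 * y ^ 2) (4 * x, y) =
      (-(2 - 6 * x ^ 2)) • (4 * x, y) := by
  simp only [planarLinear_apply, Prod.smul_mk, smul_eq_mul, Prod.mk.injEq]
  refine ⟨⟨?_, ?_⟩, ?_, ?_⟩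
  · linear_combination -3 * y * hxy
  · ring
  · linear_combination 4 * x * hxy
  · linear_combination -2 * y * hxy

lemma isStableNode_circle (hb : √(3 / 2) * ν = 3 * x) (hxy : x ^ 2 + y ^ 2 = 1)
    (hx : x ^ 2 < 1 / 3) : IsStableNode (expSystem ν) (x, y) :=
  isStableNode_of_distinct (hasStrictFDerivAt_circle hb hxy) (expSystem_circle_eq_zero hb hxy)
    (u := (4 * x, y)) (w := (-y, x)) (by simp only; nlinarith)
    (circle_eigenvectors hxy).2 (circle_eigenvectors hxy).1 (by linarith) (by nlinarith)

lemma isSaddle_circle (hb : √(3 / 2) * ν = 3 * x) (hxy : x ^ 2 + y ^ 2 = 1)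
    (hx : 1 / 3 < x ^ 2) : IsSaddle (expSystem ν) (x, y) := by
  -- At `y = 0` the eigenvalue `-3 y²` vanishes, but the point then lies on the axis and is covered
  -- there.
  by_cases hy : y = 0
  · subst hy
    have hx1 : x ^ 2 = 1 := by linarith
    exact isSaddle_axis hx1 (by rw [hb]; linarith)
  · have : 0 < y ^ 2 := by positivity
    exact isSaddle_of_hasStrictFDerivAt (hasStrictFDerivAt_circle hb hxy)
      (expSystem_circle_eq_zero hb hxy) (u := (4 * x, y)) (w := (-y, x)) (by simp only; nlinarith)
      (circle_eigenvectors hxy).2 (circle_eigenvectors hxy).1 (by linarith) (by linarith)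

/-- Scaling the eigenvectors by the coordinates of the point itself cancels the signs of `x` and
`y`, so a single model field serves all cases. -/
lemma isSaddleNode_circle (hb : √(3 / 2) * ν = 3 * x) (hx : x ^ 2 = 1 / 3) (hy : y ^ 2 = 2 / 3) :
    IsSaddleNode (expSystem ν) (x, y) := by
  have hdet : ((-x, y / 2) : ℝ × ℝ).1 * ((4 * x, y) : ℝ × ℝ).2 -
      ((-x, y / 2) : ℝ × ℝ).2 * ((4 * x, y) : ℝ × ℝ).1 ≠ 0 := fun h => by
    simp only at h
    have : x * y = 0 := by linarith
    rcases mul_eq_zero.mp this with rfl | rfl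
    · norm_num at hx
    · norm_num at hy
  have hc : conjField (expSystem ν) (x, y) (basisEquiv (-x, y / 2) (4 * x, y) hdet) =
      saddleNodeField := by
    funext z
    rw [conjField, ContinuousLinearEquiv.symm_apply_eq]
    simp only [basisEquiv_apply, expSystem, saddleNodeField, Prod.smul_mk, Prod.mk_add_mk,
      smul_eq_mul, hb, Prod.mk.injEq]
    constructor
    · linear_combination (2 * x * (1 - z.1 + 4 * z.2) ^ 3) * hx +
        (3 * x * (1 + z.1 / 2 + z.2) ^ 2 - x * (1 - z.1 + 4 * z.2) * (1 + z.1 / 2 + z.2) ^ 2) * hy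
    · linear_combination (-3 * y * (1 - z.1 + 4 * z.2) * (1 + z.1 / 2 + z.2) +
        2 * y * (1 - z.1 + 4 * z.2) ^ 2 * (1 + z.1 / 2 + z.2)) * hx -
        y * (1 + z.1 / 2 + z.2) ^ 3 * hy
  exact Or.inl (IsAttractingSaddleNode.of_conjField (hc ▸ isAttractingSaddleNode_saddleNodeField))

end Circle

/-! ### The scaling critical points -/

section Scaling

variable {ν x y : ℝ}

lemma expSystem_scaling_eq_zero (hb : √(3 / 2) * ν * x = 1) (hy : y ^ 2 = 2 * x ^ 2) :
    expSystem ν (x, y) = 0 := by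
  simp only [expSystem, Prod.mk_eq_zero]
  constructor
  · linear_combination (√(3 / 2) * ν - x) * hy + 2 * x * hb
  · linear_combination -y * hb - y * hy

/-- The Jacobian at a scaling critical point. -/
noncomputable def scalingJacobian (b x y : ℝ) : ℝ × ℝ →L[ℝ] ℝ × ℝ :=
  planarLinear (-2 + 4 * x ^ 2) (2 * y * (b - x)) (y * (4 * x - b)) (-4 * x ^ 2)

lemma hasStrictFDerivAt_scaling (hb : √(3 / 2) * ν * x = 1) (hy : y ^ 2 = 2 * x ^ 2) :
    HasStrictFDerivAt (expSystem ν) (scalingJacobian (√(3 / 2) * ν) x y) (x, y) := by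
  convert! hasStrictFDerivAt_expSystem ν x y using 1
  rw [scalingJacobian]
  congr 1
  · linear_combination hy
  · ring
  · ring
  · linear_combination hb + 3 * hy

lemma scaling_det {b : ℝ} (hb : b * x = 1) (hy : y ^ 2 = 2 * x ^ 2) :
    (-2 + 4 * x ^ 2) * (-4 * x ^ 2) - 2 * y * (b - x) * (y * (4 * x - b)) = 4 - 12 * x ^ 2 := by
  linear_combination (-2 * (b - x) * (4 * x - b)) * hy + (-20 * x ^ 2 + 4 * b * x + 4) * hb

/-- Trace `-2` and determinant `4 - 12 x²` give the eigenvalues `-1 ± s`. For a matrix with lower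
row `(C, D)` an eigenvector for `l` is `(l - D, C)`; either root `s` is allowed. -/
lemma scaling_eigenvector {b s : ℝ} (hb : b * x = 1) (hy : y ^ 2 = 2 * x ^ 2)
    (hs : s ^ 2 = 12 * x ^ 2 - 3) :
    scalingJacobian b x y (-1 + s + 4 * x ^ 2, y * (4 * x - b)) =
      (-1 + s) • (-1 + s + 4 * x ^ 2, y * (4 * x - b)) := by
  have hd := scaling_det hb hy
  simp only [scalingJacobian, planarLinear_apply, Prod.smul_mk, smul_eq_mul, Prod.mk.injEq]
  constructor
  · linear_combination -hd - hs
  · ring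

lemma scaling_basis {b s : ℝ} (hb : b * x = 1) (hy : y ^ 2 = 2 * x ^ 2)
    (hs : s ≠ 0) (hx : 4 * x ^ 2 ≠ 1) :
    (-1 + s + 4 * x ^ 2) * (y * (4 * x - b)) - y * (4 * x - b) * (-1 + -s + 4 * x ^ 2) ≠ 0 := by
  have hx0 : x ≠ 0 := by rintro rfl; simp at hb
  have hy0 : y ≠ 0 := by
    rintro rfl
    have : 0 < x ^ 2 := by positivity
    norm_num at hy
    exact hx0 hy
  have h4 : 4 * x - b ≠ 0 := fun h => hx (by linear_combination x * h + hb)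
  have : (-1 + s + 4 * x ^ 2) * (y * (4 * x - b)) - y * (4 * x - b) * (-1 + -s + 4 * x ^ 2) =
      2 * s * (y * (4 * x - b)) := by ring
  rw [this]
  exact mul_ne_zero (mul_ne_zero two_ne_zero hs) (mul_ne_zero hy0 h4)

lemma isSaddle_scaling (hb : √(3 / 2) * ν * x = 1) (hy : y ^ 2 = 2 * x ^ 2)
    (hx : 1 / 3 < x ^ 2) : IsSaddle (expSystem ν) (x, y) := by
  have hs := Real.sq_sqrt (show 0 ≤ 12 * x ^ 2 - 3 by linarith)
  have h1 : 1 < √(12 * x ^ 2 - 3) := by rw [Real.lt_sqrt zero_le_one]; linarith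
  exact isSaddle_of_hasStrictFDerivAt (hasStrictFDerivAt_scaling hb hy)
    (expSystem_scaling_eq_zero hb hy) (scaling_basis hb hy (by linarith) (by linarith))
    (scaling_eigenvector hb hy hs) (scaling_eigenvector hb hy (by rw [neg_sq, hs]))
    (by linarith) (by linarith)

lemma isStableNode_scaling (hb : √(3 / 2) * ν * x = 1) (hy : y ^ 2 = 2 * x ^ 2)
    (hx : 1 / 4 ≤ x ^ 2) (hx' : x ^ 2 < 1 / 3) : IsStableNode (expSystem ν) (x, y) := by
  rcases hx.lt_or_eq with hlt | heq
  · have hs := Real.sq_sqrt (show 0 ≤ 12 * x ^ 2 - 3 by linarith)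
    have h1 : √(12 * x ^ 2 - 3) < 1 := by rw [Real.sqrt_lt' one_pos]; linarith
    have h2 : 0 < √(12 * x ^ 2 - 3) := Real.sqrt_pos.mpr (by linarith)
    refine isStableNode_of_distinct (a := 1 - √(12 * x ^ 2 - 3)) (d := 1 + √(12 * x ^ 2 - 3))
      (u := (-1 + √(12 * x ^ 2 - 3) + 4 * x ^ 2, y * (4 * x - √(3 / 2) * ν)))
      (w := (-1 + -√(12 * x ^ 2 - 3) + 4 * x ^ 2, y * (4 * x - √(3 / 2) * ν)))
      (hasStrictFDerivAt_scaling hb hy) (expSystem_scaling_eq_zero hb hy)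
      (scaling_basis hb hy h2.ne' (by linarith)) ?_ ?_ (by linarith) (by linarith)
    · rw [scaling_eigenvector hb hy hs]; congr 1; ring
    · rw [scaling_eigenvector hb hy (s := -√(12 * x ^ 2 - 3)) (by rw [neg_sq, hs])]; congr 1; ring
  -- At `x² = 1/4` the eigenvalue `-1` is double, with a nontrivial Jordan block. The factor `10` in
  -- `u` shrinks the off-diagonal entry to `1 / 10`, as `isStableNode_of_double` requires.
  · have hx0 : x ≠ 0 := by rintro rfl; norm_num at heq
    have hbx : √(3 / 2) * ν = 4 * x := mul_right_cancel₀ hx0 (by linear_combination hb + 4 * heq)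
    have hy0 : y ≠ 0 := by rintro rfl; linarith
    have hF := hasStrictFDerivAt_scaling hb hy
    rw [hbx, scalingJacobian] at hF
    refine isStableNode_of_double (u := (10 * (6 * x * y), 0)) (w := (0, 1)) (a := 1) (ε := 1 / 10)
      (contDiff_expSystem ν) hF (expSystem_scaling_eq_zero hb hy) ?_ ?_ ?_ one_pos ?_
    · simp [hx0, hy0]
    · simp only [planarLinear_apply, ← heq, Prod.smul_mk, smul_eq_mul, Prod.mk.injEq]
      constructor <;> ring
    · simp only [planarLinear_apply, ← heq, Prod.smul_mk, smul_eq_mul, Prod.mk_add_mk,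
        Prod.mk.injEq]
      constructor <;> ring
    · norm_num [abs_of_pos]

/-- The trace is `-2` and the discriminant `48 x² - 12`. -/
lemma isSpiralSink_scaling (hb : √(3 / 2) * ν * x = 1) (hy : y ^ 2 = 2 * x ^ 2)
    (hx : x ^ 2 < 1 / 4) : IsSpiralSink (expSystem ν) (x, y) := by
  have hd := scaling_det hb hy
  refine isSpiralSink_of_hasStrictFDerivAt (hasStrictFDerivAt_scaling hb hy)
    (expSystem_scaling_eq_zero hb hy) (by linarith) (by nlinarith)

/-- Translates the thresholds `2` and `8/3` for `ν²` into `1/3` and `1/4` for `x²`. -/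
lemma scaling_sq (hb : √(3 / 2) * ν * x = 1) : 3 * ν ^ 2 * x ^ 2 = 2 := by
  have h := congrArg (· ^ 2) hb
  simp only [mul_pow, Real.sq_sqrt (show (0 : ℝ) ≤ 3 / 2 by norm_num)] at h
  linarith

end Scaling

/-! ### Center manifold expansions -/

lemma isBigO_pow_of_le {f : ℝ → ℝ} {m n : ℕ} (hf : f =O[𝓝 0] fun s : ℝ => s ^ m) (h : n ≤ m) :
    f =O[𝓝 0] fun s : ℝ => s ^ n := by
  refine hf.trans ?_
  have h1 : (fun s : ℝ => s ^ (m - n)) =O[𝓝 0] fun _ => (1 : ℝ) :=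
    (by fun_prop : Continuous fun s : ℝ => s ^ (m - n)).continuousAt.isBigO_one ℝ
  simpa [← pow_add, Nat.add_sub_cancel' h] using (isBigO_refl (fun s : ℝ => s ^ n) (𝓝 0)).mul h1

lemma isBigO_mul_pow {f g : ℝ → ℝ} {m n : ℕ} (hf : f =O[𝓝 0] fun s : ℝ => s ^ m)
    (hg : g =O[𝓝 0] fun s : ℝ => s ^ n) : (fun s => f s * g s) =O[𝓝 0] fun s : ℝ => s ^ (m + n) := by
  simpa [pow_add] using hf.mul hg

lemma isBigO_deriv {h : ℝ → ℝ} (hC : ContDiffAt ℝ 2 h 0) (h1 : deriv h 0 = 0) :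
    deriv h =O[𝓝 0] fun s : ℝ => s ^ 1 := by
  have hd : DifferentiableAt ℝ (deriv h) 0 := by
    have := ((hC.fderiv_right (m := 1) (by norm_num)).differentiableAt one_ne_zero).clm_apply
      (differentiableAt_const (1 : ℝ))
    simpa only [fderiv_apply_one_eq_deriv] using this
  simpa [h1] using hd.isBigO_sub

/-- The mean value inequality on `[-|s|, |s|]`, where the derivative is `O(|s|)`. -/
lemma isBigO_sq_of_deriv {h : ℝ → ℝ} (hC : ContDiffAt ℝ 2 h 0) (h0 : h 0 = 0) (h1 : deriv h 0 = 0) :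
    h =O[𝓝 0] fun s : ℝ => s ^ 2 := by
  obtain ⟨C, hC0⟩ := (isBigO_deriv hC h1).bound
  have hdiff : ∀ᶠ s in 𝓝 (0 : ℝ), DifferentiableAt ℝ h s := by
    filter_upwards [hC.eventually (by simp)] with s hs
    exact hs.differentiableAt (by simp)
  obtain ⟨δ, hδ, hb⟩ := Metric.eventually_nhds_iff_ball.mp (hC0.and hdiff)
  refine IsBigO.of_bound (max C 0) ?_
  filter_upwards [Metric.ball_mem_nhds 0 hδ] with s hs
  have hsub : ∀ t ∈ Metric.closedBall (0 : ℝ) |s|, t ∈ Metric.ball (0 : ℝ) δ := fun t ht => by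
    rw [mem_ball_zero_iff] at hs ⊢
    exact (mem_closedBall_zero_iff.mp ht).trans_lt hs
  have hCs : ∀ t ∈ Metric.closedBall (0 : ℝ) |s|, ‖deriv h t‖ ≤ max C 0 * |s| := fun t ht => by
    refine (hb t (hsub t ht)).1.trans ?_
    rw [pow_one]
    exact mul_le_mul (le_max_left _ _) (mem_closedBall_zero_iff.mp ht) (norm_nonneg _)
      (le_max_right _ _)
  have := (convex_closedBall (0 : ℝ) |s|).norm_image_sub_le_of_norm_deriv_le
    (fun t ht => (hb t (hsub t ht)).2) hCs (Metric.mem_closedBall_self (abs_nonneg s))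
    (mem_closedBall_zero_iff.mpr (Real.norm_eq_abs s).le)
  rw [h0, sub_zero, sub_zero, Real.norm_eq_abs s, mul_assoc, ← sq] at this
  rwa [norm_pow, Real.norm_eq_abs s]

/-- One component of the invariance equation expresses `g` through `h`; the other reads `4 h = -2 σ
s² + O(s³)`, because `g h'` and the nonlinear terms in `h` are of higher order. Substitution gives
`g`. -/
theorem hasCenterExpansion_axis {ν σ : ℝ} (hσ : σ ^ 2 = 1) (hb : √(3 / 2) * ν = 3 * σ) :
    HasCenterExpansion (expSystem ν) (σ, 0) (1, 0) (0, 1) 4 (-σ / 2) (-3 / 2) 3 := by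
  have hF := (hasStrictFDerivAt_axis (ν := ν) hσ).hasFDerivAt.fderiv
  refine ⟨by simp, by simp, by norm_num, by simp [hF], ?_, fun h g hM => ?_⟩
  · rw [hF, hb]
    simp only [planarLinear_apply, Prod.mk_eq_zero]
    constructor
    · ring
    · linear_combination -3 * hσ
  obtain ⟨hC, h0, h1, hM⟩ := hM
  have H := isBigO_sq_of_deriv hC h0 h1
  have H' := isBigO_deriv hC h1
  have S : ∀ n : ℕ, (fun s : ℝ => s ^ n) =O[𝓝 0] fun s : ℝ => s ^ n := fun n => isBigO_refl _ _
  have eqs : ∀ᶠ s in 𝓝 (0 : ℝ), g s = s * (σ * h s + 2 * h s ^ 2 - s ^ 2) ∧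
      4 * h s + 2 * σ * s ^ 2 + 6 * σ * h s ^ 2 + 2 * h s ^ 3 - h s * s ^ 2 =
        g s * deriv h s := by
    filter_upwards [hM] with s hs
    simp only [expSystem, hb, Prod.smul_mk, Prod.mk_add_mk, smul_eq_mul, Prod.mk.injEq] at hs
    obtain ⟨e1, e2⟩ := hs
    constructor
    · linear_combination -e2 - s * hσ
    · linear_combination e1 + (-2 * σ - 6 * h s) * hσ
  have H2 : (fun s => h s * h s) =O[𝓝 0] fun s : ℝ => s ^ 4 := isBigO_mul_pow H H
  have G : g =O[𝓝 0] fun s : ℝ => s ^ 3 := by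
    have : (fun s => s ^ 1 * (σ * h s + 2 * (h s * h s) - s ^ 2)) =O[𝓝 0] fun s : ℝ => s ^ (1 + 2) :=
      isBigO_mul_pow (S 1) (((H.const_mul_left σ).add
        ((isBigO_pow_of_le H2 (by norm_num)).const_mul_left 2)).sub (S 2))
    refine this.congr' ?_ EventuallyEq.rfl
    filter_upwards [eqs] with s hs
    rw [hs.1]
    ring
  have E : (fun s => h s - -σ / 2 * s ^ 2) =O[𝓝 0] fun s : ℝ => s ^ 3 := by
    have := (((isBigO_pow_of_le (isBigO_mul_pow G H') (show 3 ≤ 3 + 1 by norm_num)).sub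
      ((isBigO_pow_of_le H2 (show 3 ≤ 4 by norm_num)).const_mul_left (6 * σ))).sub
      ((isBigO_pow_of_le (isBigO_mul_pow H2 H) (show 3 ≤ 4 + 2 by norm_num)).const_mul_left 2)).add
      (isBigO_pow_of_le (isBigO_mul_pow H (S 2)) (show 3 ≤ 2 + 2 by norm_num))
    refine (this.const_mul_left (1 / 4)).congr' ?_ EventuallyEq.rfl
    filter_upwards [eqs] with s hs
    linear_combination -1 / 4 * hs.2
  refine ⟨E, ?_⟩
  have := isBigO_mul_pow (S 1) ((E.const_mul_left σ).add
    ((isBigO_pow_of_le H2 (show 3 ≤ 4 by norm_num)).const_mul_left 2))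
  refine this.congr' ?_ EventuallyEq.rfl
  filter_upwards [eqs] with s hs
  linear_combination -hs.1 + 1 / 2 * s ^ 3 * hσ

/-- With `U = k h`, `V = k s` and `k = 1 / y`, the coordinates `x` and `y` factor out of the two
components, so one computation serves all signs. -/
theorem hasCenterExpansion_circle {ν x y k : ℝ} (hb : √(3 / 2) * ν = 3 * x) (hx : x ^ 2 = 1 / 3)
    (hy : y ^ 2 = 2 / 3) (hk : k * y = 1) :
    HasCenterExpansion (expSystem ν) (x, y) (-2 * x * k, 1) (4 * x * k, 1) (-2) k (8 * k) 2 := by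
  have hF := (hasStrictFDerivAt_circle hb (by linarith : x ^ 2 + y ^ 2 = 1)).hasFDerivAt.fderiv
  have hx0 : x ≠ 0 := by rintro rfl; norm_num at hx
  have hy0 : y ≠ 0 := by rintro rfl; norm_num at hy
  have hk0 : k ≠ 0 := by rintro rfl; norm_num at hk
  have hyk : y = 2 / 3 * k := by linear_combination k * hy - y * hk
  refine ⟨by simp, by simp, by norm_num, ?_, ?_, fun h g hM => ?_⟩
  · simp only [hF, planarLinear_apply, Prod.smul_mk, smul_eq_mul, Prod.mk.injEq]
    constructor
    · linear_combination -14 * x * k * hx + 4 * x * hyk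
    · linear_combination -2 * x ^ 2 * hk - 2 * hx - 2 * hy
  · simp only [hF, planarLinear_apply, Prod.mk_eq_zero]
    constructor
    · linear_combination 28 * x * k * hx + 4 * x * hyk
    · linear_combination 4 * x ^ 2 * hk + 4 * hx - 2 * hy
  obtain ⟨hC, h0, h1, hM⟩ := hM
  have H := isBigO_sq_of_deriv hC h0 h1
  have H' := isBigO_deriv hC h1
  have S : ∀ n : ℕ, (fun s : ℝ => s ^ n) =O[𝓝 0] fun s : ℝ => s ^ n := fun n => isBigO_refl _ _
  set Q : ℝ → ℝ := fun s => k ^ 2 * (10 * s ^ 2 - 12 * (h s * s ^ 1) + 2 * (h s * h s)) with hQ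
  have eqs : ∀ᶠ s in 𝓝 (0 : ℝ),
      g s = 8 * k * s ^ 2 - 10 * k * h s * s + 2 * k * h s ^ 2 + s * Q s ∧
      -2 * h s + 2 * k * s ^ 2 - 4 * k * h s * s - 2 * k * h s ^ 2 + h s * Q s =
        g s * deriv h s := by
    filter_upwards [hM] with s hs
    simp only [expSystem, hb, Prod.smul_mk, Prod.mk_add_mk, smul_eq_mul, Prod.mk.injEq] at hs
    obtain ⟨e1, e2⟩ := hs
    set d := deriv h s
    set U := k * h s with hU
    set V := k * s with hV
    have p1 : x + h s * (-2 * x * k) + s * (4 * x * k) = x * (1 - 2 * U + 4 * V) := by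
      rw [hU, hV]; ring
    have p2 : y + h s * 1 + s * 1 = y * (1 + U + V) := by
      linear_combination -(h s + s) * hk
    rw [p1, p2] at e1 e2
    have f1 : -2 * (1 - 2 * U + 4 * V) + 2 * (1 + U + V) ^ 2 -
        2 / 3 * (1 - 2 * U + 4 * V) * (1 + U + V) ^ 2 + 2 / 3 * (1 - 2 * U + 4 * V) ^ 3 =
        g s * k * (-2 * d + 4) := by
      refine mul_left_cancel₀ hx0 ?_
      linear_combination e1 - 2 * x * (1 - 2 * U + 4 * V) ^ 3 * hx -
        (3 * x * (1 + U + V) ^ 2 - x * (1 - 2 * U + 4 * V) * (1 + U + V) ^ 2) * hy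
    have f2 : (1 + U + V) * (1 - (1 - 2 * U + 4 * V) + 2 / 3 * (1 - 2 * U + 4 * V) ^ 2 -
        2 / 3 * (1 + U + V) ^ 2) = g s * k * (d + 1) := by
      refine mul_left_cancel₀ hy0 ?_
      linear_combination e2 + (3 * y * (1 - 2 * U + 4 * V) * (1 + U + V) -
        2 * y * (1 - 2 * U + 4 * V) ^ 2 * (1 + U + V)) * hx + y * (1 + U + V) ^ 3 * hy -
        g s * (d + 1) * hk
    -- Up to a factor, `f1 + 2 f2` isolates `g` and `f1 - 4 f2` isolates `g h'`.
    constructor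
    · refine mul_left_cancel₀ hk0 ?_
      rw [hU, hV] at f1 f2
      simp only [hQ]
      linear_combination -1 / 6 * f1 - 1 / 3 * f2
    · refine mul_left_cancel₀ hk0 ?_
      rw [hU, hV] at f1 f2
      simp only [hQ]
      linear_combination -1 / 6 * f1 + 2 / 3 * f2
  have H2 : (fun s => h s * h s) =O[𝓝 0] fun s : ℝ => s ^ 4 := isBigO_mul_pow H H
  have HS : (fun s => h s * s ^ 1) =O[𝓝 0] fun s : ℝ => s ^ 3 := isBigO_mul_pow H (S 1)
  have Q2 : Q =O[𝓝 0] fun s : ℝ => s ^ 2 :=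
    ((((S 2).const_mul_left 10).sub ((isBigO_pow_of_le HS (by norm_num)).const_mul_left 12)).add
      ((isBigO_pow_of_le H2 (by norm_num)).const_mul_left 2)).const_mul_left _
  have E' : (fun s => g s - 8 * k * s ^ 2) =O[𝓝 0] fun s : ℝ => s ^ 3 := by
    have := ((HS.const_mul_left (-10 * k)).add
      ((isBigO_pow_of_le H2 (show 3 ≤ 4 by norm_num)).const_mul_left (2 * k))).add
      (isBigO_mul_pow (S 1) Q2)
    refine this.congr' ?_ EventuallyEq.rfl
    filter_upwards [eqs] with s hs
    linear_combination -hs.1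
  have G : g =O[𝓝 0] fun s : ℝ => s ^ 2 := by
    simpa using (isBigO_pow_of_le E' (show 2 ≤ 3 by norm_num)).add ((S 2).const_mul_left (8 * k))
  refine ⟨?_, E'⟩
  have := (((HS.const_mul_left (-4 * k)).sub
    ((isBigO_pow_of_le H2 (show 3 ≤ 4 by norm_num)).const_mul_left (2 * k))).add
    (isBigO_pow_of_le (isBigO_mul_pow H Q2) (show 3 ≤ 2 + 2 by norm_num))).sub
    (isBigO_mul_pow G H')
  refine (this.const_mul_left (1 / 2)).congr' ?_ EventuallyEq.rfl
  filter_upwards [eqs] with s hs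
  linear_combination 1 / 2 * hs.2

/-! ### The main theorem -/

lemma circle_sq {ν x : ℝ} (hb : √(3 / 2) * ν = 3 * x) : x ^ 2 = ν ^ 2 / 6 := by
  have h := sq_sqrt_mul ν
  rw [hb] at h
  linarith

lemma eigenvalues_axis {ν x : ℝ} (hx : x ^ 2 = 1) :
    eigenvalues (expSystem ν) (x, 0) = {4, ((3 - √(3 / 2) * ν * x : ℝ) : ℂ)} :=
  eigenvalues_eq (hasStrictFDerivAt_axis hx) (by push_cast; ring) (by push_cast; ring)

lemma eigenvalues_circle {ν : ℝ} {p : ℝ × ℝ} (hb : √(3 / 2) * ν = 3 * p.1)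
    (hp : p.1 ^ 2 + p.2 ^ 2 = 1) : eigenvalues (expSystem ν) p =
      {((-2 + ν ^ 2 : ℝ) : ℂ), ((1 / 2 * (ν ^ 2 - 6) : ℝ) : ℂ)} := by
  have hx := circle_sq hb
  have hy : p.2 ^ 2 = 1 - ν ^ 2 / 6 := by linarith
  refine eigenvalues_eq (hasStrictFDerivAt_circle hb hp) ?_ ?_
  · rw [← Complex.ofReal_add, hx, hy]
    congr 1
    ring
  · rw [← Complex.ofReal_mul, show 4 * p.1 * p.2 * (p.1 * p.2) = 4 * p.1 ^ 2 * p.2 ^ 2 by ring, hx, hy]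
    congr 1
    ring

/-- Any complex square root `s` will do: changing its sign only permutes the two eigenvalues. -/
lemma eigenvalues_scaling {ν : ℝ} {p : ℝ × ℝ} (hν : ν ≠ 0) (hb : √(3 / 2) * ν * p.1 = 1)
    (hp : p.2 ^ 2 = 2 * p.1 ^ 2) {s : ℂ} (hs : s ^ 2 = (((8 - 3 * ν ^ 2) * ν ^ 2 : ℝ) : ℂ)) :
    eigenvalues (expSystem ν) p =
      {(-(ν : ℂ) ^ 2 + s) / (ν : ℂ) ^ 2, (-(ν : ℂ) ^ 2 - s) / (ν : ℂ) ^ 2} := by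
  have hν' : (ν : ℂ) ≠ 0 := Complex.ofReal_ne_zero.mpr hν
  refine eigenvalues_eq (hasStrictFDerivAt_scaling hb hp) ?_ ?_
  · push_cast
    field_simp
    ring
  · rw [scaling_det hb hp]
    have hx : (3 : ℂ) * ν ^ 2 * p.1 ^ 2 = 2 := by exact_mod_cast scaling_sq hb
    push_cast at hs ⊢
    field_simp
    linear_combination -hs + 4 * (ν : ℂ) ^ 2 * hx

theorem mainTheorem2 (V₀ ν : ℝ) (hV₀ : 0 < V₀) :
    -- the exponential potential turns the general equations into the autonomous planar system
    (∀ φ p, generalSystem (expPotential V₀ ν) φ p = expSystem ν p) ∧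
    -- the critical points
    (∀ p, expSystem ν p = 0 ↔
      p = P0 ∨ p = P1 ∨ p = P2 ∨ (ν ^ 2 ≤ 6 ∧ (p = P3 ν ∨ p = P4 ν)) ∨
        (ν ≠ 0 ∧ (p = P5 ν ∨ p = P6 ν))) ∧
    -- the eigenvalues
    eigenvalues (expSystem ν) P0 = {-2, 1} ∧
    eigenvalues (expSystem ν) P1 = {4, ((3 - √(3 / 2) * ν : ℝ) : ℂ)} ∧
    eigenvalues (expSystem ν) P2 = {4, ((3 + √(3 / 2) * ν : ℝ) : ℂ)} ∧
    (ν ^ 2 ≤ 6 →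
      eigenvalues (expSystem ν) (P3 ν) =
        {((-2 + ν ^ 2 : ℝ) : ℂ), ((1 / 2 * (ν ^ 2 - 6) : ℝ) : ℂ)} ∧
      eigenvalues (expSystem ν) (P4 ν) =
        {((-2 + ν ^ 2 : ℝ) : ℂ), ((1 / 2 * (ν ^ 2 - 6) : ℝ) : ℂ)}) ∧
    (ν ≠ 0 → ∀ s : ℂ, s ^ 2 = (((8 - 3 * ν ^ 2) * ν ^ 2 : ℝ) : ℂ) →
      eigenvalues (expSystem ν) (P5 ν) =
        {(-(ν : ℂ) ^ 2 + s) / (ν : ℂ) ^ 2, (-(ν : ℂ) ^ 2 - s) / (ν : ℂ) ^ 2} ∧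
      eigenvalues (expSystem ν) (P6 ν) =
        {(-(ν : ℂ) ^ 2 + s) / (ν : ℂ) ^ 2, (-(ν : ℂ) ^ 2 - s) / (ν : ℂ) ^ 2}) ∧
    -- the nature of the critical points
    IsSaddle (expSystem ν) P0 ∧
    (ν < √6 → IsUnstableNode (expSystem ν) P1) ∧
    (√6 ≤ ν → IsSaddle (expSystem ν) P1) ∧
    (-√6 < ν → IsUnstableNode (expSystem ν) P2) ∧
    (ν ≤ -√6 → IsSaddle (expSystem ν) P2) ∧
    (ν ^ 2 < 2 → IsStableNode (expSystem ν) (P3 ν) ∧ IsStableNode (expSystem ν) (P4 ν)) ∧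
    (ν ^ 2 = 2 → IsSaddleNode (expSystem ν) (P3 ν) ∧ IsSaddleNode (expSystem ν) (P4 ν)) ∧
    (2 < ν ^ 2 → ν ^ 2 ≤ 6 → IsSaddle (expSystem ν) (P3 ν) ∧ IsSaddle (expSystem ν) (P4 ν)) ∧
    (ν ≠ 0 → ν ^ 2 < 2 → IsSaddle (expSystem ν) (P5 ν) ∧ IsSaddle (expSystem ν) (P6 ν)) ∧
    (ν ^ 2 = 2 → IsSaddleNode (expSystem ν) (P5 ν) ∧ IsSaddleNode (expSystem ν) (P6 ν)) ∧
    (2 < ν ^ 2 → ν ^ 2 ≤ 8 / 3 →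
      IsStableNode (expSystem ν) (P5 ν) ∧ IsStableNode (expSystem ν) (P6 ν)) ∧
    (8 / 3 < ν ^ 2 → IsSpiralSink (expSystem ν) (P5 ν) ∧ IsSpiralSink (expSystem ν) (P6 ν)) ∧
    -- center manifold expansions at the non-hyperbolic parameter values
    (ν = √6 → HasCenterExpansion (expSystem ν) P1 (1, 0) (0, 1) 4 (-1 / 2) (-3 / 2) 3) ∧
    (ν = -√6 → HasCenterExpansion (expSystem ν) P2 (1, 0) (0, 1) 4 (1 / 2) (-3 / 2) 3) ∧
    (ν ^ 2 = 2 →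
      HasCenterExpansion (expSystem ν) (P3 ν) (-ν, 1) (2 * ν, 1) (-2) √(3 / 2) (4 * √6) 2 ∧
      HasCenterExpansion (expSystem ν) (P4 ν) (ν, 1) (-2 * ν, 1) (-2) (-√(3 / 2)) (-4 * √6) 2) := by
  have circ : ∀ {p : ℝ × ℝ}, ν ^ 2 ≤ 6 → (p = P3 ν ∨ p = P4 ν) →
      √(3 / 2) * ν = 3 * p.1 ∧ p.1 ^ 2 + p.2 ^ 2 = 1 := fun h hp => circle_point_iff.mpr ⟨h, hp⟩
  have scal : ∀ {p : ℝ × ℝ}, ν ≠ 0 → (p = P5 ν ∨ p = P6 ν) →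
      √(3 / 2) * ν * p.1 = 1 ∧ p.2 ^ 2 = 2 * p.1 ^ 2 := fun h hp => scaling_point_iff.mpr ⟨h, hp⟩
  -- The members of a pair satisfy the same polynomial relations, so each claim is proved once for
  -- both.
  have both : ∀ {Q : ℝ × ℝ → Prop} {q q' : ℝ × ℝ}, (∀ p, (p = q ∨ p = q') → Q p) → Q q ∧ Q q' :=
    fun h => ⟨h _ (Or.inl rfl), h _ (Or.inr rfl)⟩
  have h6 : (0 : ℝ) < √6 := by positivity
  have hb := sqrt_three_halves_mul ν
  have hone : ((1 : ℝ)) ^ 2 = 1 := one_pow 2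
  have hneg : ((-1 : ℝ)) ^ 2 = 1 := by norm_num
  have ne_of_sq : ν ^ 2 = 2 → ν ≠ 0 := fun h h0 => by rw [h0] at h; norm_num at h
  have hsx : ∀ {x : ℝ}, √(3 / 2) * ν * x = 1 → 3 * ν ^ 2 * x ^ 2 = 2 := scaling_sq
  refine ⟨generalSystem_expPotential hV₀ ν, expSystem_eq_zero_iff ν, ?_, ?_, ?_, ?_, ?_, ?_, ?_, ?_,
    ?_, ?_, ?_, ?_, ?_, ?_, ?_, ?_, ?_, ?_, ?_, ?_⟩
  · exact eigenvalues_eq (hasStrictFDerivAt_expSystem ν 0 0) (by push_cast; ring)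
      (by push_cast; ring)
  · simpa using! eigenvalues_axis (ν := ν) hone
  · simpa using! eigenvalues_axis (ν := ν) hneg
  · exact fun h => both fun p hp => eigenvalues_circle (circ h hp).1 (circ h hp).2
  · exact fun h s hs => both fun p hp => eigenvalues_scaling h (scal h hp).1 (scal h hp).2 hs
  · exact isSaddle_of_hasStrictFDerivAt (hasStrictFDerivAt_expSystem ν 0 0)
      ((expSystem_eq_zero_iff ν _).mpr (Or.inl rfl)) (u := (0, 1)) (w := (1, 0)) (a := 1) (d := -2)
      (by simp) (by simp) (by simp) one_pos (by norm_num)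
  · intro h
    have := (div_lt_one h6).mpr h
    exact isUnstableNode_axis hone (by linarith)
  · intro h
    have := (one_le_div h6).mpr h
    exact isSaddle_axis hone (by linarith)
  · intro h
    have : -1 < ν / √6 := by rw [lt_div_iff₀ h6]; linarith
    exact isUnstableNode_axis hneg (by linarith)
  · intro h
    have : ν / √6 ≤ -1 := by rw [div_le_iff₀ h6]; linarith
    exact isSaddle_axis hneg (by linarith)
  · refine fun h => both fun p hp => ?_
    obtain ⟨h1, h2⟩ := circ (by linarith) hp
    exact isStableNode_circle h1 h2 (by linarith [circle_sq h1])
  · refine fun h => both fun p hp => ?_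
    obtain ⟨h1, h2⟩ := circ (by linarith) hp
    exact isSaddleNode_circle h1 (by linarith [circle_sq h1]) (by linarith [circle_sq h1])
  · refine fun h h' => both fun p hp => ?_
    obtain ⟨h1, h2⟩ := circ h' hp
    exact isSaddle_circle h1 h2 (by linarith [circle_sq h1])
  · refine fun h h' => both fun p hp => ?_
    obtain ⟨h1, h2⟩ := scal h hp
    have h3 := hsx h1
    have h4 : 0 < ν ^ 2 := by positivity
    exact isSaddle_scaling h1 h2 (by nlinarith)
  -- At `ν² = 2` the scaling points lie on the circle, so the saddle-node result for circle points
  -- applies.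
  · refine fun h => both fun p hp => ?_
    obtain ⟨h1, h2⟩ := scal (ne_of_sq h) hp
    have h3 := hsx h1
    rw [h] at h3
    have h4 : p.1 ^ 2 = 1 / 3 := by linarith
    have h5 : p.1 ≠ 0 := fun h0 => by rw [h0] at h4; norm_num at h4
    exact isSaddleNode_circle (mul_right_cancel₀ h5 (by linear_combination h1 - 3 * h4)) h4
      (by linarith)
  · refine fun h h' => both fun p hp => ?_
    have hν : ν ≠ 0 := fun h0 => by rw [h0] at h; norm_num at h
    obtain ⟨h1, h2⟩ := scal hν hp
    have h3 := hsx h1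
    exact isStableNode_scaling h1 h2 (by nlinarith) (by nlinarith)
  · refine fun h => both fun p hp => ?_
    have hν : ν ≠ 0 := fun h0 => by rw [h0] at h; norm_num at h
    obtain ⟨h1, h2⟩ := scal hν hp
    have h3 := hsx h1
    exact isSpiralSink_scaling h1 h2 (by nlinarith)
  · intro h
    simpa using! hasCenterExpansion_axis (ν := ν) hone (by rw [hb, h, div_self h6.ne'])
  · intro h
    simpa using! hasCenterExpansion_axis (ν := ν) hneg (by rw [hb, h, neg_div, div_self h6.ne'])
  · intro h
    have hk : √(3 / 2 : ℝ) ^ 2 = 3 / 2 := Real.sq_sqrt (by norm_num)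
    have hs : √6 = 2 * √(3 / 2) := by
      rw [Real.sqrt_eq_iff_mul_self_eq (by norm_num) (by positivity)]
      linear_combination -4 * hk
    have hy : √(3 / 2) * √(1 - ν ^ 2 / 6) = 1 := by
      rw [← Real.sqrt_mul (by norm_num), h]
      norm_num
    have hy2 : √(1 - ν ^ 2 / 6) ^ 2 = 2 / 3 := by
      rw [Real.sq_sqrt (by rw [h]; norm_num), h]
      norm_num
    have hx : (ν / √6) ^ 2 = 1 / 3 := by rw [div_sqrt_six_sq, h]; norm_num
    have hxk : 2 * (ν / √6) * √(3 / 2) = ν := by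
      rw [mul_comm 2, mul_assoc, ← hs, div_mul_cancel₀ _ h6.ne']
    have e3 := hasCenterExpansion_circle (k := √(3 / 2)) hb hx hy2 hy
    -- For `P4` the signs of `y` and `k` change together, which preserves `k * y = 1`.
    have e4 := hasCenterExpansion_circle (y := -√(1 - ν ^ 2 / 6)) (k := -√(3 / 2)) hb hx
      (by rw [neg_sq, hy2]) (by rw [neg_mul_neg, hy])
    rw [show -2 * (ν / √6) * √(3 / 2) = -ν by linear_combination -hxk,
      show 4 * (ν / √6) * √(3 / 2) = 2 * ν by linear_combination 2 * hxk,
      show 8 * √(3 / 2) = 4 * √6 by rw [hs]; ring] at e3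
    rw [show -2 * (ν / √6) * -√(3 / 2) = ν by linear_combination hxk,
      show 4 * (ν / √6) * -√(3 / 2) = -2 * ν by linear_combination -2 * hxk,
      show 8 * -√(3 / 2) = -4 * √6 by rw [hs]; ring] at e4
    exact ⟨e3, e4⟩
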